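/- **Model.** Consider layers $\mathcal K=\{0,\dots,K\}$; layer $k$ has altitude $h_k$, transmission power $P_k>0$, association bias $B_k>0$, and its receivers and transmitters form independent homogeneous Poisson point processes of densities $\lambda_{k,\mathrm{Rx}},\lambda_{k,\mathrm{Tx}}\ge0$ in the horizontal plane, also independent across layers; $\lambda_k=\lambda_{k,\mathrm{Rx}}+\lambda_{k,\mathrm{Tx}}$ and $h_{ij}=|h_i-h_j|$. In doubly indexed quantities the first index is the receiver's layer and the second the transmitter's layer. Independently for all links, a link of (spatial) length $x$ from layer $j$ to layer $i$ is LoS ($c=\mathrm L$) with probability $\rho^{(\mathrm L)}_{ij}(x)$ and NLoS ($c=\mathrm N$) with probability $\rho^{(\mathrm N)}_{ij}(x)=1-\rho^{(\mathrm L)}_{ij}(x)$; it has path-loss exponent $\alpha^{(c)}>0$ and, independently, power gain $G^{(c)}\sim\Gamma(m^{(c)},1/m^{(c)})$ with an integer $m^{(c)}\ge1$. The noise power is $\sigma^2\ge 0$, and $\beta_{ij}>0$ is the target SINR. A typical node of layer $k$ is placed at the origin of its layer (a receiver if $o=\mathrm r$, a transmitter if $o=\mathrm t$). Under the rule $\tau=oa$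 it is associated with the node of $\bigcup_l\Phi_{l,o}$ ($\Phi_{l,\mathrm r}=\Phi_{l,\mathrm{Tx}}$, $\Phi_{l,\mathrm t}=\Phi_{l,\mathrm{Rx}}$, with densities $\lambda_{l,\mathrm r}=\lambda_{l,\mathrm{Tx}}$, $\lambda_{l,\mathrm t}=\lambda_{l,\mathrm{Rx}}$) that maximizes $B_l d^{-1}$ if $a=\mathrm n$, and $B_l d^{-\alpha^{(c)}}$ if $a=\mathrm s$, where $d$ is the link length and $c$ the state of the link. If the main link, from a layer-$j$ transmitter to a layer-$i$ receiver, has state $c$ and length $y$ (the event $\varepsilon^{(c)}_{ij,\tau}(y)$), then $\mathrm{SINR}=P_jG^{(c)}y^{-\alpha^{(c)}}/\mathcal I_i$, where $\mathcal I_i$ is $\sigma^2$ plus the sum of the powers $P_kG^{(c_o)}x^{-\alpha^{(c_o)}}$ that this receiver gets from all other transmitters of all layers. The STP $\mathcal P_{k,\tau}$ of layer $k$ is the probability that the SINR of the main link of the typical node exceeds the target $\beta_{ij}$ of its pair of layers. The ASE $\mathcal S_{k,\tau}$ of layer $k$ is the density of the associating nodes of layer $k$ ($\lambda_{k,\mathrm{Rx}}$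 for $o=\mathrm r$, $\lambda_{k,\mathrm{Tx}}$ for $o=\mathrm t$) times the expected data rate, which is $R_{ij}=\log_2(1+\beta_{ij})$ if the SINR of the main link exceeds $\beta_{ij}$ and $0$ otherwise. **Notation.** For a receiver layer $i$ and a transmitter layer $j$ let $(u,v)=(i,j)$ if $o=\mathrm r$ and $(u,v)=(j,i)$ if $o=\mathrm t$ (associating layer, selected layer). Write $\varrho^{(c)}_{ul}=\rho^{(c)}_{ul}$ if $o=\mathrm r$ and $\varrho^{(c)}_{ul}=\rho^{(c)}_{lu}$ if $o=\mathrm t$, and let $$\bar F_{V_{ul}^{(c)}}(x)=\exp\Big[-\int_{h_{ul}}^{\max(x,h_{ul})}2\pi\lambda_{l,o}\,t\,\varrho_{ul}^{(c)}(t)\,dt\Big],\qquad f_{V_{ul}^{(c)}}(x)=2\pi\lambda_{l,o}\,x\,\varrho_{ul}^{(c)}(x)\exp\Big[-\int_{h_{ul}}^{x}2\pi\lambda_{l,o}\,t\,\varrho_{ul}^{(c)}(t)\,dt\Big]$$ for $x\ge h_{ul}$, $f_{V_{ul}^{(c)}}(x)=0$ for $x<h_{ul}$. Let $R^{(c,c_o)}_{v,l}(y)=yB_l/B_v$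 if $a=\mathrm n$ and $(y^{\alpha^{(c)}}B_l/B_v)^{1/\alpha^{(c_o)}}$ if $a=\mathrm s$, $$\mathcal A^{(c)}_{ij,\tau}=\int_0^\infty f_{V_{uv}^{(c)}}(x)\prod_{(l,c_o)\ne(v,c)}\bar F_{V_{ul}^{(c_o)}}\big(R^{(c,c_o)}_{v,l}(x)\big)dx,\qquad f_{Y^{(c)}_{ij,\tau}}(y)=\frac{f_{V_{uv}^{(c)}}(y)}{\mathcal A^{(c)}_{ij,\tau}}\prod_{(l,c_o)\ne(v,c)}\bar F_{V_{ul}^{(c_o)}}\big(R^{(c,c_o)}_{v,l}(y)\big)$$ (with $f_{Y^{(c)}_{ij,\tau}}=0$ if $\mathcal A^{(c)}_{ij,\tau}=0$). Let $\chi_k^{(c_o)}(y)=R^{(c,c_o)}_{j,k}(y)$ if $o=\mathrm r$ and $0$ if $o=\mathrm t$, and $$\mathcal L_{ij,\tau}^{(c)}(y;s)=e^{-s\sigma^2}\prod_{k\in\mathcal K,\,c_o\in\{\mathrm L,\mathrm N\}}\exp\Big[-2\pi\lambda_{k,\mathrm{Tx}}\int_{\max(\chi_k^{(c_o)}(y),h_{ik})}^\infty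 x\rho_{ik}^{(c_o)}(x)\Big(1-\Big(1+\tfrac{sP_kx^{-\alpha^{(c_o)}}}{m^{(c_o)}}\Big)^{-m^{(c_o)}}\Big)dx\Big],$$ where $e^{-\infty}=0$ and $0\cdot\infty=0$. **Lemma 3.** $\mathcal A^{(c)}_{ij,\tau}$ is the probability that the main link of the typical node of layer $u$ has its receiver in layer $i$, its transmitter in layer $j$ and state $c$; given this event, $f_{Y^{(c)}_{ij,\tau}}$ is the density of the main link length, and $\mathcal L^{(c)}_{ij,\tau}(y;\cdot)$ is, on $(0,\infty)$, the Laplace transform of $\mathcal I_i$ given $\varepsilon^{(c)}_{ij,\tau}(y)$. The conditional STP $p^{(c)}_{ij,\tau}(y)=\mathbb P[\mathrm{SINR}>\beta_{ij}\mid\varepsilon^{(c)}_{ij,\tau}(y)]$ is $$p^{(c)}_{ij,\tau}(y)=\sum_{n=0}^{m^{(c)}-1}\frac{(-s)^n}{n!}\frac{d^n}{ds^n}\mathcal L^{(c)}_{ij,\tau}(y;s)\Big|_{s=l^{(c)}_{ij}(y)},\qquad l^{(c)}_{ij}(y)=\frac{m^{(c)}\beta_{ij}}{P_jy^{-\alpha^{(c)}}}.$$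 (Conditioning on $\varepsilon^{(c)}_{ij,\tau}(y)$ is understood as disintegration with respect to the main link length.) With $f_{\mathcal P}(i,j,c,\tau)=\mathcal A^{(c)}_{ij,\tau}\int_{h_{ij}}^\infty p^{(c)}_{ij,\tau}(y)f_{Y^{(c)}_{ij,\tau}}(y)\,dy$, for every layer $k$, $$\mathcal P_{k,\tau}=\begin{cases}\sum_{j\in\mathcal K,\,c}f_{\mathcal P}(k,j,c,\tau)&o=\mathrm r,\\ \sum_{i\in\mathcal K,\,c}f_{\mathcal P}(i,k,c,\tau)&o=\mathrm t,\end{cases}\qquad \mathcal S_{k,\tau}=\begin{cases}\sum_{j\in\mathcal K,\,c}(\lambda_k-\lambda_{k,o})R_{kj}f_{\mathcal P}(k,j,c,\tau)&o=\mathrm r,\\ \sum_{i\in\mathcal K,\,c}(\lambda_k-\lambda_{k,o})R_{ik}f_{\mathcal P}(i,k,c,\tau)&o=\mathrm t.\end{cases}$$ -/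

import Mathlib

open MeasureTheory ProbabilityTheory
open scoped ENNReal NNReal

namespace MAN

/-- Channel environment of a link: line of sight or non line of sight. -/
inductive Channel
  | los
  | nlos
  deriving DecidableEq

instance : Fintype Channel := ⟨{Channel.los, Channel.nlos}, fun c => by cases c <;> simp⟩

/-- The two kinds of nodes of a layer. -/
inductive Role
  | tx
  | rx

/-- Association subject: the receiver selects a transmitter, or the transmitter selects a
receiver. -/
inductive Subject
  | receiver
  | transmitter

/-- Association criterion: (biased) nearest distance or (biased) strongest power. -/
inductive Criterion
  | nearest
  | strongest

/-- The parameters of a network with layers `0, …, K`. In every doubly indexed quantity the first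
index is the layer of the receiver and the second one the layer of the transmitter. -/
structure Params (K : ℕ) where
  /-- altitude of a layer -/
  alt : Fin (K + 1) → ℝ
  /-- transmission power -/
  power : Fin (K + 1) → ℝ
  /-- association bias -/
  bias : Fin (K + 1) → ℝ
  /-- density of the nodes of a layer that have a given role -/
  dens : Role → Fin (K + 1) → ℝ
  /-- probability that a link of given length is line of sight -/
  rhoLoS : Fin (K + 1) → Fin (K + 1) → ℝ → ℝ
  /-- path loss exponent -/
  alpha : Channel → ℝ
  /-- Nakagami fading parameter -/
  m : Channel → ℕ
  /-- noise power `σ²` -/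
  noise : ℝ
  /-- target SINR -/
  beta : Fin (K + 1) → Fin (K + 1) → ℝ
  power_pos : ∀ k, 0 < power k
  bias_pos : ∀ k, 0 < bias k
  dens_nonneg : ∀ r k, 0 ≤ dens r k
  rhoLoS_measurable : ∀ i j, Measurable (rhoLoS i j)
  rhoLoS_mem : ∀ i j x, |alt i - alt j| ≤ x → rhoLoS i j x ∈ Set.Icc (0 : ℝ) 1
  alpha_pos : ∀ c, 0 < alpha c
  m_pos : ∀ c, 1 ≤ m c
  noise_nonneg : 0 ≤ noise
  beta_pos : ∀ i j, 0 < beta i j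

/-- The horizontal plane. -/
abbrev Plane : Type := EuclideanSpace ℝ (Fin 2)

/-- Names of nodes: `none` is the typical node, `some (l, n)` is the `n`-th node of layer `l`. -/
abbrev Node (K : ℕ) : Type := Option (Fin (K + 1) × ℕ)

/-- The counting measure of the (finitely or infinitely many) points `x n`, `n < N`. -/
noncomputable def countingMeasure (N : ℕ∞) (x : ℕ → Plane) : Measure Plane :=
  Measure.sum fun n : ℕ => if (n : ℕ∞) < N then Measure.dirac (x n) else 0

/-- The random points `X n`, `n < N`, form a Poisson point process with intensity measure `Λ`. -/
structure IsPoissonProcess {Ω : Type*} [MeasurableSpace Ω] (μ : Measure Ω)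
    (N : Ω → ℕ∞) (X : ℕ → Ω → Plane) (Λ : Measure Plane) : Prop where
  measurable_num : Measurable N
  measurable_pos : ∀ n, Measurable (X n)
  law_count : ∀ B : Set Plane, MeasurableSet B → Λ B ≠ ∞ → ∀ n : ℕ,
    μ {ω | countingMeasure (N ω) (fun i => X i ω) B = n} = poissonMeasure (Λ B).toNNReal {n}
  indep_count : ∀ (r : ℕ) (B : Fin r → Set Plane), (∀ i, MeasurableSet (B i)) →
    Pairwise (fun i j => Disjoint (B i) (B j)) →
    iIndepFun (fun i ω => countingMeasure (N ω) (fun n => X n ω) (B i)) μ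

/-- A realization of the network on a probability space, seen from a typical node that is placed
above the origin. The receivers and the transmitters of the layers form independent homogeneous
Poisson processes. Every pair (transmitter, receiver) carries an independent uniform variable,
which decides whether the link is line of sight, and independent Nakagami power gains
`G ∼ Γ(m, 1/m)` for the two channel environments. -/
structure Network {K : ℕ} (p : Params K) {Ω : Type*} [MeasurableSpace Ω] (μ : Measure Ω) where
  /-- number of nodes of a role in a layer -/
  num : Role → Fin (K + 1) → Ω → ℕ∞
  /-- horizontal positions of these nodes -/
  pos : Role → Fin (K + 1) → ℕ → Ω → Plane
  /-- uniform variable of the link from the first node (transmitter) to the second (receiver) -/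
  unif : Node K → Node K → Ω → ℝ
  /-- power gains of the link from the first node (transmitter) to the second (receiver) -/
  gain : Channel → Node K → Node K → Ω → ℝ
  poisson : ∀ r k, IsPoissonProcess μ (num r k) (pos r k) (ENNReal.ofReal (p.dens r k) • volume)
  unif_measurable : ∀ t r, Measurable (unif t r)
  unif_law : ∀ t r, μ.map (unif t r) = volume.restrict (Set.Icc (0 : ℝ) 1)
  gain_measurable : ∀ c t r, Measurable (gain c t r)
  gain_law : ∀ c t r, μ.map (gain c t r) = gammaMeasure (p.m c) (p.m c)
  nodes_indep : iIndepFun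
    (fun (q : Role × Fin (K + 1)) ω => (num q.1 q.2 ω, fun n => pos q.1 q.2 n ω)) μ
  marks_indep : iIndepFun
    (fun (q : Option Channel × Node K × Node K) ω =>
      q.1.elim (unif q.2.1 q.2.2 ω) (fun c => gain c q.2.1 q.2.2 ω)) μ
  nodes_marks_indep : IndepFun
    (fun ω (q : Role × Fin (K + 1)) => (num q.1 q.2 ω, fun n => pos q.1 q.2 n ω))
    (fun ω (q : Option Channel × Node K × Node K) =>
      q.1.elim (unif q.2.1 q.2.2 ω) (fun c => gain c q.2.1 q.2.2 ω)) μ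

/-! ### The random quantities of the network -/

namespace Network

variable {K : ℕ} {p : Params K} {Ω : Type*} [MeasurableSpace Ω] {μ : Measure Ω}

/-- The layer of a node, when the typical node belongs to layer `k`. -/
def layerOf (k : Fin (K + 1)) (v : Node K) : Fin (K + 1) := v.elim k Prod.fst

/-- The horizontal position of a node; the typical node is at the origin. -/
noncomputable def place (net : Network p μ) (r : Role) (v : Node K) (ω : Ω) : Plane :=
  v.elim 0 (fun q => net.pos r q.1 q.2 ω)

/-- The layer `q.1` has at least `q.2 + 1` nodes of role `r`, so that its `q.2`-th point exists. -/
def Active (net : Network p μ) (r : Role) (q : Fin (K + 1) × ℕ) (ω : Ω) : Prop :=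
  (q.2 : ℕ∞) < net.num r q.1 ω

/-- Link distance (in space) between transmitter `t` and receiver `r`. -/
noncomputable def linkDist (net : Network p μ) (k : Fin (K + 1)) (t r : Node K) (ω : Ω) : ℝ :=
  Real.sqrt (‖net.place Role.tx t ω - net.place Role.rx r ω‖ ^ 2
    + (p.alt (layerOf k r) - p.alt (layerOf k t)) ^ 2)

/-- Channel environment of the link from `t` to `r`. -/
noncomputable def linkChannel (net : Network p μ) (k : Fin (K + 1)) (t r : Node K) (ω : Ω) :
    Channel :=
  if net.unif t r ω ≤ p.rhoLoS (layerOf k r) (layerOf k t) (net.linkDist k t r ω)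
  then Channel.los else Channel.nlos

/-- Power received by `r` from the transmitter `t`. -/
noncomputable def rxPower (net : Network p μ) (k : Fin (K + 1)) (t r : Node K) (ω : Ω) : ℝ :=
  p.power (layerOf k t) * net.gain (net.linkChannel k t r ω) t r ω
    * net.linkDist k t r ω ^ (-p.alpha (net.linkChannel k t r ω))

open Classical in
/-- Total interference plus noise at receiver `r` when `t` is its transmitter: the sum over all
transmitters of the network other than `t`, plus the noise power. -/
noncomputable def interferencePlusNoise (net : Network p μ) (k : Fin (K + 1)) (t r : Node K)
    (ω : Ω) : ℝ≥0∞ :=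
  (∑' q : Fin (K + 1) × ℕ, if net.Active Role.tx q ω ∧ some q ≠ t
    then ENNReal.ofReal (net.rxPower k (some q) r ω) else 0) + ENNReal.ofReal p.noise

/-- SINR of the link from `t` to `r`. -/
noncomputable def sinr (net : Network p μ) (k : Fin (K + 1)) (t r : Node K) (ω : Ω) : ℝ≥0∞ :=
  ENNReal.ofReal (net.rxPower k t r ω) / net.interferencePlusNoise k t r ω

end Network

/-- The role of the nodes among which the typical node selects. -/
def Subject.candRole : Subject → Role
  | .receiver => Role.tx
  | .transmitter => Role.rx

/-- The transmitter of the link between the typical node and the candidate `q`. -/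
def Subject.txNode {K : ℕ} (o : Subject) (q : Fin (K + 1) × ℕ) : Node K :=
  match o with
  | .receiver => some q
  | .transmitter => none

/-- The receiver of the link between the typical node and the candidate `q`. -/
def Subject.rxNode {K : ℕ} (o : Subject) (q : Fin (K + 1) × ℕ) : Node K :=
  match o with
  | .receiver => none
  | .transmitter => some q

/-- The layer of the selecting node of a link from layer `j` to layer `i`. -/
def Subject.selecting {K : ℕ} (o : Subject) (i j : Fin (K + 1)) : Fin (K + 1) :=
  match o with
  | .receiver => i
  | .transmitter => j

/-- The layer of the selected node of a link from layer `j` to layer `i`. -/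
def Subject.selected {K : ℕ} (o : Subject) (i j : Fin (K + 1)) : Fin (K + 1) :=
  match o with
  | .receiver => j
  | .transmitter => i

namespace Network

variable {K : ℕ} {p : Params K} {Ω : Type*} [MeasurableSpace Ω] {μ : Measure Ω}

/-- The quantity that the association rule maximizes, for the typical node of layer `k` and the
candidate `q`. -/
noncomputable def score (net : Network p μ) (o : Subject) (a : Criterion) (k : Fin (K + 1))
    (q : Fin (K + 1) × ℕ) (ω : Ω) : ℝ :=
  match a with
  | .nearest => p.bias q.1 * (net.linkDist k (o.txNode q) (o.rxNode q) ω)⁻¹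
  | .strongest => p.bias q.1 * net.linkDist k (o.txNode q) (o.rxNode q) ω
      ^ (-p.alpha (net.linkChannel k (o.txNode q) (o.rxNode q) ω))

/-- The typical node of layer `k` is associated with the node `q`. -/
def Associated (net : Network p μ) (o : Subject) (a : Criterion) (k : Fin (K + 1))
    (q : Fin (K + 1) × ℕ) (ω : Ω) : Prop :=
  net.Active o.candRole q ω ∧
    ∀ q' : Fin (K + 1) × ℕ, net.Active o.candRole q' ω →
      net.score o a k q' ω ≤ net.score o a k q ω

/-- The typical node of layer `k` is associated with the node `q`, and the main link has channel
environment `c` and a length in `B`. -/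
def mainLink (net : Network p μ) (o : Subject) (a : Criterion) (k : Fin (K + 1))
    (q : Fin (K + 1) × ℕ) (c : Channel) (B : Set ℝ) : Set Ω :=
  {ω | net.Associated o a k q ω ∧ net.linkChannel k (o.txNode q) (o.rxNode q) ω = c ∧
    net.linkDist k (o.txNode q) (o.rxNode q) ω ∈ B}

/-- The SINR of the link between the typical node of layer `k` and the node `q` exceeds the target
of that pair of layers. -/
def succeeds (net : Network p μ) (o : Subject) (k : Fin (K + 1)) (q : Fin (K + 1) × ℕ) : Set Ω :=
  {ω | ENNReal.ofReal
      (p.beta (layerOf k (o.rxNode q)) (layerOf k (o.txNode q)))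
    < net.sinr k (o.txNode q) (o.rxNode q) ω}

/-- Successful transmission probability of layer `k`: the probability that the SINR of the main
link of the typical node of layer `k` exceeds its target. -/
noncomputable def stp (net : Network p μ) (o : Subject) (a : Criterion) (k : Fin (K + 1)) : ℝ :=
  μ.real {ω | ∃ q, net.Associated o a k q ω ∧ ω ∈ net.succeeds o k q}

/-- Data rate of the typical node of layer `k`: `log₂ (1 + β)` if the main link succeeds (`β` is
the target SINR of the two layers of the main link), `0` otherwise. -/
noncomputable def rate (net : Network p μ) (o : Subject) (a : Criterion) (k : Fin (K + 1))
    (ω : Ω) : ℝ :=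
  ∑ l : Fin (K + 1), Set.indicator
    {ω' | ∃ n : ℕ, net.Associated o a k (l, n) ω' ∧ ω' ∈ net.succeeds o k (l, n)}
    (fun _ => Real.logb 2
      (1 + p.beta (layerOf k (o.rxNode (l, 0))) (layerOf k (o.txNode (l, 0))))) ω

/-- Area spectral efficiency of layer `k`: the density of the selecting nodes of layer `k` times
their expected data rate. -/
noncomputable def ase (net : Network p μ) (o : Subject) (a : Criterion) (k : Fin (K + 1)) : ℝ :=
  (match o with
    | .receiver => p.dens Role.rx k
    | .transmitter => p.dens Role.tx k) * ∫ ω, net.rate o a k ω ∂μ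

end Network

/-! ### The analytic expressions -/

/-- `exp (-t)`, with `exp (-∞) = 0`. -/
noncomputable def expNeg (t : ℝ≥0∞) : ℝ := if t = ∞ then 0 else Real.exp (-t.toReal)

namespace Params

variable {K : ℕ} (p : Params K)

/-- Altitude difference `h_{ij}`. -/
noncomputable def hdiff (i j : Fin (K + 1)) : ℝ := |p.alt i - p.alt j|

/-- Probability that a link of length `x` from layer `j` to layer `i` has environment `c`. -/
noncomputable def rho (i j : Fin (K + 1)) (c : Channel) (x : ℝ) : ℝ :=
  match c with
  | .los => p.rhoLoS i j x
  | .nlos => 1 - p.rhoLoS i j x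

/-- The same probability for a selecting node in layer `k` and a candidate in layer `l`. -/
noncomputable def rhoSel (o : Subject) (k l : Fin (K + 1)) (c : Channel) (x : ℝ) : ℝ :=
  match o with
  | .receiver => p.rho k l c x
  | .transmitter => p.rho l k c x

/-- Density of the candidates in layer `l`. -/
def candDens (o : Subject) (l : Fin (K + 1)) : ℝ := p.dens o.candRole l

/-- Density of all nodes of a layer. -/
noncomputable def totalDens (l : Fin (K + 1)) : ℝ := p.dens Role.rx l + p.dens Role.tx l

/-- `∫_{h_{kl}}^v 2 π λ x ρ(x) dx`. -/
noncomputable def nearestExponent (o : Subject) (k l : Fin (K + 1)) (c : Channel) (v : ℝ) : ℝ :=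
  ∫ x in (p.hdiff k l)..v, 2 * Real.pi * p.candDens o l * x * p.rhoSel o k l c x

/-- PDF of the distance `V` from a selecting node in layer `k` to the nearest candidate of layer `l`
with environment `c`. -/
noncomputable def nearestPDF (o : Subject) (k l : Fin (K + 1)) (c : Channel) (v : ℝ) : ℝ :=
  if v < p.hdiff k l then 0
  else 2 * Real.pi * p.candDens o l * v * p.rhoSel o k l c v
    * Real.exp (-p.nearestExponent o k l c v)

/-- CCDF of the same distance. -/
noncomputable def nearestCCDF (o : Subject) (k l : Fin (K + 1)) (c : Channel) (v : ℝ) : ℝ :=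
  Real.exp (-p.nearestExponent o k l c (max v (p.hdiff k l)))

/-- When the selected node lies in layer `l`, with environment `c` and at distance `y`, the
candidates of layer `l'` with environment `c'` are at distance at least `exclusion`. -/
noncomputable def exclusion (a : Criterion) (l l' : Fin (K + 1)) (c c' : Channel) (y : ℝ) : ℝ :=
  match a with
  | .nearest => y * p.bias l' / p.bias l
  | .strongest => (y ^ p.alpha c * p.bias l' / p.bias l) ^ (1 / p.alpha c')

/-- `f_V(y)` times the product of the other CCDFs, for a selecting node in layer `k` and a selected
node in layer `l`. -/
noncomputable def assocDensity (o : Subject) (a : Criterion) (k l : Fin (K + 1)) (c : Channel)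
    (y : ℝ) : ℝ :=
  p.nearestPDF o k l c y *
    ∏ q ∈ (Finset.univ : Finset (Fin (K + 1) × Channel)).erase (l, c),
      p.nearestCCDF o k q.1 q.2 (p.exclusion a l q.1 c q.2 y)

/-- Association probability of a receiver in layer `i` and a transmitter in layer `j` with
environment `c`. -/
noncomputable def assocProb (o : Subject) (a : Criterion) (i j : Fin (K + 1)) (c : Channel) : ℝ :=
  ∫ x in Set.Ioi 0, p.assocDensity o a (o.selecting i j) (o.selected i j) c x

/-- PDF of the main link distance between a receiver in layer `i` and a transmitter in layer `j`
with environment `c`. -/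
noncomputable def mainPDF (o : Subject) (a : Criterion) (i j : Fin (K + 1)) (c : Channel)
    (y : ℝ) : ℝ :=
  p.assocDensity o a (o.selecting i j) (o.selected i j) c y / p.assocProb o a i j c

/-- Distance below which there is no interferer of layer `k` with environment `c'`. -/
noncomputable def chi (o : Subject) (a : Criterion) (j k : Fin (K + 1)) (c c' : Channel)
    (y : ℝ) : ℝ :=
  match o with
  | .receiver => p.exclusion a j k c c' y
  | .transmitter => 0

/-- Laplace transform at `s` of the interference from the transmitters of layer `k` with
environment `c'`, when the main link goes from layer `j` to layer `i`, has environment `c` and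
length `y`. -/
noncomputable def lapInterference (o : Subject) (a : Criterion) (i j : Fin (K + 1)) (c : Channel)
    (y : ℝ) (k : Fin (K + 1)) (c' : Channel) (s : ℝ) : ℝ :=
  expNeg (ENNReal.ofReal (2 * Real.pi * p.dens Role.tx k) *
    ∫⁻ x in Set.Ioi (max (p.chi o a j k c c' y) (p.hdiff i k)),
      ENNReal.ofReal (x * p.rho i k c' x *
        (1 - (1 / (1 + s * p.power k * x ^ (-p.alpha c') / p.m c')) ^ p.m c')))

/-- Laplace transform at `s` of the total interference plus noise. -/
noncomputable def lapTotal (o : Subject) (a : Criterion) (i j : Fin (K + 1)) (c : Channel)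
    (y s : ℝ) : ℝ :=
  Real.exp (-s * p.noise) *
    ∏ q : Fin (K + 1) × Channel, p.lapInterference o a i j c y q.1 q.2 s

/-- `l(y) = m β / (P y^{-α})`. -/
noncomputable def lapArg (i j : Fin (K + 1)) (c : Channel) (y : ℝ) : ℝ :=
  p.m c * p.beta i j / (p.power j * y ^ (-p.alpha c))

/-- Success probability of a main link from layer `j` to layer `i` with environment `c` and
length `y`. -/
noncomputable def condSTP (o : Subject) (a : Criterion) (i j : Fin (K + 1)) (c : Channel)
    (y : ℝ) : ℝ :=
  ∑ n ∈ Finset.range (p.m c),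
    (-p.lapArg i j c y) ^ n / (n.factorial : ℝ) *
      iteratedDeriv n (fun s => p.lapTotal o a i j c y s) (p.lapArg i j c y)

/-- `f_P(i, j, c, τ)`. -/
noncomputable def fP (o : Subject) (a : Criterion) (i j : Fin (K + 1)) (c : Channel) : ℝ :=
  p.assocProb o a i j c *
    ∫ y in Set.Ioi (p.hdiff i j), p.condSTP o a i j c y * p.mainPDF o a i j c y

/-- Data rate `R_{ij} = log₂ (1 + β_{ij})`. -/
noncomputable def dataRate (i j : Fin (K + 1)) : ℝ := Real.logb 2 (1 + p.beta i j)

end Params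

end MAN

namespace MAN

open Filter Topology

/-! ### The decreasing exponential on `[0, ∞]` -/

/-! Association, channel state and interference are put into a single exponential. For an existing
candidate to be the main link with environment `c`, no other candidate may beat its score: a node
that does so receives the exponent `∞`, and a node that interferes receives `s` times its received
power. The sum `totalVar` of these contributions over all nodes satisfies `nexp totalVar = 1_{main
link} * exp (-s * interference)` (`ite_mul_nexp_eq`, where the noise is a separate factor). Working
in `[0, ∞]` with `nexp ∞ = 0` keeps this valid when the interference diverges.

For fixed positions the contributions are independent, because distinct nodes use distinct links
(`linkOf_injective`), so averaging over the marks gives a product over the nodes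
(`lintegral_nexp_totalVar`). The sum over all candidates is then evaluated by the Mecke formula:
seen from the selected point, the other points form Poisson processes with the original intensities,
and their Laplace functional is `exp (-∫ (1 - meanFactor))` (`mecke_of_iIndepFun`). In its own
process the selected point acts only through a real threshold, its score; the Mecke formula for such
functionals follows from the independence of counts on disjoint sets, by way of simple functions and
discretised thresholds. Polar coordinates reduce all integrals to link lengths. Splitting `1 -
meanFactor` by environment is the thinning into LoS and NLoS processes: the forbidden candidates
produce the CCDFs and the remaining transmitters the interference factors (`totExp_eq`,
`mainDens_one`).

The sum over candidates is the expected number of main links, and it is a probability only if the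
associated node is almost surely unique. For this a margin `κ` is carried along. With `κ > 1` two
nodes at positive distance cannot both win, so the expected number of winners is at most the
probability that there is one; as `κ → 1` the expectation converges, because ties of scores form a
null set (`ae_associated_unique`).

For the success probability, the gain of the main link is independent of everything that enters
`totalVar` (`lintegral_gain_resample`). Integrating it out leaves the tail of a Gamma law with
integer shape, `∑ (l v)^n / n! * exp (-l v)`, where `v` is the interference plus noise. The mean of
`v^n * exp (-l v)` is `(-1)^n` times the `n`-th derivative at `l` of the Laplace transform of `v`,
whence the formula for `condSTP`. As `l` depends on the length `y` of the main link, the conditional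
law of `v` given `y` is realised as a kernel, and its Laplace transform is identified off one null
set of `y` for all `s > 0` (`ae_lintegral_nexp_kernel`, `condSTP_spec`). STP and ASE follow by
adding up almost surely disjoint events over layers and environments. -/

/-- `exp (-u)` as a function from `[0, ∞]` to `[0, ∞]`. -/
noncomputable def nexp (u : ℝ≥0∞) : ℝ≥0∞ := (EReal.exp u)⁻¹

/-- `-log h` for `h ≤ 1`, the inverse of `nexp`. -/
noncomputable def nlog (h : ℝ≥0∞) : ℝ≥0∞ := (ENNReal.log h⁻¹).toENNReal

@[simp] lemma nexp_zero : nexp 0 = 1 := by simp [nexp]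

@[simp] lemma nexp_top : nexp ∞ = 0 := by simp [nexp]

lemma nexp_add (u v : ℝ≥0∞) : nexp (u + v) = nexp u * nexp v := by
  have h : ∀ u : ℝ≥0∞, EReal.exp (u : EReal) ≠ 0 := fun u => by simp
  rw [nexp, EReal.coe_ennreal_add, EReal.exp_add, ENNReal.mul_inv (Or.inl (h u)) (Or.inr (h v))]
  rfl

lemma nexp_antitone : Antitone nexp := fun u v h => by
  refine ENNReal.inv_le_inv.2 (EReal.exp_monotone ?_)
  exact_mod_cast h

lemma nexp_le_one (u : ℝ≥0∞) : nexp u ≤ 1 := by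
  simpa using nexp_antitone (zero_le : 0 ≤ u)

lemma nexp_ne_top (u : ℝ≥0∞) : nexp u ≠ ∞ := ((nexp_le_one u).trans_lt ENNReal.one_lt_top).ne

lemma continuous_nexp : Continuous nexp :=
  continuous_inv.comp (ENNReal.continuous_exp.comp continuous_coe_ennreal_ereal)

lemma measurable_nexp : Measurable nexp := continuous_nexp.measurable

@[fun_prop]
lemma _root_.Measurable.nexp {α : Type*} [MeasurableSpace α] {f : α → ℝ≥0∞} (hf : Measurable f) :
    Measurable fun a => MAN.nexp (f a) := measurable_nexp.comp hf

lemma nexp_ofReal {x : ℝ} (hx : 0 ≤ x) : nexp (ENNReal.ofReal x) = ENNReal.ofReal (Real.exp (-x)) := by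
  rw [nexp, EReal.coe_ennreal_ofReal, max_eq_left hx, EReal.exp_coe,
    ← ENNReal.ofReal_inv_of_pos (Real.exp_pos x), Real.exp_neg]

lemma nexp_of_ne_top {u : ℝ≥0∞} (hu : u ≠ ∞) : nexp u = ENNReal.ofReal (Real.exp (-u.toReal)) := by
  rw [← nexp_ofReal ENNReal.toReal_nonneg, ENNReal.ofReal_toReal hu]

lemma toReal_nexp (u : ℝ≥0∞) : (nexp u).toReal = expNeg u := by
  rcases eq_or_ne u ∞ with rfl | hu
  · simp [expNeg]
  · rw [nexp_of_ne_top hu, expNeg, if_neg hu, ENNReal.toReal_ofReal (Real.exp_pos _).le]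

lemma ofReal_expNeg (u : ℝ≥0∞) : ENNReal.ofReal (expNeg u) = nexp u := by
  rw [← toReal_nexp, ENNReal.ofReal_toReal (nexp_ne_top u)]

lemma expNeg_nonneg (u : ℝ≥0∞) : 0 ≤ expNeg u := by
  rw [← toReal_nexp]; exact ENNReal.toReal_nonneg

lemma nexp_sum {ι : Type*} (s : Finset ι) (f : ι → ℝ≥0∞) :
    nexp (∑ i ∈ s, f i) = ∏ i ∈ s, nexp (f i) := by
  classical
  induction s using Finset.induction_on with
  | empty => simp
  | insert i s hi ih => rw [Finset.sum_insert hi, Finset.prod_insert hi, nexp_add, ih]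

lemma nexp_nat_mul (n : ℕ) (u : ℝ≥0∞) : nexp (n * u) = nexp u ^ n := by
  induction n with
  | zero => simp
  | succ n ih => rw [Nat.cast_succ, add_mul, one_mul, nexp_add, ih, pow_succ]

/-- Partial products are `nexp` of partial sums, and sums in `[0, ∞]` always converge, so infinite
products of numbers in `[0, 1]` need no separate theory. -/
lemma tendsto_prod_nexp {ι : Type*} (f : ι → ℝ≥0∞) :
    Tendsto (fun s : Finset ι => ∏ i ∈ s, nexp (f i)) atTop (𝓝 (nexp (∑' i, f i))) := by
  simp_rw [← nexp_sum]
  exact (continuous_nexp.tendsto _).comp ENNReal.summable.hasSum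

/-- For `h ≤ 1` one has `log h⁻¹ ≥ 0`, so the truncation `toENNReal` in `nlog` loses nothing. -/
lemma nexp_nlog {h : ℝ≥0∞} (hh : h ≤ 1) : nexp (nlog h) = h := by
  have h0 : 0 ≤ ENNReal.log h⁻¹ := by simpa using hh
  rw [nexp, nlog, EReal.coe_toENNReal h0, ENNReal.exp_log, inv_inv]

lemma nlog_nexp (u : ℝ≥0∞) : nlog (nexp u) = u := by
  rw [nlog, nexp, inv_inv, EReal.log_exp, EReal.toENNReal_coe]

@[simp] lemma nlog_one : nlog 1 = 0 := by simp [nlog]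

lemma nlog_antitone : Antitone nlog := fun _ _ h =>
  EReal.toENNReal_le_toENNReal (ENNReal.log_monotone (ENNReal.inv_le_inv.2 h))

lemma measurable_nlog : Measurable nlog :=
  (EReal.continuous_toENNReal.comp
    (ENNReal.continuous_log.comp continuous_inv)).measurable

@[fun_prop]
lemma _root_.Measurable.nlog {α : Type*} [MeasurableSpace α] {f : α → ℝ≥0∞} (hf : Measurable f) :
    Measurable fun a => MAN.nlog (f a) := measurable_nlog.comp hf

/-! ### Generalities on integration and independence -/

section General

variable {Ω : Type*} [MeasurableSpace Ω] {μ : Measure Ω}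

/-- Convergence from below implies convergence of the integrals. -/
lemma tendsto_lintegral_of_le {f : ℕ → Ω → ℝ≥0∞} {g : Ω → ℝ≥0∞} (hf : ∀ k, Measurable (f k))
    (hle : ∀ k ω, f k ω ≤ g ω) (hlim : ∀ ω, Tendsto (fun k => f k ω) atTop (𝓝 (g ω))) :
    Tendsto (fun k => ∫⁻ ω, f k ω ∂μ) atTop (𝓝 (∫⁻ ω, g ω ∂μ)) := by
  -- The lower bound is Fatou's lemma and the upper bound is `hle`. Neither monotonicity in `k` nor
  -- integrability of `g` is needed, so the limit may be infinite.
  refine tendsto_of_le_liminf_of_limsup_le ?_ ?_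
  · calc ∫⁻ ω, g ω ∂μ = ∫⁻ ω, liminf (fun k => f k ω) atTop ∂μ := by
          simp_rw [fun ω => (hlim ω).liminf_eq]
      _ ≤ _ := lintegral_liminf_le hf
  · exact limsup_le_of_le (by isBoundedDefault)
      (Eventually.of_forall fun k => lintegral_mono (hle k))

lemma tendsto_tsum_of_le {ι : Type*} {f : ℕ → ι → ℝ≥0∞} {g : ι → ℝ≥0∞}
    (hle : ∀ k i, f k i ≤ g i) (hlim : ∀ i, Tendsto (fun k => f k i) atTop (𝓝 (g i))) :
    Tendsto (fun k => ∑' i, f k i) atTop (𝓝 (∑' i, g i)) := by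
  let : MeasurableSpace ι := ⊤
  simp_rw [← lintegral_count]
  exact tendsto_lintegral_of_le (fun k => measurable_from_top) hle hlim

/-- Independence factorises the finite products, and dominated convergence with bound `1` passes to
the limit. The product of means is rewritten as `nexp` of a sum of `nlog`s because a sum over nodes
of this kind is what the point process formulas take as input. -/
lemma lintegral_nexp_tsum {ι : Type*} [Countable ι] {Z : ι → Ω → ℝ≥0∞} (hZ : ∀ i, Measurable (Z i))
    (hind : iIndepFun Z μ) :
    ∫⁻ ω, nexp (∑' i, Z i ω) ∂μ = nexp (∑' i, nlog (∫⁻ ω, nexp (Z i ω) ∂μ)) := by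
  have : IsProbabilityMeasure μ := hind.isProbabilityMeasure
  have hle : ∀ i, ∫⁻ ω, nexp (Z i ω) ∂μ ≤ 1 := fun i =>
    (lintegral_mono fun ω => nexp_le_one _).trans (by simp)
  have h1 : Tendsto (fun s : Finset ι => ∫⁻ ω, ∏ i ∈ s, nexp (Z i ω) ∂μ) atTop
      (𝓝 (∫⁻ ω, nexp (∑' i, Z i ω) ∂μ)) := by
    refine tendsto_lintegral_filter_of_dominated_convergence (fun _ => 1)
      (Eventually.of_forall fun s => ?_) (Eventually.of_forall fun s => ?_) (by simp) ?_
    · exact Finset.measurable_prod _ fun i _ => (hZ i).nexp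
    · exact Eventually.of_forall fun ω => Finset.prod_le_one' fun i _ => nexp_le_one _
    · exact Eventually.of_forall fun ω => tendsto_prod_nexp _
  have h2 := tendsto_prod_nexp fun i => nlog (∫⁻ ω, nexp (Z i ω) ∂μ)
  refine tendsto_nhds_unique h1 (h2.congr fun s => ?_)
  rw [lintegral_prod_eq_prod_lintegral_of_indepFun s (fun i ω => nexp (Z i ω))
    (hind.comp (fun _ => nexp) fun _ => measurable_nexp) fun i => (hZ i).nexp]
  exact Finset.prod_congr rfl fun i _ => nexp_nlog (hle i)

/-- Fubini for the joint law. It is used to average over the marks first, with the positions frozen.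
-/
lemma lintegral_comp_of_indepFun [IsFiniteMeasure μ] {α β : Type*} [MeasurableSpace α]
    [MeasurableSpace β] {X : Ω → α} {Y : Ω → β} (hX : Measurable X) (hY : Measurable Y)
    (h : IndepFun X Y μ) {F : α → β → ℝ≥0∞} (hF : Measurable fun q : α × β => F q.1 q.2) :
    ∫⁻ ω, F (X ω) (Y ω) ∂μ = ∫⁻ ω, ∫⁻ ω', F (X ω) (Y ω') ∂μ ∂μ := by
  have h1 := (indepFun_iff_map_prod_eq_prod_map_map hX.aemeasurable hY.aemeasurable).1 h
  calc ∫⁻ ω, F (X ω) (Y ω) ∂μ = ∫⁻ q, F q.1 q.2 ∂(μ.map fun ω => (X ω, Y ω)) := by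
        rw [lintegral_map hF (hX.prodMk hY)]
    _ = ∫⁻ x, ∫⁻ y, F x y ∂(μ.map Y) ∂(μ.map X) := by
        rw [h1, lintegral_prod _ hF.aemeasurable]
    _ = ∫⁻ x, ∫⁻ ω', F x (Y ω') ∂μ ∂(μ.map X) := by
        refine lintegral_congr fun x => ?_
        exact lintegral_map (f := fun y => F x y) (hF.comp measurable_prodMk_left) hY
    _ = _ := by
        rw [lintegral_map _ hX]
        exact Measurable.lintegral_prod_right' (f := fun q : α × Ω => F q.1 (Y q.2))
          (hF.comp (measurable_fst.prodMk (hY.comp measurable_snd)))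

/-- One member of an independent family can be replaced by an independent copy. -/
lemma lintegral_update_of_iIndepFun [IsFiniteMeasure μ] {ι β : Type*} [DecidableEq ι]
    [MeasurableSpace β] {f : ι → Ω → β} (hf : ∀ i, Measurable (f i)) (hind : iIndepFun f μ) (i : ι)
    {F : (ι → β) → ℝ≥0∞} (hF : Measurable F) :
    ∫⁻ ω, F (fun j => f j ω) ∂μ
      = ∫⁻ ω, ∫⁻ ω', F (Function.update (fun j => f j ω) i (f i ω')) ∂μ ∂μ := by
  let R : Ω → ({j // j ≠ i} → β) := fun ω j => f j ω
  have hR : Measurable R := measurable_pi_lambda _ fun j => hf j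
  have hRi : IndepFun R (f i) μ := by
    have h := indep_iSup_of_disjoint (fun j => (hf j).comap_le) hind.iIndep
      (S := {j | j ≠ i}) (T := {i}) (by simp)
    refine indep_of_indep_of_le_left (indep_of_indep_of_le_right h ?_) ?_
    · simp
    · rw [← measurable_iff_comap_le]
      refine @measurable_pi_lambda _ _ _ (_) _ _ fun j => ?_
      rw [measurable_iff_comap_le]
      exact le_iSup₂_of_le j.1 j.2 le_rfl
  let G : ({j // j ≠ i} → β) → β → (ι → β) := fun r b j => if h : j = i then b else r ⟨j, h⟩
  have hG : Measurable fun q : ({j // j ≠ i} → β) × β => G q.1 q.2 := by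
    refine measurable_pi_lambda _ fun j => ?_
    by_cases h : j = i
    · simp only [G, h, dite_true]; exact measurable_snd
    · simp only [G, h, dite_false]; exact (measurable_pi_apply _).comp measurable_fst
  have h1 : ∀ ω ω', G (R ω) (f i ω') = Function.update (fun j => f j ω) i (f i ω') := by
    intro ω ω'
    funext j
    by_cases h : j = i
    · subst h; simp [G]
    · simp [G, h, R]
  have h2 := lintegral_comp_of_indepFun hR (hf i) hRi (F := fun r b => F (G r b)) (hF.comp hG)
  simp only [h1] at h2
  rw [← h2]
  simp

end General

/-! ### Sums over the points of a configuration -/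

/-- A configuration of finitely or infinitely many numbered points. -/
abbrev Config : Type := ℕ∞ × (ℕ → Plane)

/-- The sum of `φ` over the points of a configuration. -/
noncomputable def pointSum (ξ : Config) (φ : Plane → ℝ≥0∞) : ℝ≥0∞ :=
  ∑' n : ℕ, if (n : ℕ∞) < ξ.1 then φ (ξ.2 n) else 0

/-- The sum of `φ` over the points of a configuration other than the `n`-th one. -/
noncomputable def reducedSum (ξ : Config) (n : ℕ) (φ : Plane → ℝ≥0∞) : ℝ≥0∞ :=
  ∑' m : ℕ, if (m : ℕ∞) < ξ.1 ∧ m ≠ n then φ (ξ.2 m) else 0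

lemma measurableSet_natCast_lt (n : ℕ) : MeasurableSet {ξ : Config | (n : ℕ∞) < ξ.1} :=
  measurable_fst (MeasurableSet.of_discrete (s := Set.Ioi (n : ℕ∞)))

lemma measurable_pointSum {α : Type*} [MeasurableSpace α] {φ : α → Plane → ℝ≥0∞}
    (hφ : Measurable fun q : α × Plane => φ q.1 q.2) :
    Measurable fun q : α × Config => pointSum q.2 (φ q.1) := by
  refine Measurable.tsum fun n => Measurable.ite ?_ ?_ measurable_const
  · exact measurable_snd (measurableSet_natCast_lt n)
  · exact hφ.comp (measurable_fst.prodMk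
      ((measurable_pi_apply n).comp (measurable_snd.comp measurable_snd)))

lemma measurable_reducedSum {α : Type*} [MeasurableSpace α] {φ : α → Plane → ℝ≥0∞} (n : ℕ)
    (hφ : Measurable fun q : α × Plane => φ q.1 q.2) :
    Measurable fun q : α × Config => reducedSum q.2 n (φ q.1) := by
  refine Measurable.tsum fun m => Measurable.ite ?_ ?_ measurable_const
  · exact (measurable_snd (measurableSet_natCast_lt m)).inter (MeasurableSet.const _)
  · exact hφ.comp (measurable_fst.prodMk
      ((measurable_pi_apply m).comp (measurable_snd.comp measurable_snd)))

lemma lintegral_countingMeasure (ξ : Config) {φ : Plane → ℝ≥0∞} (hφ : Measurable φ) :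
    ∫⁻ x, φ x ∂(countingMeasure ξ.1 ξ.2) = pointSum ξ φ := by
  rw [countingMeasure, lintegral_sum_measure, pointSum]
  refine tsum_congr fun n => ?_
  split_ifs <;> simp [lintegral_dirac' _ hφ]

lemma countingMeasure_apply (ξ : Config) {B : Set Plane} (hB : MeasurableSet B) :
    countingMeasure ξ.1 ξ.2 B = pointSum ξ (B.indicator 1) := by
  rw [← lintegral_countingMeasure ξ (measurable_one.indicator hB), lintegral_indicator_one hB]

lemma pointSum_eq_add_reducedSum (ξ : Config) {n : ℕ} (hn : (n : ℕ∞) < ξ.1) (φ : Plane → ℝ≥0∞) :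
    pointSum ξ φ = φ (ξ.2 n) + reducedSum ξ n φ := by
  rw [pointSum, ENNReal.tsum_eq_add_tsum_ite n, if_pos hn, reducedSum]
  congr 1
  refine tsum_congr fun m => ?_
  by_cases h : m = n <;> simp [h]

lemma reducedSum_add (ξ : Config) (n : ℕ) (φ ψ : Plane → ℝ≥0∞) :
    reducedSum ξ n (φ + ψ) = reducedSum ξ n φ + reducedSum ξ n ψ := by
  rw [reducedSum, reducedSum, reducedSum, ← ENNReal.tsum_add]
  refine tsum_congr fun m => ?_
  split_ifs <;> simp

lemma reducedSum_const_mul (ξ : Config) (n : ℕ) (c : ℝ≥0∞) (φ : Plane → ℝ≥0∞) :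
    reducedSum ξ n (fun x => c * φ x) = c * reducedSum ξ n φ := by
  rw [reducedSum, reducedSum, ← ENNReal.tsum_mul_left]
  refine tsum_congr fun m => ?_
  split_ifs <;> simp

/-! ### Sums of Poisson weights -/

/-- The probability generating function of the Poisson law; `t = nexp a` turns it into the Laplace
transform. -/
lemma tsum_pow_mul_poisson {t : ℝ≥0∞} (ht : t ≤ 1) (r : ℝ≥0) :
    ∑' n : ℕ, t ^ n * ENNReal.ofReal (Real.exp (-r) * r ^ n / n.factorial)
      = nexp ((1 - t) * r) := by
  lift t to ℝ≥0 using (ht.trans_lt ENNReal.one_lt_top).ne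
  have ht' : (t : ℝ) ≤ 1 := by exact_mod_cast ht
  have h1 : ∀ n : ℕ, (t : ℝ≥0∞) ^ n * ENNReal.ofReal (Real.exp (-r) * r ^ n / n.factorial)
      = ENNReal.ofReal (Real.exp (-r) * ((t * r) ^ n / n.factorial)) := by
    intro n
    rw [← ENNReal.ofReal_coe_nnreal, ← ENNReal.ofReal_pow t.coe_nonneg, ← ENNReal.ofReal_mul (by positivity)]
    congr 1
    ring
  have h2 : HasSum (fun n : ℕ => Real.exp (-r) * ((t * r : ℝ) ^ n / n.factorial))
      (Real.exp (-r) * Real.exp (t * r)) := by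
    rw [Real.exp_eq_exp_ℝ]
    exact (NormedSpace.expSeries_div_hasSum_exp (t * r : ℝ)).mul_left _
  simp_rw [h1]
  rw [← ENNReal.ofReal_tsum_of_nonneg (fun n => by positivity) h2.summable, h2.tsum_eq,
    ← Real.exp_add]
  have h3 : (1 - (t : ℝ≥0∞)) * r = ENNReal.ofReal ((1 - t) * r) := by
    rw [ENNReal.ofReal_mul (by linarith), ENNReal.ofReal_sub _ t.coe_nonneg]
    simp
  rw [h3, nexp_ofReal (mul_nonneg (by linarith) r.coe_nonneg)]
  congr 2
  ring

/-- The derivative of the generating function in `t`. The factor `n` kills the term `n = 0`, where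
`n - 1` is truncated, and a shift by one leads back to the generating function. -/
lemma tsum_mul_pow_mul_poisson {t : ℝ≥0∞} (ht : t ≤ 1) (r : ℝ≥0) :
    ∑' n : ℕ, n * t ^ (n - 1) * ENNReal.ofReal (Real.exp (-r) * r ^ n / n.factorial)
      = r * nexp ((1 - t) * r) := by
  rw [tsum_eq_zero_add' ENNReal.summable, ← tsum_pow_mul_poisson ht, ← ENNReal.tsum_mul_left]
  simp only [Nat.cast_zero, zero_mul, zero_add, Nat.add_sub_cancel]
  refine tsum_congr fun n => ?_
  rw [mul_comm ((n + 1 : ℕ) : ℝ≥0∞), mul_assoc, mul_left_comm (r : ℝ≥0∞)]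
  congr 1
  rw [← ENNReal.ofReal_coe_nnreal, ← ENNReal.ofReal_mul r.coe_nonneg, ← ENNReal.ofReal_natCast,
    ← ENNReal.ofReal_mul (by positivity), Nat.factorial_succ]
  congr 1
  push_cast
  field_simp
  ring

/-! ### Functionals of a single Poisson process -/

section Poisson

variable {Ω : Type*} [MeasurableSpace Ω] {μ : Measure Ω} {N : Ω → ℕ∞} {X : ℕ → Ω → Plane}
  {Λ : Measure Plane}

/-- The random configuration of a process. -/
def config (N : Ω → ℕ∞) (X : ℕ → Ω → Plane) (ω : Ω) : Config := (N ω, fun n => X n ω)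

namespace IsPoissonProcess

lemma measurable_config (h : IsPoissonProcess μ N X Λ) : Measurable (config N X) :=
  h.measurable_num.prodMk (measurable_pi_lambda _ h.measurable_pos)

lemma measurable_count (h : IsPoissonProcess μ N X Λ) {B : Set Plane} (hB : MeasurableSet B) :
    Measurable fun ω => countingMeasure (N ω) (fun n => X n ω) B := by
  have h1 := (measurable_pointSum (α := Unit) (φ := fun _ => B.indicator 1)
    ((measurable_one.indicator hB).comp measurable_snd)).comp
    (measurable_const.prodMk h.measurable_config : Measurable fun ω => ((), config N X ω))
  convert h1 using 2 with ω
  exact countingMeasure_apply (config N X ω) hB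

lemma lintegral_count [IsProbabilityMeasure μ] (h : IsPoissonProcess μ N X Λ) {B : Set Plane}
    (hB : MeasurableSet B) (hfin : Λ B ≠ ∞) (ψ : ℝ≥0∞ → ℝ≥0∞) :
    ∫⁻ ω, ψ (countingMeasure (N ω) (fun n => X n ω) B) ∂μ
      = ∑' n : ℕ, ψ n * ENNReal.ofReal
          (Real.exp (-(Λ B).toNNReal) * (Λ B).toNNReal ^ n / n.factorial) := by
  set C : Ω → ℝ≥0∞ := fun ω => countingMeasure (N ω) (fun n => X n ω) B
  have hC : Measurable C := h.measurable_count hB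
  have hS : ∀ n : ℕ, MeasurableSet (C ⁻¹' {(n : ℝ≥0∞)}) := fun n => hC (measurableSet_singleton _)
  have hdisj : Pairwise (Function.onFun Disjoint fun n : ℕ => C ⁻¹' {(n : ℝ≥0∞)}) := by
    intro m n hmn
    exact Disjoint.preimage _ (Set.disjoint_singleton.2 (by exact_mod_cast hmn))
  have hlaw : ∀ n : ℕ, μ (C ⁻¹' {(n : ℝ≥0∞)}) = poissonMeasure (Λ B).toNNReal {n} :=
    fun n => h.law_count B hB hfin n
  -- A priori the count is an element of `[0, ∞]`. The Poisson weights add up to one, so it is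
  -- almost surely a natural number.
  have huniv : μ (⋃ n : ℕ, C ⁻¹' {(n : ℝ≥0∞)}) = 1 := by
    rw [measure_iUnion hdisj hS]
    simp_rw [hlaw]
    rw [← measure_iUnion (fun m n hmn => Set.disjoint_singleton.2 hmn)
      (fun n => MeasurableSet.of_discrete), Set.iUnion_of_singleton, measure_univ]
  have hae : ∀ᵐ ω ∂μ, ω ∈ ⋃ n : ℕ, C ⁻¹' {(n : ℝ≥0∞)} := by
    rwa [← prob_compl_eq_zero_iff (MeasurableSet.iUnion hS)] at huniv
  calc ∫⁻ ω, ψ (C ω) ∂μ = ∫⁻ ω in ⋃ n : ℕ, C ⁻¹' {(n : ℝ≥0∞)}, ψ (C ω) ∂μ := by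
        rw [Measure.restrict_eq_self_of_ae_mem hae]
    _ = ∑' n : ℕ, ∫⁻ ω in C ⁻¹' {(n : ℝ≥0∞)}, ψ (C ω) ∂μ := lintegral_iUnion hS hdisj _
    _ = _ := by
        refine tsum_congr fun n => ?_
        rw [← poissonMeasure_singleton, ← hlaw n, ← setLIntegral_const]
        refine setLIntegral_congr_fun (hS n) fun ω hω => ?_
        rw [show C ω = n from hω]

lemma lintegral_nexp_mul_count [IsProbabilityMeasure μ] (h : IsPoissonProcess μ N X Λ)
    {B : Set Plane} (hB : MeasurableSet B) (hfin : Λ B ≠ ∞) (a : ℝ≥0∞) :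
    ∫⁻ ω, nexp (a * countingMeasure (N ω) (fun n => X n ω) B) ∂μ = nexp ((1 - nexp a) * Λ B) := by
  rw [h.lintegral_count hB hfin fun u => nexp (a * u)]
  simp_rw [mul_comm a, nexp_nat_mul]
  rw [tsum_pow_mul_poisson (nexp_le_one a), ENNReal.coe_toNNReal hfin]

/-- The Mecke formula in its smallest instance: each of the `C` points of `B` sees `C - 1` others,
all of weight `a`. -/
lemma lintegral_count_mul_nexp [IsProbabilityMeasure μ] (h : IsPoissonProcess μ N X Λ)
    {B : Set Plane} (hB : MeasurableSet B) (hfin : Λ B ≠ ∞) (a : ℝ≥0∞) :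
    ∫⁻ ω, countingMeasure (N ω) (fun n => X n ω) B
        * nexp (a * (countingMeasure (N ω) (fun n => X n ω) B - 1)) ∂μ
      = Λ B * nexp ((1 - nexp a) * Λ B) := by
  rw [h.lintegral_count hB hfin fun u => u * nexp (a * (u - 1))]
  have h1 : ∀ n : ℕ, (n : ℝ≥0∞) * nexp (a * (n - 1)) = n * nexp a ^ (n - 1) := by
    intro n
    rw [← nexp_nat_mul, ENNReal.natCast_sub, Nat.cast_one, mul_comm a]
  simp_rw [h1]
  rw [tsum_mul_pow_mul_poisson (nexp_le_one a), ENNReal.coe_toNNReal hfin]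

lemma lintegral_prod_count (h : IsPoissonProcess μ N X Λ) {ι : Type*} [Fintype ι]
    {B : ι → Set Plane} (hB : ∀ i, MeasurableSet (B i))
    (hdisj : Pairwise (fun i j => Disjoint (B i) (B j))) {ψ : ι → ℝ≥0∞ → ℝ≥0∞}
    (hψ : ∀ i, Measurable (ψ i)) :
    ∫⁻ ω, ∏ i, ψ i (countingMeasure (N ω) (fun n => X n ω) (B i)) ∂μ
      = ∏ i, ∫⁻ ω, ψ i (countingMeasure (N ω) (fun n => X n ω) (B i)) ∂μ := by
  let e := Fintype.equivFin ι
  have h1 := h.indep_count _ (fun i => B (e.symm i)) (fun i => hB _)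
    fun i j hij => hdisj (e.symm.injective.ne hij)
  have h2 := h1.precomp e.injective
  have h3 : iIndepFun (fun i ω => ψ i (countingMeasure (N ω) (fun n => X n ω) (B i))) μ := by
    have := h2.comp ψ hψ
    simpa [Function.comp_def] using this
  exact lintegral_prod_eq_prod_lintegral_of_indepFun Finset.univ _ h3
    fun i => (hψ i).comp (h.measurable_count (hB i))

end IsPoissonProcess

end Poisson

/-- Dominated convergence twice, in `ω` and then in `n` for the counting measure. -/
lemma tendsto_tsum_lintegral {Ω : Type*} [MeasurableSpace Ω] {μ : Measure Ω}
    {F : ℕ → ℕ → Ω → ℝ≥0∞} {G G' : ℕ → Ω → ℝ≥0∞} (hF : ∀ k n, Measurable (F k n))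
    (hle : ∀ k n ω, F k n ω ≤ G n ω) (hG : ∑' n, ∫⁻ ω, G n ω ∂μ ≠ ∞)
    (hlim : ∀ n ω, Tendsto (fun k => F k n ω) atTop (𝓝 (G' n ω))) :
    Tendsto (fun k => ∑' n, ∫⁻ ω, F k n ω ∂μ) atTop (𝓝 (∑' n, ∫⁻ ω, G' n ω ∂μ)) := by
  simp_rw [← lintegral_count (fun n => ∫⁻ ω, _ ∂μ)]
  refine tendsto_lintegral_of_dominated_convergence (fun n => ∫⁻ ω, G n ω ∂μ)
    (fun k => Measurable.of_discrete) (fun k => Eventually.of_forall fun n => ?_) ?_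
    (Eventually.of_forall fun n => ?_)
  · exact lintegral_mono (hle k n)
  · rwa [lintegral_count]
  · exact tendsto_lintegral_of_dominated_convergence (G n) (fun k => hF k n)
      (fun k => Eventually.of_forall (hle k n)) (ENNReal.ne_top_of_tsum_ne_top hG n)
      (Eventually.of_forall (hlim n))

lemma measurable_one_sub_nexp {α : Type*} [MeasurableSpace α] {φ : α → ℝ≥0∞} (hφ : Measurable φ) :
    Measurable fun z => 1 - nexp (φ z) := measurable_const.sub hφ.nexp

section Poisson

variable {Ω : Type*} [MeasurableSpace Ω] {μ : Measure Ω} {N : Ω → ℕ∞} {X : ℕ → Ω → Plane}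
  {Λ : Measure Plane}

namespace IsPoissonProcess

/-- As `f` vanishes on `A`, both factors are functions of the counts on the disjoint sets `A` (index
`none`) and `f ⁻¹' {b} \ A` (index `some b`), which are independent. -/
lemma lintegral_count_mul_nexp_simple [IsProbabilityMeasure μ] (h : IsPoissonProcess μ N X Λ)
    {f : SimpleFunc Plane ℝ≥0∞} (hf : ∀ b, b ≠ 0 → Λ (f ⁻¹' {b}) ≠ ∞) {A : Set Plane}
    (hA : MeasurableSet A) (hfA : ∀ x ∈ A, f x = 0) {ψ : ℝ≥0∞ → ℝ≥0∞}
    (hψ : Measurable ψ) :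
    ∫⁻ ω, ψ (countingMeasure (N ω) (fun n => X n ω) A) * nexp (pointSum (config N X ω) f) ∂μ
      = (∫⁻ ω, ψ (countingMeasure (N ω) (fun n => X n ω) A) ∂μ)
        * nexp (∫⁻ z, (1 - nexp (f z)) ∂Λ) := by
  classical
  let B : Option f.range → Set Plane := fun i => i.elim A fun b => f ⁻¹' {b.1} \ A
  let Ψ : Option f.range → ℝ≥0∞ → ℝ≥0∞ := fun i => i.elim ψ fun b u => nexp (b.1 * u)
  have hB : ∀ i, MeasurableSet (B i) := by
    rintro (_ | b)
    · exact hA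
    · exact (f.measurableSet_fiber b.1).diff hA
  have hΨ : ∀ i, Measurable (Ψ i) := by
    rintro (_ | b)
    · exact hψ
    · exact (measurable_const.mul measurable_id).nexp
  have hdisj : Pairwise fun i j => Disjoint (B i) (B j) := by
    rintro (_ | b) (_ | b') hij
    · exact absurd rfl hij
    · exact Set.disjoint_sdiff_right
    · exact Set.disjoint_sdiff_left
    · have hb : b.1 ≠ b'.1 := fun hb => hij (by rw [Subtype.ext hb])
      exact ((Set.disjoint_singleton.2 hb).preimage f).mono Set.sdiff_subset Set.sdiff_subset
  -- Only the level `0` of `f` can meet `A`, and there the weight `b = 0` makes the removal of `A`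
  -- harmless. The same weight dispenses with finiteness of `Λ` on that level.
  have hdiff : ∀ b : ℝ≥0∞, b ≠ 0 → f ⁻¹' {b} \ A = f ⁻¹' {b} := by
    intro b hb
    refine sdiff_eq_left.2 (Set.disjoint_left.2 fun x hx hxA => hb ?_)
    rw [← show f x = b from hx, hfA x hxA]
  have hmul : ∀ (ν : Measure Plane) (b : ℝ≥0∞), b * ν (f ⁻¹' {b}) = b * ν (f ⁻¹' {b} \ A) := by
    intro ν b
    rcases eq_or_ne b 0 with rfl | hb
    · simp
    · rw [hdiff b hb]
  have h1 : ∀ ω, ψ (countingMeasure (N ω) (fun n => X n ω) A) * nexp (pointSum (config N X ω) f)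
      = ∏ i, Ψ i (countingMeasure (N ω) (fun n => X n ω) (B i)) := by
    intro ω
    rw [Fintype.prod_option]
    congr 1
    rw [← lintegral_countingMeasure _ f.measurable, SimpleFunc.lintegral_eq_lintegral,
      SimpleFunc.lintegral, nexp_sum, ← Finset.prod_coe_sort]
    refine Finset.prod_congr rfl fun b _ => ?_
    rw [hmul]
    rfl
  have h2 : ∀ b : f.range, ∫⁻ ω, Ψ (some b) (countingMeasure (N ω) (fun n => X n ω) (B (some b))) ∂μ
      = nexp ((1 - nexp b.1) * Λ (f ⁻¹' {b.1})) := by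
    intro b
    rcases eq_or_ne b.1 0 with hb | hb
    · simp [Ψ, hb]
    · have := h.lintegral_nexp_mul_count (f.measurableSet_fiber b.1) (hf _ hb) b.1
      simpa only [Ψ, B, Option.elim, hdiff b.1 hb] using this
  simp_rw [h1]
  rw [h.lintegral_prod_count hB hdisj hΨ, Fintype.prod_option]
  congr 1
  simp_rw [h2]
  rw [← nexp_sum]
  congr 1
  have h3 : ∫⁻ z, (1 - nexp (f z)) ∂Λ = ∫⁻ z, (f.map fun b => 1 - nexp b) z ∂Λ := rfl
  rw [h3, SimpleFunc.lintegral_eq_lintegral, SimpleFunc.map_lintegral,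
    ← Finset.sum_coe_sort f.range]

lemma lintegral_nexp_pointSum_simple [IsProbabilityMeasure μ] (h : IsPoissonProcess μ N X Λ)
    {f : SimpleFunc Plane ℝ≥0∞} (hf : ∀ b, b ≠ 0 → Λ (f ⁻¹' {b}) ≠ ∞) :
    ∫⁻ ω, nexp (pointSum (config N X ω) f) ∂μ = nexp (∫⁻ z, (1 - nexp (f z)) ∂Λ) := by
  simpa using h.lintegral_count_mul_nexp_simple hf (A := ∅) MeasurableSet.empty (by simp)
    (ψ := fun _ => 1) measurable_const

/-- The weight of the `n`-th point, if it exists, and of the remaining points. -/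
lemma measurable_weight (h : IsPoissonProcess μ N X Λ) (n : ℕ) {g : Plane → ℝ≥0∞}
    (hg : Measurable g) {φ : Plane → Plane → ℝ≥0∞}
    (hφ : Measurable fun q : Plane × Plane => φ q.1 q.2) :
    Measurable fun ω => if (n : ℕ∞) < N ω then
      g (X n ω) * nexp (reducedSum (config N X ω) n (φ (X n ω))) else 0 := by
  refine Measurable.ite ?_ ((hg.comp (h.measurable_pos n)).mul ?_) measurable_const
  · exact h.measurable_config (measurableSet_natCast_lt n)
  · exact ((measurable_reducedSum n hφ).comp
      ((h.measurable_pos n).prodMk h.measurable_config)).nexp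

/-- With `f = a` on `A` write `f = a * 1_A + f'`. The sum over the points of `A` then depends only
on their number and on the sum of `f'`, which are independent. -/
lemma mecke_simple_of_const [IsProbabilityMeasure μ] (h : IsPoissonProcess μ N X Λ)
    {f : SimpleFunc Plane ℝ≥0∞} (hf : ∀ b, b ≠ 0 → Λ (f ⁻¹' {b}) ≠ ∞) {A : Set Plane}
    (hA : MeasurableSet A) (hfin : Λ A ≠ ∞) {a : ℝ≥0∞} (ha : ∀ x ∈ A, f x = a) :
    ∑' n : ℕ, ∫⁻ ω, (if (n : ℕ∞) < N ω then
        A.indicator 1 (X n ω) * nexp (reducedSum (config N X ω) n f) else 0) ∂μ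
      = Λ A * nexp (∫⁻ z, (1 - nexp (f z)) ∂Λ) := by
  classical
  set f' : SimpleFunc Plane ℝ≥0∞ := f.restrict Aᶜ with hf'_def
  have hf'A : ∀ x ∈ A, f' x = 0 := fun x hx => by
    rw [hf'_def, SimpleFunc.restrict_apply _ hA.compl]; simp [hx]
  have hf'Ac : ∀ x ∉ A, f' x = f x := fun x hx => by
    rw [hf'_def, SimpleFunc.restrict_apply _ hA.compl]; simp [hx]
  have hf' : ∀ b, b ≠ 0 → Λ (f' ⁻¹' {b}) ≠ ∞ := by
    intro b hb
    refine ((measure_mono ?_).trans_lt (hf b hb).lt_top).ne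
    intro x hx
    have hx' : f' x = b := hx
    by_cases hxA : x ∈ A
    · exact absurd (hx'.symm.trans (hf'A x hxA)) hb
    · rw [hf'Ac x hxA] at hx'; exact hx'
  have hsplit : (f : Plane → ℝ≥0∞) = (fun x => a * A.indicator 1 x) + f' := by
    funext x
    by_cases hx : x ∈ A
    · simp [hx, ha x hx, hf'A x hx]
    · simp [hx, hf'Ac x hx]
  let C : Ω → ℝ≥0∞ := fun ω => countingMeasure (N ω) (fun n => X n ω) A
  have hC : ∀ ω, C ω = pointSum (config N X ω) (A.indicator 1) :=
    fun ω => countingMeasure_apply (config N X ω) hA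
  -- Every point of `A` leaves behind `C - 1` points of weight `a` and all of `f'`, so the `C`
  -- nonzero terms coincide.
  have hterm : ∀ ω, ∑' n : ℕ, (if (n : ℕ∞) < N ω then
        A.indicator 1 (X n ω) * nexp (reducedSum (config N X ω) n f) else 0)
      = (C ω * nexp (a * (C ω - 1))) * nexp (pointSum (config N X ω) f') := by
    intro ω
    rw [mul_assoc, hC, pointSum, ← ENNReal.tsum_mul_right]
    refine tsum_congr fun n => ?_
    by_cases hn : (n : ℕ∞) < N ω
    · rw [if_pos hn, if_pos (show (n : ℕ∞) < (config N X ω).1 from hn)]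
      by_cases hx : X n ω ∈ A
      · congr 1
        rw [← nexp_add, ← pointSum]
        congr 1
        have e1 := pointSum_eq_add_reducedSum (config N X ω) hn (A.indicator 1)
        have e2 := pointSum_eq_add_reducedSum (config N X ω) hn f'
        rw [show (config N X ω).2 n = X n ω from rfl] at e1 e2
        rw [Set.indicator_of_mem hx, Pi.one_apply] at e1
        rw [hf'A _ hx, zero_add] at e2
        rw [e1, e2, hsplit, reducedSum_add, reducedSum_const_mul,
          ENNReal.add_sub_cancel_left ENNReal.one_ne_top]
      · have hx' : (config N X ω).2 n ∉ A := hx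
        simp [hx, hx']
    · rw [if_neg hn, if_neg (show ¬ (n : ℕ∞) < (config N X ω).1 from hn), zero_mul]
  rw [← lintegral_tsum fun n => (h.measurable_weight n (measurable_one.indicator hA)
    (φ := fun _ => f) (f.measurable.comp measurable_snd)).aemeasurable]
  simp_rw [hterm]
  rw [h.lintegral_count_mul_nexp_simple hf' hA hf'A (ψ := fun u => u * nexp (a * (u - 1)))
    (measurable_id.mul (measurable_const.mul (measurable_id.sub_const 1)).nexp),
    h.lintegral_count_mul_nexp hA hfin, mul_assoc, ← nexp_add]
  congr 2
  rw [← lintegral_add_compl (fun z => 1 - nexp (f z)) hA]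
  congr 1
  · rw [setLIntegral_congr_fun (g := fun _ => 1 - nexp a) hA fun x hx => by
      simp only [ha x hx], setLIntegral_const]
  · rw [← lintegral_indicator hA.compl]
    refine lintegral_congr fun x => ?_
    by_cases hx : x ∈ A
    · simp [hx, hf'A x hx]
    · simp [hx, hf'Ac x hx]

/-- The set `A` is partitioned by the levels of `f`, on each of which `f` is constant. -/
lemma mecke_simple [IsProbabilityMeasure μ] (h : IsPoissonProcess μ N X Λ)
    {f : SimpleFunc Plane ℝ≥0∞} (hf : ∀ b, b ≠ 0 → Λ (f ⁻¹' {b}) ≠ ∞) {A : Set Plane}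
    (hA : MeasurableSet A) (hfin : Λ A ≠ ∞) :
    ∑' n : ℕ, ∫⁻ ω, (if (n : ℕ∞) < N ω then
        A.indicator 1 (X n ω) * nexp (reducedSum (config N X ω) n f) else 0) ∂μ
      = Λ A * nexp (∫⁻ z, (1 - nexp (f z)) ∂Λ) := by
  classical
  have hms : ∀ b, MeasurableSet (A ∩ f ⁻¹' {b}) := fun b => hA.inter (f.measurableSet_fiber b)
  have hind : ∀ x, A.indicator (1 : Plane → ℝ≥0∞) x
      = ∑ b ∈ f.range, (A ∩ f ⁻¹' {b}).indicator 1 x := by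
    intro x
    rw [Finset.sum_eq_single_of_mem (f x) (SimpleFunc.mem_range_self f x)]
    · by_cases hx : x ∈ A <;> simp [hx]
    · intro b _ hb
      refine Set.indicator_of_notMem (fun hx => hb ?_) _
      exact hx.2.symm
  have h1 : ∀ (n : ℕ) ω, (if (n : ℕ∞) < N ω then
        A.indicator 1 (X n ω) * nexp (reducedSum (config N X ω) n f) else 0)
      = ∑ b ∈ f.range, (if (n : ℕ∞) < N ω then
        (A ∩ f ⁻¹' {b}).indicator 1 (X n ω) * nexp (reducedSum (config N X ω) n f) else 0) := by
    intro n ω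
    split_ifs
    · rw [hind, Finset.sum_mul]
    · simp
  simp_rw [h1]
  simp_rw [fun n : ℕ => lintegral_finsetSum (μ := μ) f.range fun b _ =>
    h.measurable_weight n (measurable_one.indicator (hms b))
    (φ := fun _ => f) (f.measurable.comp measurable_snd)]
  rw [Summable.tsum_finsetSum fun _ _ => ENNReal.summable]
  rw [Finset.sum_congr rfl fun b _ => h.mecke_simple_of_const hf (hms b)
    ((measure_mono Set.inter_subset_left).trans_lt hfin.lt_top).ne (a := b) fun x hx => hx.2,
    ← Finset.sum_mul]
  congr 1
  rw [← lintegral_indicator_one hA]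
  simp_rw [hind]
  rw [lintegral_finsetSum _ fun b _ => measurable_one.indicator (hms b)]
  exact Finset.sum_congr rfl fun b _ => (lintegral_indicator_one (hms b)).symm

end IsPoissonProcess

end Poisson

/-! ### From simple functions to the Laplace functional and the Mecke formula -/

/-- Approximation of a measurable function by simple functions with support of finite measure. -/
lemma exists_simpleFunc_tendsto {Λ : Measure Plane} [SigmaFinite Λ] {φ : Plane → ℝ≥0∞}
    (hφ : Measurable φ) : ∃ f : ℕ → SimpleFunc Plane ℝ≥0∞,
      (∀ k b, b ≠ 0 → Λ (f k ⁻¹' {b}) ≠ ∞) ∧ (∀ k x, f k x ≤ φ x) ∧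
      ∀ x, Tendsto (fun k => f k x) atTop (𝓝 (φ x)) := by
  have hS := measurableSet_spanningSets Λ
  have happ : ∀ k x, (SimpleFunc.eapprox φ k).restrict (spanningSets Λ k) x
      = (spanningSets Λ k).indicator (SimpleFunc.eapprox φ k) x := fun k x =>
    SimpleFunc.restrict_apply _ (hS k) x
  refine ⟨fun k => (SimpleFunc.eapprox φ k).restrict (spanningSets Λ k), ?_, ?_, ?_⟩
  · intro k b hb
    refine ((measure_mono ?_).trans_lt (measure_spanningSets_lt_top Λ k)).ne
    intro x hx
    by_contra hxS
    refine hb ?_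
    have hx' : (SimpleFunc.eapprox φ k).restrict (spanningSets Λ k) x = b := hx
    rw [← hx', happ, Set.indicator_of_notMem hxS]
  · intro k x
    rw [happ]
    refine (Set.indicator_le_self _ _ x).trans ?_
    exact SimpleFunc.iSup_eapprox_apply hφ x ▸ le_iSup (fun n => SimpleFunc.eapprox φ n x) k
  · intro x
    obtain ⟨k₀, hk₀⟩ := Set.mem_iUnion.1 ((iUnion_spanningSets Λ).symm ▸ Set.mem_univ x)
    refine (SimpleFunc.tendsto_eapprox hφ x).congr' ?_
    filter_upwards [eventually_ge_atTop k₀] with k hk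
    rw [happ, Set.indicator_of_mem (monotone_spanningSets Λ hk hk₀)]

/-- The limit may be `∞`, so there is no integrable majorant; the bound `f k ≤ φ` gives convergence
from below, which suffices. -/
lemma tendsto_lintegral_one_sub_nexp {Λ : Measure Plane} {f : ℕ → Plane → ℝ≥0∞}
    {φ : Plane → ℝ≥0∞} (hf : ∀ k, Measurable (f k)) (hle : ∀ k x, f k x ≤ φ x)
    (hlim : ∀ x, Tendsto (fun k => f k x) atTop (𝓝 (φ x))) :
    Tendsto (fun k => ∫⁻ z, (1 - nexp (f k z)) ∂Λ) atTop (𝓝 (∫⁻ z, (1 - nexp (φ z)) ∂Λ)) := by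
  refine tendsto_lintegral_of_le (fun k => measurable_one_sub_nexp (hf k)) (fun k x => ?_)
    fun x => ?_
  · exact tsub_le_tsub_left (nexp_antitone (hle k x)) 1
  · exact ENNReal.Tendsto.sub tendsto_const_nhds ((continuous_nexp.tendsto _).comp (hlim x))
      (Or.inl ENNReal.one_ne_top)

lemma tendsto_pointSum (ξ : Config) {f : ℕ → Plane → ℝ≥0∞}
    {φ : Plane → ℝ≥0∞} (hle : ∀ k x, f k x ≤ φ x)
    (hlim : ∀ x, Tendsto (fun k => f k x) atTop (𝓝 (φ x))) :
    Tendsto (fun k => pointSum ξ (f k)) atTop (𝓝 (pointSum ξ φ)) := by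
  refine tendsto_tsum_of_le (fun k n => ?_) fun n => ?_
  · split_ifs
    exacts [hle _ _, le_rfl]
  · split_ifs
    exacts [hlim _, tendsto_const_nhds]

lemma tendsto_reducedSum (ξ : Config) (n : ℕ) {f : ℕ → Plane → ℝ≥0∞}
    {φ : Plane → ℝ≥0∞} (hle : ∀ k x, f k x ≤ φ x)
    (hlim : ∀ x, Tendsto (fun k => f k x) atTop (𝓝 (φ x))) :
    Tendsto (fun k => reducedSum ξ n (f k)) atTop (𝓝 (reducedSum ξ n φ)) := by
  refine tendsto_tsum_of_le (fun k n => ?_) fun n => ?_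
  · split_ifs
    exacts [hle _ _, le_rfl]
  · split_ifs
    exacts [hlim _, tendsto_const_nhds]

section Poisson

variable {Ω : Type*} [MeasurableSpace Ω] {μ : Measure Ω} {N : Ω → ℕ∞} {X : ℕ → Ω → Plane}
  {Λ : Measure Plane}

namespace IsPoissonProcess

/-- The Laplace functional of a Poisson process. -/
theorem lintegral_nexp_pointSum [IsProbabilityMeasure μ] [SigmaFinite Λ]
    (h : IsPoissonProcess μ N X Λ) {φ : Plane → ℝ≥0∞} (hφ : Measurable φ) :
    ∫⁻ ω, nexp (pointSum (config N X ω) φ) ∂μ = nexp (∫⁻ z, (1 - nexp (φ z)) ∂Λ) := by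
  obtain ⟨f, hf, hle, hlim⟩ := exists_simpleFunc_tendsto (Λ := Λ) hφ
  have h1 : Tendsto (fun k => ∫⁻ ω, nexp (pointSum (config N X ω) (f k)) ∂μ) atTop
      (𝓝 (∫⁻ ω, nexp (pointSum (config N X ω) φ) ∂μ)) := by
    refine tendsto_lintegral_of_dominated_convergence (fun _ => 1) (fun k => ?_)
      (fun k => Eventually.of_forall fun ω => nexp_le_one _) (by simp)
      (Eventually.of_forall fun ω => (continuous_nexp.tendsto _).comp
        (tendsto_pointSum _ hle hlim))
    exact ((measurable_pointSum (α := Unit) (φ := fun _ => f k)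
      ((f k).measurable.comp measurable_snd)).comp
      (measurable_const.prodMk h.measurable_config : Measurable fun ω => ((), config N X ω))).nexp
  refine tendsto_nhds_unique h1 ?_
  simp_rw [fun k => h.lintegral_nexp_pointSum_simple (hf k)]
  exact (continuous_nexp.tendsto _).comp
    (tendsto_lintegral_one_sub_nexp (fun k => (f k).measurable) hle hlim)

/-- Campbell's formula, the case of weight zero. It supplies the summable majorant for the limits
below. -/
lemma tsum_lintegral_indicator [IsProbabilityMeasure μ]
    (h : IsPoissonProcess μ N X Λ) {A : Set Plane}
    (hA : MeasurableSet A) (hfin : Λ A ≠ ∞) :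
    ∑' n : ℕ, ∫⁻ ω, (if (n : ℕ∞) < N ω then A.indicator 1 (X n ω) else 0) ∂μ = Λ A := by
  have h0 := h.mecke_simple (f := 0) (fun b hb => by
    rw [SimpleFunc.coe_zero, Pi.zero_def, Set.preimage_const_of_notMem (by simpa using hb.symm)]
    simp) hA hfin
  simpa [reducedSum] using h0

lemma mecke_of_set [IsProbabilityMeasure μ] [SigmaFinite Λ]
    (h : IsPoissonProcess μ N X Λ) {φ : Plane → ℝ≥0∞} (hφ : Measurable φ) {A : Set Plane}
    (hA : MeasurableSet A) (hfin : Λ A ≠ ∞) :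
    ∑' n : ℕ, ∫⁻ ω, (if (n : ℕ∞) < N ω then
        A.indicator 1 (X n ω) * nexp (reducedSum (config N X ω) n φ) else 0) ∂μ
      = Λ A * nexp (∫⁻ z, (1 - nexp (φ z)) ∂Λ) := by
  obtain ⟨f, hf, hle, hlim⟩ := exists_simpleFunc_tendsto (Λ := Λ) hφ
  have h1 : Tendsto (fun k => ∑' n : ℕ, ∫⁻ ω, (if (n : ℕ∞) < N ω then
        A.indicator 1 (X n ω) * nexp (reducedSum (config N X ω) n (f k)) else 0) ∂μ) atTop
      (𝓝 (∑' n : ℕ, ∫⁻ ω, (if (n : ℕ∞) < N ω then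
        A.indicator 1 (X n ω) * nexp (reducedSum (config N X ω) n φ) else 0) ∂μ)) := by
    refine tendsto_tsum_lintegral
      (G := fun n ω => if (n : ℕ∞) < N ω then A.indicator 1 (X n ω) else 0)
      (fun k n => h.measurable_weight n (measurable_one.indicator hA)
        (φ := fun _ => f k) ((f k).measurable.comp measurable_snd)) (fun k n ω => ?_)
      (by rwa [h.tsum_lintegral_indicator hA hfin]) (fun n ω => ?_)
    · split_ifs
      · exact mul_le_of_le_one_right' (nexp_le_one _)
      · exact le_rfl
    · split_ifs
      · refine ENNReal.Tendsto.const_mul ((continuous_nexp.tendsto _).comp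
          (tendsto_reducedSum _ n hle hlim)) (Or.inr ?_)
        by_cases hx : X n ω ∈ A <;> simp [hx]
      · exact tendsto_const_nhds
  refine tendsto_nhds_unique h1 ?_
  simp_rw [fun k => h.mecke_simple (hf k) hA hfin]
  exact ENNReal.Tendsto.const_mul ((continuous_nexp.tendsto _).comp
    (tendsto_lintegral_one_sub_nexp (fun k => (f k).measurable) hle hlim)) (Or.inr hfin)

/-- The Mecke formula for functionals that depend on the distinguished point through an integer. -/
lemma mecke_of_int [IsProbabilityMeasure μ] [SigmaFinite Λ]
    (h : IsPoissonProcess μ N X Λ) {φ : ℤ → Plane → ℝ≥0∞} (hφ : ∀ j, Measurable (φ j))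
    {c : Plane → ℤ} (hc : Measurable c) {A : Set Plane}
    (hA : MeasurableSet A) (hfin : Λ A ≠ ∞) :
    ∑' n : ℕ, ∫⁻ ω, (if (n : ℕ∞) < N ω then
        A.indicator 1 (X n ω) * nexp (reducedSum (config N X ω) n (φ (c (X n ω)))) else 0) ∂μ
      = ∫⁻ x, A.indicator 1 x * nexp (∫⁻ z, (1 - nexp (φ (c x) z)) ∂Λ) ∂Λ := by
  have hms : ∀ j, MeasurableSet (A ∩ c ⁻¹' {j}) := fun j => hA.inter (hc (measurableSet_singleton j))
  have hkey : ∀ (v : ℤ → ℝ≥0∞) x, A.indicator 1 x * v (c x)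
      = ∑' j, (A ∩ c ⁻¹' {j}).indicator 1 x * v j := by
    intro v x
    rw [tsum_eq_single (c x)]
    · by_cases hx : x ∈ A <;> simp [hx]
    · intro j hj
      rw [Set.indicator_of_notMem (fun hx => hj (by simpa using hx.2.symm)), zero_mul]
  have hR : ∫⁻ x, A.indicator 1 x * nexp (∫⁻ z, (1 - nexp (φ (c x) z)) ∂Λ) ∂Λ
      = ∑' j, Λ (A ∩ c ⁻¹' {j}) * nexp (∫⁻ z, (1 - nexp (φ j z)) ∂Λ) := by
    simp_rw [fun x => hkey (fun j => nexp (∫⁻ z, (1 - nexp (φ j z)) ∂Λ)) x]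
    rw [lintegral_tsum fun j => ((measurable_one.indicator (hms j)).mul_const _).aemeasurable]
    refine tsum_congr fun j => ?_
    rw [lintegral_mul_const _ (measurable_one.indicator (hms j)), lintegral_indicator_one (hms j)]
  rw [hR]
  simp_rw [fun j => (h.mecke_of_set (hφ j) (hms j)
    ((measure_mono Set.inter_subset_left).trans_lt hfin.lt_top).ne).symm]
  rw [ENNReal.tsum_comm]
  refine tsum_congr fun n => ?_
  rw [← lintegral_tsum fun j => (h.measurable_weight n (measurable_one.indicator (hms j))
    (φ := fun _ => φ j) ((hφ j).comp measurable_snd)).aemeasurable]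
  refine lintegral_congr fun ω => ?_
  split_ifs
  · exact hkey (fun j => nexp (reducedSum (config N X ω) n (φ j))) _
  · simp

/-- The threshold `T x` is rounded up to the grid `ℤ / (k + 1)`, which reduces to `mecke_of_int`.
Rounding is upward because `φ` is antitone and right-continuous in the threshold: the rounded
functionals stay below the true one and converge to it. -/
lemma mecke_threshold_of_set [IsProbabilityMeasure μ] [SigmaFinite Λ]
    (h : IsPoissonProcess μ N X Λ) {T : Plane → ℝ} (hT : Measurable T)
    {φ : ℝ → Plane → ℝ≥0∞} (hφ : Measurable fun q : ℝ × Plane => φ q.1 q.2)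
    (hanti : ∀ z, Antitone fun t => φ t z)
    (hcont : ∀ t z, Tendsto (fun t' => φ t' z) (𝓝[≥] t) (𝓝 (φ t z))) {A : Set Plane}
    (hA : MeasurableSet A) (hfin : Λ A ≠ ∞) :
    ∑' n : ℕ, ∫⁻ ω, (if (n : ℕ∞) < N ω then
        A.indicator 1 (X n ω) * nexp (reducedSum (config N X ω) n (φ (T (X n ω)))) else 0) ∂μ
      = ∫⁻ x, A.indicator 1 x * nexp (∫⁻ z, (1 - nexp (φ (T x) z)) ∂Λ) ∂Λ := by
  let c : ℕ → Plane → ℤ := fun k x => ⌈T x * (k + 1)⌉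
  have hc : ∀ k, Measurable (c k) := fun k => Int.measurable_ceil.comp (hT.mul_const _)
  let τ : ℕ → ℤ → ℝ := fun k j => j / (k + 1)
  have hge : ∀ k x, T x ≤ τ k (c k x) := by
    intro k x
    rw [le_div_iff₀ (by positivity)]
    exact Int.le_ceil _
  have hle : ∀ k x, τ k (c k x) ≤ T x + 1 / ((k : ℝ) + 1) := by
    intro k x
    rw [div_le_iff₀ (by positivity), add_mul, one_div, inv_mul_cancel₀ (by positivity)]
    exact (Int.ceil_lt_add_one _).le
  have hτ : ∀ x, Tendsto (fun k => τ k (c k x)) atTop (𝓝[≥] (T x)) := by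
    intro x
    refine tendsto_nhdsWithin_iff.2 ⟨?_, Eventually.of_forall fun k => hge k x⟩
    refine tendsto_of_tendsto_of_tendsto_of_le_of_le tendsto_const_nhds ?_ (fun k => hge k x)
      (fun k => hle k x)
    simpa using tendsto_const_nhds.add (tendsto_one_div_add_atTop_nhds_zero_nat (𝕜 := ℝ))
  have hφt : ∀ t, Measurable (φ t) := fun t => hφ.comp measurable_prodMk_left
  have hφle : ∀ k x z, φ (τ k (c k x)) z ≤ φ (T x) z := fun k x z => hanti z (hge k x)
  have hφlim : ∀ x z, Tendsto (fun k => φ (τ k (c k x)) z) atTop (𝓝 (φ (T x) z)) :=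
    fun x z => (hcont (T x) z).comp (hτ x)
  have hmeas : ∀ k (n : ℕ), Measurable fun ω => if (n : ℕ∞) < N ω then
      A.indicator 1 (X n ω) * nexp (reducedSum (config N X ω) n (φ (τ k (c k (X n ω))))) else 0 := by
    intro k n
    refine h.measurable_weight n (measurable_one.indicator hA) (φ := fun x => φ (τ k (c k x)))
      (hφ.comp (Measurable.prodMk ?_ measurable_snd))
    exact (Measurable.of_discrete (f := τ k)).comp ((hc k).comp measurable_fst)
  have hind : ∀ x, A.indicator (1 : Plane → ℝ≥0∞) x ≠ ∞ := by
    intro x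
    by_cases hx : x ∈ A <;> simp [hx]
  have h1 : Tendsto (fun k => ∑' n : ℕ, ∫⁻ ω, (if (n : ℕ∞) < N ω then A.indicator 1 (X n ω)
        * nexp (reducedSum (config N X ω) n (φ (τ k (c k (X n ω))))) else 0) ∂μ) atTop
      (𝓝 (∑' n : ℕ, ∫⁻ ω, (if (n : ℕ∞) < N ω then A.indicator 1 (X n ω)
        * nexp (reducedSum (config N X ω) n (φ (T (X n ω)))) else 0) ∂μ)) := by
    refine tendsto_tsum_lintegral
      (G := fun n ω => if (n : ℕ∞) < N ω then A.indicator 1 (X n ω) else 0)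
      hmeas (fun k n ω => ?_)
      (by rwa [h.tsum_lintegral_indicator hA hfin]) (fun n ω => ?_)
    · split_ifs
      · exact mul_le_of_le_one_right' (nexp_le_one _)
      · exact le_rfl
    · split_ifs
      · exact ENNReal.Tendsto.const_mul ((continuous_nexp.tendsto _).comp
          (tendsto_reducedSum _ n (fun k => hφle k _) (hφlim _))) (Or.inr (hind _))
      · exact tendsto_const_nhds
  have h2 : Tendsto (fun k => ∫⁻ x, A.indicator 1 x
        * nexp (∫⁻ z, (1 - nexp (φ (τ k (c k x)) z)) ∂Λ) ∂Λ) atTop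
      (𝓝 (∫⁻ x, A.indicator 1 x * nexp (∫⁻ z, (1 - nexp (φ (T x) z)) ∂Λ) ∂Λ)) := by
    refine tendsto_lintegral_of_dominated_convergence (A.indicator 1) (fun k => ?_)
      (fun k => Eventually.of_forall fun x => mul_le_of_le_one_right' (nexp_le_one _))
      (by rwa [lintegral_indicator_one hA]) (Eventually.of_forall fun x => ?_)
    · refine (measurable_one.indicator hA).mul (Measurable.nexp ?_)
      exact (Measurable.of_discrete (f := fun j => ∫⁻ z, (1 - nexp (φ (τ k j) z)) ∂Λ)).comp (hc k)
    · exact ENNReal.Tendsto.const_mul ((continuous_nexp.tendsto _).comp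
        (tendsto_lintegral_one_sub_nexp (fun k => hφt _) (fun k => hφle k x) (hφlim x)))
        (Or.inr (hind x))
  refine tendsto_nhds_unique h1 (h2.congr fun k => ?_)
  exact (h.mecke_of_int (φ := fun j => φ (τ k j)) (fun j => hφt _) (hc k) hA hfin).symm

/-- The Mecke formula for functionals that depend on the distinguished point through a threshold. -/
theorem mecke_threshold [IsProbabilityMeasure μ] [SigmaFinite Λ]
    (h : IsPoissonProcess μ N X Λ) {T : Plane → ℝ} (hT : Measurable T)
    {φ : ℝ → Plane → ℝ≥0∞} (hφ : Measurable fun q : ℝ × Plane => φ q.1 q.2)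
    (hanti : ∀ z, Antitone fun t => φ t z)
    (hcont : ∀ t z, Tendsto (fun t' => φ t' z) (𝓝[≥] t) (𝓝 (φ t z))) {g : Plane → ℝ≥0∞}
    (hg : Measurable g) :
    ∑' n : ℕ, ∫⁻ ω, (if (n : ℕ∞) < N ω then
        g (X n ω) * nexp (reducedSum (config N X ω) n (φ (T (X n ω)))) else 0) ∂μ
      = ∫⁻ x, g x * nexp (∫⁻ z, (1 - nexp (φ (T x) z)) ∂Λ) ∂Λ := by
  have hφT : Measurable fun q : Plane × Plane => φ (T q.1) q.2 :=
    hφ.comp ((hT.comp measurable_fst).prodMk measurable_snd)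
  let W : ℕ → Ω → ℝ≥0∞ := fun n ω => if (n : ℕ∞) < N ω then
    nexp (reducedSum (config N X ω) n (φ (T (X n ω)))) else 0
  have hW : ∀ n, Measurable (W n) := fun n => by
    simpa using h.measurable_weight n (g := 1) measurable_one (φ := fun x => φ (T x)) hφT
  let w : Plane → ℝ≥0∞ := fun x => nexp (∫⁻ z, (1 - nexp (φ (T x) z)) ∂Λ)
  have hw : Measurable w := (Measurable.lintegral_prod_right'
    (f := fun q : Plane × Plane => 1 - nexp (φ (T q.1) q.2)) (measurable_one_sub_nexp hφT)).nexp
  -- Both sides are integrals of `g` against a measure, namely `ρ` and `Λ.withDensity w`, so it is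
  -- enough to compare these on sets of finite `Λ`-measure.
  let ρ : Measure Plane := Measure.sum fun n => (μ.withDensity (W n)).map (X n)
  have hρ : ∀ {g : Plane → ℝ≥0∞}, Measurable g → ∫⁻ x, g x ∂ρ = ∑' n : ℕ, ∫⁻ ω,
      (if (n : ℕ∞) < N ω then
        g (X n ω) * nexp (reducedSum (config N X ω) n (φ (T (X n ω)))) else 0) ∂μ := by
    intro g hg
    rw [lintegral_sum_measure]
    refine tsum_congr fun n => ?_
    rw [lintegral_map hg (h.measurable_pos n),
      lintegral_withDensity_eq_lintegral_mul _ (hW n) (g := fun ω => g (X n ω))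
        (hg.comp (h.measurable_pos n))]
    refine lintegral_congr fun ω => ?_
    by_cases hn : (n : ℕ∞) < N ω <;> simp [W, hn, mul_comm]
  have hρw : ∀ {g : Plane → ℝ≥0∞}, Measurable g → ∫⁻ x, g x ∂(Λ.withDensity w)
      = ∫⁻ x, g x * nexp (∫⁻ z, (1 - nexp (φ (T x) z)) ∂Λ) ∂Λ := by
    intro g hg
    rw [lintegral_withDensity_eq_lintegral_mul _ hw hg]
    exact lintegral_congr fun x => mul_comm _ _
  rw [← hρ hg, ← hρw hg]
  congr 1
  refine Measure.ext_of_iUnion_eq_univ (iUnion_spanningSets Λ) fun i => ?_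
  ext B hB
  have hBi := hB.inter (measurableSet_spanningSets Λ i)
  rw [Measure.restrict_apply hB, Measure.restrict_apply hB, ← lintegral_indicator_one hBi,
    ← lintegral_indicator_one hBi, hρ (measurable_one.indicator hBi),
    hρw (measurable_one.indicator hBi)]
  exact h.mecke_threshold_of_set hT hφ hanti hcont hBi
    ((measure_mono Set.inter_subset_right).trans_lt (measure_spanningSets_lt_top Λ i)).ne

end IsPoissonProcess

end Poisson

/-! ### Several independent Poisson processes -/

section Processes

variable {Ω : Type*} [MeasurableSpace Ω] {μ : Measure Ω} {𝒬 : Type*} [Fintype 𝒬] [DecidableEq 𝒬]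
  {N : 𝒬 → Ω → ℕ∞} {X : 𝒬 → ℕ → Ω → Plane} {Λ : 𝒬 → Measure Plane}

/-- The Mecke formula for a distinguished process among finitely many independent ones. -/
theorem mecke_of_iIndepFun [IsProbabilityMeasure μ] [∀ q, SigmaFinite (Λ q)]
    (h : ∀ q, IsPoissonProcess μ (N q) (X q) (Λ q))
    (hind : iIndepFun (fun q ω => config (N q) (X q) ω) μ) (q₀ : 𝒬)
    {T : Plane → ℝ} (hT : Measurable T)
    {φ₀ : ℝ → Plane → ℝ≥0∞} (hφ₀ : Measurable fun q : ℝ × Plane => φ₀ q.1 q.2)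
    (hanti : ∀ z, Antitone fun t => φ₀ t z)
    (hcont : ∀ t z, Tendsto (fun t' => φ₀ t' z) (𝓝[≥] t) (𝓝 (φ₀ t z)))
    {φ : 𝒬 → Plane → Plane → ℝ≥0∞} (hφ : ∀ q, Measurable fun r : Plane × Plane => φ q r.1 r.2)
    (hφq : ∀ x, φ q₀ x = φ₀ (T x))
    {g : Plane → ℝ≥0∞} (hg : Measurable g) :
    ∑' n : ℕ, ∫⁻ ω, (if (n : ℕ∞) < N q₀ ω then g (X q₀ n ω) *
        nexp (reducedSum (config (N q₀) (X q₀) ω) n (φ q₀ (X q₀ n ω))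
          + ∑ q ∈ Finset.univ.erase q₀, pointSum (config (N q) (X q) ω) (φ q (X q₀ n ω)))
        else 0) ∂μ
      = ∫⁻ x, g x * nexp (∑ q, ∫⁻ z, (1 - nexp (φ q x z)) ∂(Λ q)) ∂(Λ q₀) := by
  have hcfg : ∀ q, Measurable (config (N q) (X q)) := fun q => (h q).measurable_config
  set S := Finset.univ.erase q₀ with hS
  have hφx : ∀ q x, Measurable (φ q x) := fun q x => (hφ q).comp measurable_prodMk_left
  let Y : Ω → S → Config := fun ω q => config (N q) (X q) ω
  have hY : Measurable Y := measurable_pi_lambda _ fun q => hcfg q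
  have hXY : IndepFun (config (N q₀) (X q₀)) Y μ := by
    have h1 := hind.indepFun_finset {q₀} S (by simp [hS]) hcfg
    exact h1.comp (φ := fun v : ({q₀} : Finset 𝒬) → Config => v ⟨q₀, by simp⟩) (ψ := id)
      (measurable_pi_apply (⟨q₀, by simp⟩ : ({q₀} : Finset 𝒬))) measurable_id
  have hsum : ∀ ω x, ∑ q ∈ S, pointSum (config (N q) (X q) ω) (φ q x)
      = ∑ q : S, pointSum (Y ω q) (φ q x) := fun ω x =>
    (Finset.sum_coe_sort S fun q => pointSum (config (N q) (X q) ω) (φ q x)).symm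
  have hpS : ∀ q x, Measurable fun ω => pointSum (config (N q) (X q) ω) (φ q x) := fun q x =>
    (measurable_pointSum (hφ q)).comp (measurable_const.prodMk (hcfg q))
  let w : Plane → ℝ≥0∞ := fun x => nexp (∑ q ∈ S, ∫⁻ z, (1 - nexp (φ q x z)) ∂(Λ q))
  have hw : Measurable w := by
    refine Measurable.nexp (Finset.measurable_sum _ fun q _ => ?_)
    exact Measurable.lintegral_prod_right'
      (f := fun r : Plane × Plane => 1 - nexp (φ q r.1 r.2)) (measurable_one_sub_nexp (hφ q))
  have hinner : ∀ x, ∫⁻ ω, nexp (∑ q : S, pointSum (Y ω q) (φ q x)) ∂μ = w x := by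
    intro x
    simp_rw [← hsum, nexp_sum]
    rw [lintegral_prod_eq_prod_lintegral_of_indepFun S
      (fun q ω => nexp (pointSum (config (N q) (X q) ω) (φ q x)))]
    · simp only [w]
      rw [nexp_sum]
      exact Finset.prod_congr rfl fun q _ => (h q).lintegral_nexp_pointSum (hφx q x)
    · refine hind.comp (fun q ξ => nexp (pointSum ξ (φ q x))) fun q => ?_
      exact ((measurable_pointSum (hφ q)).comp measurable_prodMk_left).nexp
    · exact fun q => (hpS q x).nexp
  -- Once the distinguished point is at `x`, the other processes only contribute their Laplace
  -- functional `w x`, which joins the weight `g`. For them `φ q x` may depend on `x` in any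
  -- measurable way.
  have hn : ∀ n : ℕ, ∫⁻ ω, (if (n : ℕ∞) < N q₀ ω then g (X q₀ n ω) *
        nexp (reducedSum (config (N q₀) (X q₀) ω) n (φ q₀ (X q₀ n ω))
          + ∑ q ∈ S, pointSum (config (N q) (X q) ω) (φ q (X q₀ n ω))) else 0) ∂μ
      = ∫⁻ ω, (if (n : ℕ∞) < N q₀ ω then (g (X q₀ n ω) * w (X q₀ n ω)) *
        nexp (reducedSum (config (N q₀) (X q₀) ω) n (φ₀ (T (X q₀ n ω)))) else 0) ∂μ := by
    intro n
    let F : Config → (S → Config) → ℝ≥0∞ := fun ξ η => if (n : ℕ∞) < ξ.1 then g (ξ.2 n) *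
      nexp (reducedSum ξ n (φ q₀ (ξ.2 n)) + ∑ q : S, pointSum (η q) (φ q (ξ.2 n))) else 0
    have hpt : Measurable fun r : Config × (S → Config) => r.1.2 n :=
      (measurable_pi_apply n).comp (measurable_snd.comp measurable_fst)
    have hF : Measurable fun r : Config × (S → Config) => F r.1 r.2 := by
      refine Measurable.ite (measurable_fst (measurableSet_natCast_lt n))
        ((hg.comp hpt).mul (Measurable.nexp (Measurable.add ?_ ?_))) measurable_const
      · exact (measurable_reducedSum n (hφ q₀)).comp (hpt.prodMk measurable_fst)
      · exact Finset.measurable_sum _ fun q _ => (measurable_pointSum (hφ q)).comp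
          (hpt.prodMk ((measurable_pi_apply q).comp measurable_snd))
    have h1 := lintegral_comp_of_indepFun (hcfg q₀) hY hXY hF
    have h2 : ∀ ω, F (config (N q₀) (X q₀) ω) (Y ω) = if (n : ℕ∞) < N q₀ ω then g (X q₀ n ω) *
        nexp (reducedSum (config (N q₀) (X q₀) ω) n (φ q₀ (X q₀ n ω))
          + ∑ q ∈ S, pointSum (config (N q) (X q) ω) (φ q (X q₀ n ω))) else 0 := fun ω => by
      rw [hsum]; rfl
    simp_rw [h2] at h1
    rw [h1]
    refine lintegral_congr fun ω => ?_
    by_cases hlt : (n : ℕ∞) < N q₀ ω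
    · have hlt' : (n : ℕ∞) < (config (N q₀) (X q₀) ω).1 := hlt
      simp only [F, if_pos hlt, if_pos hlt', nexp_add]
      have hm : Measurable fun ω' => nexp (∑ q : S, pointSum (Y ω' q) (φ q (X q₀ n ω))) := by
        simp_rw [← hsum]
        exact (Finset.measurable_sum _ fun q _ => hpS q _).nexp
      rw [show (config (N q₀) (X q₀) ω).2 n = X q₀ n ω from rfl,
        lintegral_const_mul _ (hm.const_mul _), lintegral_const_mul _ hm, hinner, hφq]
      ring
    · have hlt' : ¬ (n : ℕ∞) < (config (N q₀) (X q₀) ω).1 := hlt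
      simp [F, hlt, hlt']
  simp_rw [hn]
  rw [(h q₀).mecke_threshold hT hφ₀ hanti hcont (g := fun x => g x * w x) (hg.mul hw)]
  refine lintegral_congr fun x => ?_
  rw [mul_assoc, ← nexp_add, ← Finset.sum_erase_add _ _ (Finset.mem_univ q₀), hφq]

end Processes

/-! ### The gamma distribution with integer shape -/

/-- Exponential tilting: `exp (-θ g)` times the density with rate `r` is a constant times the
density with rate `r + θ`. -/
lemma lintegral_exp_neg_mul_gammaMeasure {a r θ : ℝ} (ha : 0 < a) (hr : 0 < r) (hθ : 0 ≤ θ) :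
    ∫⁻ g, ENNReal.ofReal (Real.exp (-(θ * g))) ∂(gammaMeasure a r)
      = ENNReal.ofReal ((r / (r + θ)) ^ a) := by
  have hrθ : 0 < r + θ := by linarith
  rw [gammaMeasure, lintegral_withDensity_eq_lintegral_mul _ (by unfold gammaPDF; fun_prop)
    (by fun_prop)]
  have h1 : ∀ g, (gammaPDF a r * fun g => ENNReal.ofReal (Real.exp (-(θ * g)))) g
      = ENNReal.ofReal ((r / (r + θ)) ^ a) * gammaPDF a (r + θ) g := by
    intro g
    rw [Pi.mul_apply]
    rcases lt_or_ge g 0 with hg | hg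
    · simp [gammaPDF_of_neg hg]
    · rw [gammaPDF_of_nonneg hg, gammaPDF_of_nonneg hg, ← ENNReal.ofReal_mul (by positivity),
        ← ENNReal.ofReal_mul (by positivity)]
      congr 1
      rw [Real.div_rpow hr.le hrθ.le, show -((r + θ) * g) = -(r * g) + -(θ * g) by ring,
        Real.exp_add]
      have : (r + θ) ^ a ≠ 0 := (Real.rpow_pos_of_pos hrθ a).ne'
      field_simp
  simp_rw [h1]
  rw [lintegral_const_mul _ (by unfold gammaPDF; fun_prop), lintegral_gammaPDF_eq_one ha hrθ,
    mul_one]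

/-- The tail of the gamma distribution with integer shape `m` and rate `1`. -/
noncomputable def erlangTail (m : ℕ) (x : ℝ) : ℝ :=
  ∑ k ∈ Finset.range m, x ^ k / (k.factorial : ℝ) * Real.exp (-x)

lemma erlangTail_nonneg (m : ℕ) {x : ℝ} (hx : 0 ≤ x) : 0 ≤ erlangTail m x :=
  Finset.sum_nonneg fun k _ => by positivity

/-- The derivative telescopes: the derivative of each power cancels the exponential's derivative in
the preceding term, and only the last term survives. -/
lemma hasDerivAt_erlangTail (m : ℕ) (x : ℝ) :
    HasDerivAt (erlangTail (m + 1)) (-(x ^ m / (m.factorial : ℝ) * Real.exp (-x))) x := by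
  have hexp : HasDerivAt (fun x : ℝ => Real.exp (-x)) (-Real.exp (-x)) x := by
    simpa using (hasDerivAt_neg x).exp
  induction m with
  | zero =>
    have : erlangTail (0 + 1) = fun x => Real.exp (-x) := by funext x; simp [erlangTail]
    rw [this]
    simpa using hexp
  | succ m ih =>
    have h1 : erlangTail (m + 1 + 1) = fun x => erlangTail (m + 1) x
        + x ^ (m + 1) / ((m + 1).factorial : ℝ) * Real.exp (-x) := by
      funext x
      rw [erlangTail, Finset.sum_range_succ]
      rfl
    rw [h1]
    refine (ih.add (((hasDerivAt_pow (m + 1) x).div_const ((m + 1).factorial : ℝ)).mul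
      hexp)).congr_deriv ?_
    rw [Nat.factorial_succ]
    push_cast
    field_simp
    ring

lemma tendsto_erlangTail (m : ℕ) : Tendsto (erlangTail m) atTop (𝓝 0) := by
  have h : Tendsto (fun x : ℝ => ∑ k ∈ Finset.range m, x ^ k / (k.factorial : ℝ) * Real.exp (-x))
      atTop (𝓝 (∑ k ∈ Finset.range m, (0 : ℝ))) := by
    refine tendsto_finsetSum _ fun k _ => ?_
    have := (Real.tendsto_pow_mul_exp_neg_atTop_nhds_zero k).const_mul ((k.factorial : ℝ)⁻¹)
    rw [mul_zero] at this
    refine this.congr fun x => ?_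
    rw [div_eq_inv_mul, mul_assoc]
  rw [Finset.sum_const_zero] at h
  exact h

/-- The density is minus the derivative of the Erlang tail, which vanishes at infinity. -/
lemma gammaMeasure_Ioi {m : ℕ} (hm : 1 ≤ m) {r x : ℝ} (hr : 0 < r) (hx : 0 ≤ x) :
    gammaMeasure m r (Set.Ioi x) = ENNReal.ofReal (erlangTail m (r * x)) := by
  obtain ⟨k, rfl⟩ : ∃ k, m = k + 1 := ⟨m - 1, by omega⟩
  have hderiv : ∀ t : ℝ, HasDerivAt (fun t => erlangTail (k + 1) (r * t))
      (-(r ^ (k + 1) / k.factorial * t ^ k * Real.exp (-(r * t)))) t := by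
    intro t
    refine ((hasDerivAt_erlangTail k (r * t)).comp t
      ((hasDerivAt_id t).const_mul r)).congr_deriv ?_
    rw [mul_pow]
    ring
  have hlim : Tendsto (fun t => erlangTail (k + 1) (r * t)) atTop (𝓝 0) :=
    (tendsto_erlangTail (k + 1)).comp (tendsto_id.const_mul_atTop hr)
  have hcont : ContinuousWithinAt (fun t => erlangTail (k + 1) (r * t)) (Set.Ici x) x :=
    (hderiv x).continuousAt.continuousWithinAt
  have hneg : ∀ t ∈ Set.Ioi x, -(r ^ (k + 1) / k.factorial * t ^ k * Real.exp (-(r * t))) ≤ 0 := by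
    intro t ht
    have : 0 < t := lt_of_le_of_lt hx ht
    rw [neg_nonpos]
    positivity
  have hint := integral_Ioi_of_hasDerivAt_of_nonpos hcont (fun t _ => hderiv t) hneg hlim
  have hintb := integrableOn_Ioi_deriv_of_nonpos hcont (fun t _ => hderiv t) hneg hlim
  rw [integral_neg, zero_sub, neg_inj] at hint
  have hintb' := hintb.neg
  rw [gammaMeasure, withDensity_apply _ measurableSet_Ioi, ← hint,
    ofReal_integral_eq_lintegral_ofReal (by simpa [IntegrableOn] using hintb')]
  · refine setLIntegral_congr_fun measurableSet_Ioi fun t ht => ?_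
    have ht0 : 0 ≤ t := hx.trans (le_of_lt ht)
    rw [gammaPDF_of_nonneg ht0]
    push_cast
    rw [Real.Gamma_nat_eq_factorial, add_sub_cancel_right, Real.rpow_natCast]
    norm_cast
  · refine (ae_restrict_iff' measurableSet_Ioi).2 (Eventually.of_forall fun t ht => ?_)
    simpa using hneg t ht

lemma gammaMeasure_Iio_zero (a r : ℝ) : gammaMeasure a r (Set.Iio 0) = 0 := by
  rw [gammaMeasure, withDensity_apply _ measurableSet_Iio]
  exact lintegral_gammaPDF_of_nonpos le_rfl

/-! ### Channels -/

lemma sum_channel {M : Type*} [AddCommMonoid M] (f : Channel → M) :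
    ∑ c, f c = f .los + f .nlos := by
  have : (Finset.univ : Finset Channel) = {.los, .nlos} := rfl
  rw [this, Finset.sum_pair (by simp)]

instance : MeasurableSpace Channel := ⊤

instance : DiscreteMeasurableSpace Channel := ⟨fun _ => trivial⟩

/-- The channel environment that a uniform variable `u` decides when the probability of line of
sight is `ρ`. -/
noncomputable def channelOf (ρ u : ℝ) : Channel := if u ≤ ρ then Channel.los else Channel.nlos

lemma measurable_channelOf : Measurable fun q : ℝ × ℝ => channelOf q.1 q.2 :=
  Measurable.ite (measurableSet_le measurable_snd measurable_fst) measurable_const measurable_const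

/-- The probability of an environment when the probability of line of sight is `ρ`. -/
def channelProb (ρ : ℝ) : Channel → ℝ
  | .los => ρ
  | .nlos => 1 - ρ

lemma channelProb_nonneg {ρ : ℝ} (h : ρ ∈ Set.Icc (0 : ℝ) 1) (c : Channel) :
    0 ≤ channelProb ρ c := by
  cases c <;> simp only [channelProb]
  · exact h.1
  · linarith [h.2]

lemma sum_ofReal_channelProb {ρ : ℝ} (h : ρ ∈ Set.Icc (0 : ℝ) 1) :
    ∑ c, ENNReal.ofReal (channelProb ρ c) = 1 := by
  rw [← ENNReal.ofReal_sum_of_nonneg fun c _ => channelProb_nonneg h c, sum_channel]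
  simp [channelProb]

/-! ### The marks of the links -/

section Marks

variable {K : ℕ} {p : Params K} {Ω : Type*} [MeasurableSpace Ω] {μ : Measure Ω}

namespace Network

/-- The configurations of all nodes. -/
def nodes (net : Network p μ) (ω : Ω) (q : Role × Fin (K + 1)) : Config :=
  config (net.num q.1 q.2) (net.pos q.1 q.2) ω

/-- The marks of all links. -/
def marks (net : Network p μ) (ω : Ω) (L : Node K × Node K) (q : Option Channel) : ℝ :=
  q.elim (net.unif L.1 L.2 ω) fun c => net.gain c L.1 L.2 ω

variable (net : Network p μ)

lemma measurable_mark (L : Node K × Node K) (q : Option Channel) :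
    Measurable fun ω => net.marks ω L q := by
  cases q with
  | none => exact net.unif_measurable _ _
  | some c => exact net.gain_measurable _ _ _

lemma measurable_linkMarks (L : Node K × Node K) : Measurable fun ω => net.marks ω L :=
  measurable_pi_lambda _ fun q => net.measurable_mark L q

lemma measurable_marks : Measurable net.marks :=
  measurable_pi_lambda _ fun L => net.measurable_linkMarks L

lemma measurable_nodes : Measurable net.nodes :=
  measurable_pi_lambda _ fun q => (net.poisson q.1 q.2).measurable_config

lemma iIndepFun_nodes : iIndepFun (fun q ω => net.nodes ω q) μ := net.nodes_indep

lemma indepFun_nodes_marks : IndepFun net.nodes net.marks μ := by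
  refine net.nodes_marks_indep.comp (φ := id)
    (ψ := fun (f : Option Channel × Node K × Node K → ℝ) L q => f (q, L)) measurable_id ?_
  exact measurable_pi_lambda _ fun L => measurable_pi_lambda _ fun q => measurable_pi_apply (q, L)

/-- Independence of single marks is regrouped link by link: the joint law is an infinite product
measure, and currying it gives the product over links of the products over the marks of one link. -/
lemma iIndepFun_marks [IsProbabilityMeasure μ] : iIndepFun (fun L ω => net.marks ω L) μ := by
  have h1 : iIndepFun (fun (q : (Node K × Node K) × Option Channel) ω => net.marks ω q.1 q.2) μ :=
    net.marks_indep.precomp (g := Prod.swap) Prod.swap_injective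
  have hm : ∀ q : (Node K × Node K) × Option Channel, Measurable fun ω => net.marks ω q.1 q.2 :=
    fun q => net.measurable_mark q.1 q.2
  have hP : ∀ q : (Node K × Node K) × Option Channel,
      IsProbabilityMeasure (μ.map fun ω => net.marks ω q.1 q.2) :=
    fun q => Measure.isProbabilityMeasure_map (hm q).aemeasurable
  have hP' : ∀ (L : Node K × Node K) (q : Option Channel),
      IsProbabilityMeasure (μ.map fun ω => net.marks ω L q) := fun L q => hP (L, q)
  rw [iIndepFun_iff_map_fun_eq_infinitePi_map hm] at h1
  have h2 := Measure.infinitePi_map_curry (fun L q => μ.map fun ω => net.marks ω L q)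
  rw [← h1, Measure.map_map (by fun_prop) (measurable_pi_lambda _ hm)] at h2
  rw [iIndepFun_iff_map_fun_eq_infinitePi_map net.measurable_linkMarks]
  have h3 : ∀ L, μ.map (fun ω => net.marks ω L)
      = Measure.infinitePi fun q => μ.map fun ω => net.marks ω L q := by
    intro L
    have := net.marks_indep.precomp (g := fun q : Option Channel => (q, L))
      (fun a b h => (Prod.ext_iff.1 h).1)
    exact (iIndepFun_iff_map_fun_eq_infinitePi_map (fun q => net.measurable_mark L q)).1 this
  simp_rw [h3]
  exact h2

lemma indepFun_unif_gain (L : Node K × Node K) (c : Channel) :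
    IndepFun (net.unif L.1 L.2) (net.gain c L.1 L.2) μ :=
  net.marks_indep.indepFun (i := (none, L)) (j := (some c, L)) (by simp)

lemma measure_channelOf_unif (L : Node K × Node K) {ρ : ℝ} (hρ : ρ ∈ Set.Icc (0 : ℝ) 1)
    (c : Channel) :
    ∫⁻ ω, (if channelOf ρ (net.unif L.1 L.2 ω) = c then 1 else 0) ∂μ
      = ENNReal.ofReal (channelProb ρ c) := by
  have hmeas : Measurable fun u => if channelOf ρ u = c then (1 : ℝ≥0∞) else 0 :=
    (Measurable.of_discrete (f := fun c' => if c' = c then (1 : ℝ≥0∞) else 0)).comp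
      (measurable_channelOf.comp measurable_prodMk_left)
  rw [← lintegral_map hmeas (net.unif_measurable _ _), net.unif_law]
  cases c with
  | los =>
    have : ∀ u, (if channelOf ρ u = .los then (1 : ℝ≥0∞) else 0) = (Set.Iic ρ).indicator 1 u := by
      intro u
      by_cases h : u ≤ ρ <;> simp [channelOf, h]
    simp_rw [this]
    rw [lintegral_indicator_one measurableSet_Iic, Measure.restrict_apply measurableSet_Iic]
    have : Set.Iic ρ ∩ Set.Icc 0 1 = Set.Icc 0 ρ := by
      ext u; simp only [Set.mem_inter_iff, Set.mem_Iic, Set.mem_Icc]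
      exact ⟨fun h => ⟨h.2.1, h.1⟩, fun h => ⟨h.2, h.1, h.2.trans hρ.2⟩⟩
    rw [this, Real.volume_Icc]
    simp [channelProb]
  | nlos =>
    have : ∀ u, (if channelOf ρ u = .nlos then (1 : ℝ≥0∞) else 0) = (Set.Ioi ρ).indicator 1 u := by
      intro u
      by_cases h : u ≤ ρ
      · simp [channelOf, h]
      · simp [channelOf, h, not_le.1 h]
    simp_rw [this]
    rw [lintegral_indicator_one measurableSet_Ioi, Measure.restrict_apply measurableSet_Ioi]
    have : Set.Ioi ρ ∩ Set.Icc 0 1 = Set.Ioc ρ 1 := by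
      ext u; simp only [Set.mem_inter_iff, Set.mem_Ioi, Set.mem_Icc, Set.mem_Ioc]
      exact ⟨fun h => ⟨h.1, h.2.2⟩, fun h => ⟨h.1, hρ.1.trans h.1.le, h.2⟩⟩
    rw [this, Real.volume_Ioc]
    simp [channelProb]

/-- Averaging over the environment and the power gain of a link. -/
lemma lintegral_link (L : Node K × Node K) {ρ : ℝ} (hρ : ρ ∈ Set.Icc (0 : ℝ) 1)
    {ψ : Channel → ℝ → ℝ≥0∞} (hψ : ∀ c, Measurable (ψ c)) :
    ∫⁻ ω, ψ (channelOf ρ (net.unif L.1 L.2 ω))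
        (net.gain (channelOf ρ (net.unif L.1 L.2 ω)) L.1 L.2 ω) ∂μ
      = ∑ c, ENNReal.ofReal (channelProb ρ c) * ∫⁻ g, ψ c g ∂(gammaMeasure (p.m c) (p.m c)) := by
  have hmeas : ∀ c, Measurable fun u => if channelOf ρ u = c then (1 : ℝ≥0∞) else 0 := fun c =>
    (Measurable.of_discrete (f := fun c' => if c' = c then (1 : ℝ≥0∞) else 0)).comp
      (measurable_channelOf.comp measurable_prodMk_left)
  have h1 : ∀ ω, ψ (channelOf ρ (net.unif L.1 L.2 ω))
        (net.gain (channelOf ρ (net.unif L.1 L.2 ω)) L.1 L.2 ω)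
      = ∑ c, (if channelOf ρ (net.unif L.1 L.2 ω) = c then 1 else 0)
        * ψ c (net.gain c L.1 L.2 ω) := by
    intro ω
    simp
  simp_rw [h1]
  have hmc : ∀ c, Measurable fun ω => (if channelOf ρ (net.unif L.1 L.2 ω) = c then 1 else 0)
      * ψ c (net.gain c L.1 L.2 ω) := fun c =>
    ((hmeas c).comp (net.unif_measurable _ _)).mul ((hψ c).comp (net.gain_measurable _ _ _))
  rw [lintegral_finsetSum _ fun c _ => hmc c]
  refine Finset.sum_congr rfl fun c _ => ?_
  rw [← net.gain_law c L.1 L.2, lintegral_map (hψ c) (net.gain_measurable _ _ _),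
    ← net.measure_channelOf_unif L hρ c]
  exact lintegral_mul_eq_lintegral_mul_lintegral_of_indepFun
    ((hmeas c).comp (net.unif_measurable _ _)) ((hψ c).comp (net.gain_measurable _ _ _))
    ((net.indepFun_unif_gain L c).comp (hmeas c) (hψ c))

end Network

end Marks

/-! ### Integration of functions of the link distance -/

/-- The spatial distance of two points with horizontal displacement `v` and altitude difference
`h`. -/
noncomputable def spatialDist (h : ℝ) (v : Plane) : ℝ := Real.sqrt (‖v‖ ^ 2 + h ^ 2)

lemma measurable_spatialDist (h : ℝ) : Measurable (spatialDist h) :=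
  ((measurable_norm.pow_const 2).add_const _).sqrt

lemma abs_le_spatialDist (h : ℝ) (v : Plane) : |h| ≤ spatialDist h v :=
  Real.abs_le_sqrt (by nlinarith [sq_nonneg ‖v‖])

/-- Polar coordinates in the plane. Both measures are compared on the half-lines `Iic b`: the
preimage is a disc of area `π (b² - h²)`, which is also `∫ 2πu` over `(|h|, b]`. -/
lemma map_spatialDist (h : ℝ) : (volume : Measure Plane).map (spatialDist h)
    = (volume.restrict (Set.Ioi |h|)).withDensity fun u => ENNReal.ofReal (2 * Real.pi * u) := by
  have h0 := abs_nonneg h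
  have hval : ∀ b : ℝ, (volume : Measure Plane).map (spatialDist h) (Set.Iic b)
      = if |h| ≤ b then ENNReal.ofReal (Real.pi * (b ^ 2 - h ^ 2)) else 0 := by
    intro b
    rw [Measure.map_apply (measurable_spatialDist h) measurableSet_Iic]
    split_ifs with hb
    · have hb2 : 0 ≤ b ^ 2 - h ^ 2 := by nlinarith [sq_abs h]
      have : spatialDist h ⁻¹' Set.Iic b = Metric.closedBall 0 (Real.sqrt (b ^ 2 - h ^ 2)) := by
        ext v
        rw [Set.mem_preimage, Set.mem_Iic, spatialDist, mem_closedBall_zero_iff,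
          Real.sqrt_le_left (h0.trans hb), Real.le_sqrt (norm_nonneg v) hb2]
        constructor <;> intro h <;> linarith
      rw [this, EuclideanSpace.volume_closedBall_fin_two, ← ENNReal.ofReal_pow (Real.sqrt_nonneg _),
        Real.sq_sqrt hb2, mul_comm Real.pi, ENNReal.ofReal_mul hb2, ← NNReal.coe_real_pi,
        ENNReal.ofReal_coe_nnreal]
    · have : spatialDist h ⁻¹' Set.Iic b = ∅ := by
        ext v
        simp only [Set.mem_preimage, Set.mem_Iic, Set.mem_empty_iff_false, iff_false]
        exact fun hv => hb ((abs_le_spatialDist h v).trans hv)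
      rw [this, measure_empty]
  have hval' : ∀ b : ℝ, ((volume.restrict (Set.Ioi |h|)).withDensity
      fun u => ENNReal.ofReal (2 * Real.pi * u)) (Set.Iic b)
      = if |h| ≤ b then ENNReal.ofReal (Real.pi * (b ^ 2 - h ^ 2)) else 0 := by
    intro b
    rw [withDensity_apply _ measurableSet_Iic, Measure.restrict_restrict measurableSet_Iic,
      Set.inter_comm, Set.Ioi_inter_Iic]
    split_ifs with hb
    · rw [← ofReal_integral_eq_lintegral_ofReal, ← intervalIntegral.integral_of_le hb,
        intervalIntegral.integral_const_mul, integral_id, sq_abs]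
      · congr 1; ring
      · exact ((continuous_const.mul continuous_id).integrableOn_Icc).mono_set Set.Ioc_subset_Icc_self
      · refine (ae_restrict_iff' measurableSet_Ioc).2 (Eventually.of_forall fun u hu => ?_)
        have : 0 < u := h0.trans_lt hu.1
        simp only [Pi.zero_apply]
        positivity
    · rw [Set.Ioc_eq_empty (fun h => hb h.le)]
      simp
  refine Measure.ext_of_generateFrom_of_iUnion (Set.range Set.Iic) (fun n : ℕ => Set.Iic (n : ℝ))
    (borel_eq_generateFrom_Iic ℝ ▸ BorelSpace.measurable_eq) isPiSystem_Iic ?_ (fun n => ⟨n, rfl⟩) ?_ ?_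
  · refine Set.eq_univ_of_forall fun x => ?_
    obtain ⟨n, hn⟩ := exists_nat_ge x
    exact Set.mem_iUnion.2 ⟨n, hn⟩
  · intro n
    rw [hval]
    split_ifs <;> simp
  · rintro _ ⟨b, rfl⟩
    rw [hval, hval']

lemma lintegral_spatialDist (h : ℝ) {f : ℝ → ℝ≥0∞} (hf : Measurable f) :
    ∫⁻ v : Plane, f (spatialDist h v)
      = ∫⁻ u in Set.Ioi |h|, ENNReal.ofReal (2 * Real.pi * u) * f u := by
  rw [← lintegral_map hf (measurable_spatialDist h), map_spatialDist,
    lintegral_withDensity_eq_lintegral_mul _ (by fun_prop) hf]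
  rfl

instance : DecidableEq Role := fun r r' => by
  cases r <;> cases r' <;> first | exact isTrue rfl | exact isFalse (by simp)

instance : Fintype Role := ⟨{.tx, .rx}, fun r => by cases r <;> simp⟩

lemma sum_role {M : Type*} [AddCommMonoid M] (f : Role → M) : ∑ r, f r = f .tx + f .rx := by
  have : (Finset.univ : Finset Role) = {.tx, .rx} := rfl
  rw [this, Finset.sum_pair (by simp)]

/-! ### Links that matter for the main link -/

/-- The link that decides about the influence of the node `i` with role `r` on the main link
between the typical node and the candidate `q₀`. -/
def linkOf {K : ℕ} (o : Subject) (q₀ : Fin (K + 1) × ℕ) (r : Role) (i : Fin (K + 1) × ℕ) :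
    Node K × Node K :=
  match o, r with
  | .receiver, .tx => (some i, none)
  | .receiver, .rx => (none, some i)
  | .transmitter, .rx => (none, some i)
  | .transmitter, .tx => (some i, some q₀)

/-- This is what makes the contributions of different nodes independent. The pair given to receivers
under `.receiver` is a mere placeholder that preserves injectivity, as their cost is zero. -/
lemma linkOf_injective {K : ℕ} (o : Subject) (q₀ : Fin (K + 1) × ℕ) :
    Function.Injective fun i : (Role × Fin (K + 1)) × ℕ => linkOf o q₀ i.1.1 (i.1.2, i.2) := by
  rintro ⟨⟨r, l⟩, n⟩ ⟨⟨r', l'⟩, n'⟩ h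
  cases o <;> cases r <;> cases r' <;> simp_all [linkOf]

lemma linkOf_candRole {K : ℕ} (o : Subject) (q₀ i : Fin (K + 1) × ℕ) :
    linkOf o q₀ o.candRole i = (o.txNode i, o.rxNode i) := by cases o <;> rfl

lemma linkOf_tx {K : ℕ} (o : Subject) (q₀ i : Fin (K + 1) × ℕ) :
    linkOf o q₀ .tx i = (some i, o.rxNode q₀) := by cases o <;> rfl

/-- The horizontal displacement of the link in `linkOf`, for a candidate at `x` and a node at
`z`. -/
def refPoint (o : Subject) (r : Role) (x z : Plane) : Plane :=
  match o, r with
  | .receiver, _ => z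
  | .transmitter, .rx => z
  | .transmitter, .tx => z - x

lemma measurable_refPoint (o : Subject) (r : Role) :
    Measurable fun q : Plane × Plane => refPoint o r q.1 q.2 := by
  cases o <;> cases r <;> simp only [refPoint] <;> fun_prop

/-- Translation invariance: the interference at a selected receiver located at `x` has the law of
the interference above the origin. -/
lemma lintegral_refPoint (o : Subject) (r : Role) (x : Plane) (f : Plane → ℝ≥0∞) :
    ∫⁻ z, f (refPoint o r x z) = ∫⁻ z, f z := by
  cases o <;> cases r <;> simp only [refPoint]
  exact lintegral_sub_right_eq_self f x

lemma measurable_apply_channel {α : Type*} [MeasurableSpace α] {f : Channel → α → ℝ≥0∞}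
    (hf : ∀ c, Measurable (f c)) {C : α → Channel} (hC : Measurable C) :
    Measurable fun x => f (C x) x := by
  have h : (fun x => f (C x) x) = fun x => ∑ c, (if C x = c then 1 else 0) * f c x := by
    funext x
    simp
  rw [h]
  refine Finset.measurable_sum _ fun c _ => Measurable.mul ?_ (hf c)
  exact (Measurable.of_discrete (f := fun c' => if c' = c then (1 : ℝ≥0∞) else 0)).comp hC

namespace Params

variable {K : ℕ} (p : Params K)

/-- The quantity that the association rule maximizes, for a candidate in layer `l` and a link of
length `d` with environment `c`. -/
noncomputable def scoreOf (a : Criterion) (l : Fin (K + 1)) (c : Channel) (d : ℝ) : ℝ :=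
  match a with
  | .nearest => p.bias l * d⁻¹
  | .strongest => p.bias l * d ^ (-p.alpha c)

/-- Probability of line of sight on the link in `linkOf`. -/
def losProb (o : Subject) (k l₀ : Fin (K + 1)) (r : Role) (l : Fin (K + 1)) : ℝ → ℝ :=
  match o, r with
  | .receiver, _ => p.rhoLoS k l
  | .transmitter, .rx => p.rhoLoS l k
  | .transmitter, .tx => p.rhoLoS l₀ l

/-- Signed altitude difference on the link in `linkOf`. -/
def refHeight (o : Subject) (k l₀ : Fin (K + 1)) (r : Role) (l : Fin (K + 1)) : ℝ :=
  match o, r with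
  | .receiver, _ => p.alt k - p.alt l
  | .transmitter, .rx => p.alt l - p.alt k
  | .transmitter, .tx => p.alt l₀ - p.alt l

/-- Length of the link in `linkOf`. -/
noncomputable def refDist (o : Subject) (k l₀ : Fin (K + 1)) (r : Role) (l : Fin (K + 1))
    (x z : Plane) : ℝ := spatialDist (p.refHeight o k l₀ r l) (refPoint o r x z)

/-- Length of the link between the typical node and a candidate. -/
noncomputable def candDist (o : Subject) (k l : Fin (K + 1)) (z : Plane) : ℝ :=
  spatialDist (p.refHeight o k l o.candRole l) z

/-- The exponent that a node contributes: `∞` if it beats the threshold `t` with margin `κ`, plus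
`s` times the interference that it causes. -/
noncomputable def cost (o : Subject) (a : Criterion) (κ s t : ℝ) (r : Role) (l : Fin (K + 1))
    (c : Channel) (d g : ℝ) : ℝ≥0∞ :=
  (if r = o.candRole ∧ t < κ * p.scoreOf a l c d then ∞ else 0)
    + if r = .tx then ENNReal.ofReal s * ENNReal.ofReal (p.power l * g * d ^ (-p.alpha c)) else 0

/-- The mean of `exp (-cost)` over the environment and the gain of a link of length `d`. -/
noncomputable def meanFactor (o : Subject) (a : Criterion) (κ s : ℝ) (k l₀ : Fin (K + 1))
    (r : Role) (l : Fin (K + 1)) (t d : ℝ) : ℝ≥0∞ :=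
  ∑ c, ENNReal.ofReal (channelProb (p.losProb o k l₀ r l d) c)
    * ∫⁻ g, nexp (p.cost o a κ s t r l c d g) ∂(gammaMeasure (p.m c) (p.m c))

lemma measurable_losProb (o : Subject) (k l₀ : Fin (K + 1)) (r : Role) (l : Fin (K + 1)) :
    Measurable (p.losProb o k l₀ r l) := by
  cases o <;> cases r <;> exact p.rhoLoS_measurable _ _

lemma losProb_mem (o : Subject) (k l₀ : Fin (K + 1)) (r : Role) (l : Fin (K + 1)) {d : ℝ}
    (hd : |p.refHeight o k l₀ r l| ≤ d) : p.losProb o k l₀ r l d ∈ Set.Icc (0 : ℝ) 1 := by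
  cases o <;> cases r <;> exact p.rhoLoS_mem _ _ _ hd

lemma losProb_refDist_mem (o : Subject) (k l₀ : Fin (K + 1)) (r : Role) (l : Fin (K + 1))
    (x z : Plane) : p.losProb o k l₀ r l (p.refDist o k l₀ r l x z) ∈ Set.Icc (0 : ℝ) 1 :=
  p.losProb_mem o k l₀ r l (abs_le_spatialDist _ _)

lemma channelProb_losProb_candRole (o : Subject) (k l : Fin (K + 1)) (c : Channel) (d : ℝ) :
    channelProb (p.losProb o k l o.candRole l d) c = p.rhoSel o k l c d := by
  cases o <;> cases c <;> rfl

lemma refDist_candRole (o : Subject) (k l₀ l : Fin (K + 1)) (x z : Plane) :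
    p.refDist o k l₀ o.candRole l x z = p.candDist o k l z := by
  cases o <;> rfl

lemma measurable_scoreOf (a : Criterion) (l : Fin (K + 1)) (c : Channel) :
    Measurable (p.scoreOf a l c) := by
  cases a
  · exact measurable_id.inv.const_mul _
  · exact (measurable_id.pow_const _).const_mul _

lemma measurable_candDist (o : Subject) (k l : Fin (K + 1)) : Measurable (p.candDist o k l) :=
  measurable_spatialDist _

lemma measurable_refDist (o : Subject) (k l₀ : Fin (K + 1)) (r : Role) (l : Fin (K + 1)) :
    Measurable fun q : Plane × Plane => p.refDist o k l₀ r l q.1 q.2 :=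
  (measurable_spatialDist _).comp (measurable_refPoint o r)

lemma measurable_cost (o : Subject) (a : Criterion) (κ s : ℝ) (r : Role) (l : Fin (K + 1))
    (c : Channel) : Measurable fun q : ℝ × ℝ × ℝ => p.cost o a κ s q.1 r l c q.2.1 q.2.2 := by
  have hd : Measurable fun q : ℝ × ℝ × ℝ => q.2.1 := measurable_fst.comp measurable_snd
  have hg : Measurable fun q : ℝ × ℝ × ℝ => q.2.2 := measurable_snd.comp measurable_snd
  refine Measurable.add (Measurable.ite ?_ measurable_const measurable_const) ?_
  · exact (MeasurableSet.const _).inter (measurableSet_lt measurable_fst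
      (((p.measurable_scoreOf a l c).comp hd).const_mul κ))
  · by_cases h : r = .tx
    · simp only [h, if_true]
      exact (((hg.const_mul _).mul (hd.pow_const _)).ennreal_ofReal).const_mul _
    · simp only [h, if_false]
      exact measurable_const

instance (c : Channel) : IsProbabilityMeasure (gammaMeasure (p.m c) (p.m c)) :=
  have h : (0 : ℝ) < p.m c := by exact_mod_cast p.m_pos c
  isProbabilityMeasure_gammaMeasure h h

lemma measurable_channelProb (c : Channel) : Measurable fun ρ => channelProb ρ c := by
  cases c <;> simp only [channelProb] <;> fun_prop

lemma measurable_meanFactor (o : Subject) (a : Criterion) (κ s : ℝ) (k l₀ : Fin (K + 1))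
    (r : Role) (l : Fin (K + 1)) :
    Measurable fun q : ℝ × ℝ => p.meanFactor o a κ s k l₀ r l q.1 q.2 := by
  refine Finset.measurable_sum _ fun c _ => Measurable.mul ?_ ?_
  · exact ((measurable_channelProb c).comp
      ((p.measurable_losProb o k l₀ r l).comp measurable_snd)).ennreal_ofReal
  · refine Measurable.lintegral_prod_right'
      (f := fun q : (ℝ × ℝ) × ℝ => nexp (p.cost o a κ s q.1.1 r l c q.1.2 q.2)) ?_
    exact ((p.measurable_cost o a κ s r l c).comp ((measurable_fst.comp measurable_fst).prodMk
      ((measurable_snd.comp measurable_fst).prodMk measurable_snd))).nexp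

lemma meanFactor_le_one (o : Subject) (a : Criterion) (κ s : ℝ) (k l₀ : Fin (K + 1))
    (r : Role) (l : Fin (K + 1)) (t : ℝ) {d : ℝ} (hd : |p.refHeight o k l₀ r l| ≤ d) :
    p.meanFactor o a κ s k l₀ r l t d ≤ 1 := by
  rw [← sum_ofReal_channelProb (p.losProb_mem o k l₀ r l hd)]
  refine Finset.sum_le_sum fun c _ => mul_le_of_le_one_right' ?_
  exact (lintegral_mono fun g => nexp_le_one _).trans (by simp)

/-- The exponent that the node `i` contributes to the event that the `n`-th candidate of layer `l₀`
is selected with environment `c`, and to the interference that the main link suffers. -/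
noncomputable def linkVar (o : Subject) (a : Criterion) (κ s : ℝ) (k l₀ : Fin (K + 1)) (c : Channel)
    (n : ℕ) (ν : Role × Fin (K + 1) → Config) (i : (Role × Fin (K + 1)) × ℕ)
    (w : Option Channel → ℝ) : ℝ≥0∞ :=
  let x := (ν (o.candRole, l₀)).2 n
  let d := p.refDist o k l₀ i.1.1 i.1.2 x ((ν i.1).2 i.2)
  let c' := channelOf (p.losProb o k l₀ i.1.1 i.1.2 d) (w none)
  -- The selected node contributes only the condition on its environment. Its gain does not enter,
  -- which later allows it to be resampled.
  if i = ((o.candRole, l₀), n) then (if c' = c then 0 else ∞)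
  else if (i.2 : ℕ∞) < (ν i.1).1 then
    p.cost o a κ s (p.scoreOf a l₀ c (p.candDist o k l₀ x)) i.1.1 i.1.2 c' d (w (some c'))
  else 0

lemma measurable_linkVar (o : Subject) (a : Criterion) (κ s : ℝ) (k l₀ : Fin (K + 1)) (c : Channel)
    (n : ℕ) (i : (Role × Fin (K + 1)) × ℕ) :
    Measurable fun q : (Role × Fin (K + 1) → Config) × (Option Channel → ℝ) =>
      p.linkVar o a κ s k l₀ c n q.1 i q.2 := by
  have hpt : ∀ (q' : Role × Fin (K + 1)) (n : ℕ), Measurable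
      fun q : (Role × Fin (K + 1) → Config) × (Option Channel → ℝ) => (q.1 q').2 n := fun q' n =>
    (measurable_pi_apply n).comp (measurable_snd.comp ((measurable_pi_apply q').comp measurable_fst))
  have hw : ∀ j, Measurable
      fun q : (Role × Fin (K + 1) → Config) × (Option Channel → ℝ) => q.2 j := fun j =>
    (measurable_pi_apply j).comp measurable_snd
  have hd := (p.measurable_refDist o k l₀ i.1.1 i.1.2).comp
    ((hpt (o.candRole, l₀) n).prodMk (hpt i.1 i.2))
  have hc := measurable_channelOf.comp
    (((p.measurable_losProb o k l₀ i.1.1 i.1.2).comp hd).prodMk (hw none))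
  have ht := (p.measurable_scoreOf a l₀ c).comp
    ((p.measurable_candDist o k l₀).comp (hpt (o.candRole, l₀) n))
  unfold linkVar
  refine Measurable.ite (MeasurableSet.const _) ?_ (Measurable.ite ?_ ?_ measurable_const)
  · exact (Measurable.of_discrete (f := fun c' => if c' = c then (0 : ℝ≥0∞) else ∞)).comp hc
  · have h1 : Measurable fun q : (Role × Fin (K + 1) → Config) × (Option Channel → ℝ) => q.1 i.1 :=
      (measurable_pi_apply i.1).comp measurable_fst
    exact h1 (measurableSet_natCast_lt i.2)
  · have hcost : ∀ c', Measurable fun q : (Role × Fin (K + 1) → Config) × (Option Channel → ℝ) =>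
        p.cost o a κ s (p.scoreOf a l₀ c (p.candDist o k l₀ ((q.1 (o.candRole, l₀)).2 n)))
          i.1.1 i.1.2 c' (p.refDist o k l₀ i.1.1 i.1.2 ((q.1 (o.candRole, l₀)).2 n)
            ((q.1 i.1).2 i.2)) (q.2 (some c')) := fun c' =>
      (p.measurable_cost o a κ s i.1.1 i.1.2 c').comp (ht.prodMk (hd.prodMk (hw (some c'))))
    exact measurable_apply_channel hcost hc

end Params

/-! ### The main link event and its interference as one exponential -/

namespace Network

variable {K : ℕ} {p : Params K} {Ω : Type*} [MeasurableSpace Ω] {μ : Measure Ω}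

/-- The typical node of layer `k` is associated with `q`, and every other candidate is worse by the
factor `κ`. -/
def MarginAssociated (net : Network p μ) (o : Subject) (a : Criterion) (κ : ℝ) (k : Fin (K + 1))
    (q : Fin (K + 1) × ℕ) (ω : Ω) : Prop :=
  net.Active o.candRole q ω ∧ ∀ q', q' ≠ q → net.Active o.candRole q' ω →
    κ * net.score o a k q' ω ≤ net.score o a k q ω

variable (net : Network p μ)

lemma marginAssociated_one (o : Subject) (a : Criterion) (k : Fin (K + 1))
    (q : Fin (K + 1) × ℕ) (ω : Ω) :
    net.MarginAssociated o a 1 k q ω ↔ net.Associated o a k q ω := by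
  refine and_congr_right fun _ => ⟨fun h q' hq' => ?_, fun h q' _ hq' => ?_⟩
  · rcases eq_or_ne q' q with rfl | hne
    · exact le_rfl
    · simpa using h q' hne hq'
  · simpa using h q' hq'

lemma linkDist_candidate (o : Subject) (k : Fin (K + 1)) (i : Fin (K + 1) × ℕ) (ω : Ω) :
    net.linkDist k (o.txNode i) (o.rxNode i) ω
      = p.candDist o k i.1 ((net.nodes ω (o.candRole, i.1)).2 i.2) := by
  cases o <;> simp [linkDist, place, Params.candDist, spatialDist, Params.refHeight, layerOf,
    Subject.txNode, Subject.rxNode, Subject.candRole, nodes, config]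

lemma linkDist_interferer (o : Subject) (k : Fin (K + 1)) (q₀ i : Fin (K + 1) × ℕ) (ω : Ω) :
    net.linkDist k (some i) (o.rxNode q₀) ω
      = p.refDist o k q₀.1 .tx i.1 ((net.nodes ω (o.candRole, q₀.1)).2 q₀.2)
        ((net.nodes ω (.tx, i.1)).2 i.2) := by
  cases o <;> simp [linkDist, place, Params.refDist, spatialDist, Params.refHeight, layerOf,
    Subject.rxNode, Subject.candRole, nodes, config, refPoint]

lemma linkChannel_candidate (o : Subject) (k l₀ : Fin (K + 1)) (q₀ i : Fin (K + 1) × ℕ) (ω : Ω) :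
    net.linkChannel k (o.txNode i) (o.rxNode i) ω
      = channelOf (p.losProb o k l₀ o.candRole i.1
          (net.linkDist k (o.txNode i) (o.rxNode i) ω))
        (net.marks ω (linkOf o q₀ o.candRole i) none) := by
  rw [linkOf_candRole]
  cases o <;> rfl

lemma linkChannel_interferer (o : Subject) (k : Fin (K + 1)) (q₀ i : Fin (K + 1) × ℕ) (ω : Ω) :
    net.linkChannel k (some i) (o.rxNode q₀) ω
      = channelOf (p.losProb o k q₀.1 .tx i.1 (net.linkDist k (some i) (o.rxNode q₀) ω))
        (net.marks ω (linkOf o q₀ .tx i) none) := by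
  rw [linkOf_tx]
  cases o <;> rfl

lemma score_eq (o : Subject) (a : Criterion) (k : Fin (K + 1)) (i : Fin (K + 1) × ℕ) (ω : Ω) :
    net.score o a k i ω = p.scoreOf a i.1 (net.linkChannel k (o.txNode i) (o.rxNode i) ω)
      (net.linkDist k (o.txNode i) (o.rxNode i) ω) := by
  cases a <;> rfl

/-- All contributions to the exponent of the main link with the `n`-th candidate of layer `l₀`. -/
noncomputable def totalVar (p : Params K) (o : Subject) (a : Criterion) (κ s : ℝ)
    (k l₀ : Fin (K + 1)) (c : Channel) (n : ℕ) (ν : Role × Fin (K + 1) → Config)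
    (M : Node K × Node K → Option Channel → ℝ) : ℝ≥0∞ :=
  ∑' i : (Role × Fin (K + 1)) × ℕ,
    p.linkVar o a κ s k l₀ c n ν i (M (linkOf o (l₀, n) i.1.1 (i.1.2, i.2)))

-- Indexes the interference by all nodes with roles, for a termwise comparison with `totalVar`.
-- Under `.transmitter` the transmitter of the main link is the typical node, so the condition `i ≠
-- ((o.candRole, l₀), n)` then excludes no transmitter.
open Classical in
lemma interferencePlusNoise_eq (o : Subject) (k l₀ : Fin (K + 1)) (n : ℕ) (ω : Ω) :
    net.interferencePlusNoise k (o.txNode (l₀, n)) (o.rxNode (l₀, n)) ω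
      = (∑' i : (Role × Fin (K + 1)) × ℕ, if i.1.1 = .tx ∧ i ≠ ((o.candRole, l₀), n)
          ∧ (i.2 : ℕ∞) < (net.nodes ω i.1).1
        then ENNReal.ofReal (net.rxPower k (some (i.1.2, i.2)) (o.rxNode (l₀, n)) ω) else 0)
        + ENNReal.ofReal p.noise := by
  rw [interferencePlusNoise]
  congr 1
  rw [ENNReal.tsum_prod', ENNReal.tsum_prod', tsum_fintype, tsum_fintype, Fintype.sum_prod_type,
    sum_role]
  have h0 : ∑ l : Fin (K + 1), ∑' m : ℕ, (if (Role.rx, l).1 = Role.tx ∧ ((Role.rx, l), m) ≠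
      ((o.candRole, l₀), n) ∧ (m : ℕ∞) < (net.nodes ω (Role.rx, l)).1 then
      ENNReal.ofReal (net.rxPower k (some (l, m)) (o.rxNode (l₀, n)) ω) else 0) = 0 := by
    simp
  rw [h0, add_zero]
  refine Finset.sum_congr rfl fun l _ => tsum_congr fun m => ?_
  have hiff : (net.Active Role.tx (l, m) ω ∧ some (l, m) ≠ o.txNode (l₀, n)) ↔
      ((Role.tx, l).1 = Role.tx ∧ ((Role.tx, l), m) ≠ ((o.candRole, l₀), n)
        ∧ (m : ℕ∞) < (net.nodes ω (Role.tx, l)).1) := by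
    have hact : net.Active Role.tx (l, m) ω ↔ (m : ℕ∞) < (net.nodes ω (Role.tx, l)).1 := Iff.rfl
    rw [hact]
    cases o <;> simp [Subject.txNode, Subject.candRole, and_comm]
  simp only [hiff]

lemma measurable_totalVar (p : Params K) (o : Subject) (a : Criterion) (κ s : ℝ)
    (k l₀ : Fin (K + 1)) (c : Channel) (n : ℕ) :
    Measurable fun q : (Role × Fin (K + 1) → Config) × (Node K × Node K → Option Channel → ℝ) =>
      totalVar p o a κ s k l₀ c n q.1 q.2 :=
  Measurable.tsum fun i => (p.measurable_linkVar o a κ s k l₀ c n i).comp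
    (measurable_fst.prodMk ((measurable_pi_apply _).comp measurable_snd))

open Classical in
/-- The exponential of the interference on the event of a main link, as a function of the
configurations and of the marks. -/
lemma ite_mul_nexp_eq (o : Subject) (a : Criterion) (κ : ℝ) {s : ℝ} (k l₀ : Fin (K + 1))
    (c : Channel) (n : ℕ) (B : Set ℝ) (ω : Ω) :
    (if net.MarginAssociated o a κ k (l₀, n) ω
        ∧ net.linkChannel k (o.txNode (l₀, n)) (o.rxNode (l₀, n)) ω = c
        ∧ net.linkDist k (o.txNode (l₀, n)) (o.rxNode (l₀, n)) ω ∈ B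
      then nexp (ENNReal.ofReal s
        * net.interferencePlusNoise k (o.txNode (l₀, n)) (o.rxNode (l₀, n)) ω) else 0)
      = if (n : ℕ∞) < (net.nodes ω (o.candRole, l₀)).1 then
          B.indicator 1 (p.candDist o k l₀ ((net.nodes ω (o.candRole, l₀)).2 n))
          * nexp (ENNReal.ofReal s * ENNReal.ofReal p.noise)
          * nexp (totalVar p o a κ s k l₀ c n (net.nodes ω) (net.marks ω)) else 0 := by
  have hact : ∀ i : Fin (K + 1) × ℕ, net.Active o.candRole i ω
      ↔ (i.2 : ℕ∞) < (net.nodes ω (o.candRole, i.1)).1 := fun i => Iff.rfl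
  by_cases hn : (n : ℕ∞) < (net.nodes ω (o.candRole, l₀)).1
  swap
  · rw [if_neg hn, if_neg]
    exact fun h => hn ((hact (l₀, n)).1 h.1.1)
  rw [if_pos hn]
  by_cases hB : net.linkDist k (o.txNode (l₀, n)) (o.rxNode (l₀, n)) ω ∈ B
  swap
  · rw [if_neg fun h => hB h.2.2, ← linkDist_candidate net o k (l₀, n),
      Set.indicator_of_notMem hB, zero_mul, zero_mul]
  rw [← linkDist_candidate net o k (l₀, n), Set.indicator_of_mem hB, Pi.one_apply, one_mul]
  -- One infinite contribution annihilates the exponential. This is how the exponent expresses a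
  -- wrong environment or a better candidate.
  have htop : ∀ i : (Role × Fin (K + 1)) × ℕ, p.linkVar o a κ s k l₀ c n (net.nodes ω) i
      (net.marks ω (linkOf o (l₀, n) i.1.1 (i.1.2, i.2))) = ∞ →
      nexp (totalVar p o a κ s k l₀ c n (net.nodes ω) (net.marks ω)) = 0 := by
    intro i hi
    rw [totalVar, ENNReal.tsum_eq_top_of_eq_top ⟨i, hi⟩, nexp_top]
  by_cases hc : net.linkChannel k (o.txNode (l₀, n)) (o.rxNode (l₀, n)) ω = c
  swap
  · rw [if_neg fun h => hc h.2.1, htop ((o.candRole, l₀), n), mul_zero]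
    rw [net.linkChannel_candidate o k l₀ (l₀, n), net.linkDist_candidate] at hc
    simp only [Params.linkVar, if_true, Params.refDist_candRole]
    rw [if_neg hc]
  have hcand : ∀ i : Fin (K + 1) × ℕ, i ≠ (l₀, n) → net.Active o.candRole i ω →
      p.linkVar o a κ s k l₀ c n (net.nodes ω) ((o.candRole, i.1), i.2)
        (net.marks ω (linkOf o (l₀, n) o.candRole i))
      = p.cost o a κ s (net.score o a k (l₀, n) ω) o.candRole i.1
        (net.linkChannel k (o.txNode i) (o.rxNode i) ω)
        (net.linkDist k (o.txNode i) (o.rxNode i) ω)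
        (net.gain (net.linkChannel k (o.txNode i) (o.rxNode i) ω) (o.txNode i) (o.rxNode i) ω) := by
    intro i hi hai
    have hne : ((o.candRole, i.1), i.2) ≠ ((o.candRole, l₀), n) := by
      intro h
      simp only [Prod.mk.injEq, true_and] at h
      exact hi (Prod.ext h.1 h.2)
    rw [hact] at hai
    rw [net.score_eq, hc, net.linkChannel_candidate o k l₀ (l₀, n) i, net.linkDist_candidate,
      net.linkDist_candidate]
    simp only [Params.linkVar, if_neg hne, if_pos hai, Params.refDist_candRole]
    simp only [marks, linkOf_candRole, Option.elim]
  have htx : ∀ i : Fin (K + 1) × ℕ, ((Role.tx, i.1), i.2) ≠ ((o.candRole, l₀), n) →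
      net.Active .tx i ω →
      p.linkVar o a κ s k l₀ c n (net.nodes ω) ((.tx, i.1), i.2)
        (net.marks ω (linkOf o (l₀, n) .tx i))
      = p.cost o a κ s (net.score o a k (l₀, n) ω) .tx i.1
        (net.linkChannel k (some i) (o.rxNode (l₀, n)) ω)
        (net.linkDist k (some i) (o.rxNode (l₀, n)) ω)
        (net.gain (net.linkChannel k (some i) (o.rxNode (l₀, n)) ω) (some i)
          (o.rxNode (l₀, n)) ω) := by
    intro i hne hai
    have hai' : (i.2 : ℕ∞) < (net.nodes ω (.tx, i.1)).1 := hai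
    rw [net.score_eq, hc, net.linkChannel_interferer o k (l₀, n) i, net.linkDist_candidate,
      net.linkDist_interferer]
    simp only [Params.linkVar, if_neg hne, if_pos hai']
    simp only [marks, linkOf_tx, Option.elim]
  by_cases hm : net.MarginAssociated o a κ k (l₀, n) ω
  swap
  · rw [if_neg fun h => hm h.1]
    -- Failure of the association means that some existing candidate strictly exceeds the threshold,
    -- and its cost is `∞`.
    have : ∃ i, i ≠ (l₀, n) ∧ net.Active o.candRole i ω ∧
        net.score o a k (l₀, n) ω < κ * net.score o a k i ω := by
      by_contra! hcon
      exact hm ⟨(hact (l₀, n)).2 hn, hcon⟩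
    obtain ⟨i, hi, hai, hlt⟩ := this
    rw [htop ((o.candRole, i.1), i.2), mul_zero]
    rw [hcand i hi hai, Params.cost, if_pos ⟨rfl, by rwa [← net.score_eq]⟩, top_add]
  rw [if_pos ⟨hm, hc, hB⟩, interferencePlusNoise_eq, mul_add, nexp_add, mul_comm]
  congr 2
  rw [totalVar, ← ENNReal.tsum_mul_left]
  refine tsum_congr fun i => ?_
  obtain ⟨⟨r, l⟩, m⟩ := i
  by_cases hne : ((r, l), m) = ((o.candRole, l₀), n)
  · rw [if_neg (fun h => h.2.1 hne), mul_zero]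
    rw [hne]
    rw [net.linkChannel_candidate o k l₀ (l₀, n), net.linkDist_candidate] at hc
    simp only [Params.linkVar, if_true, Params.refDist_candRole]
    rw [if_pos hc]
  by_cases hai : (m : ℕ∞) < (net.nodes ω (r, l)).1
  swap
  · rw [if_neg (fun h => hai h.2.2), mul_zero]
    simp only [Params.linkVar, if_neg hne, if_neg hai]
  have hthr : ∀ h : r = o.candRole, ¬ net.score o a k (l₀, n) ω < κ * net.score o a k (l, m) ω := by
    intro h
    have hne' : ((l, m) : Fin (K + 1) × ℕ) ≠ (l₀, n) := by
      rintro h'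
      simp only [Prod.mk.injEq] at h'
      exact hne (by rw [h, h'.1, h'.2])
    exact not_lt.2 (hm.2 (l, m) hne' ((hact (l, m)).2 (h ▸ hai)))
  rcases eq_or_ne r .tx with rfl | hr
  · rw [if_pos ⟨rfl, hne, hai⟩]
    refine Eq.symm ((htx (l, m) hne hai).trans ?_)
    rw [Params.cost, if_pos rfl, if_neg, zero_add]
    · rfl
    · rintro ⟨h1, h2⟩
      refine hthr h1 ?_
      cases o
      · rwa [net.score_eq .receiver a k (l, m)]
      · simp [Subject.candRole] at h1
  · rw [if_neg (fun h => hr h.1), mul_zero]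
    by_cases hcr : r = o.candRole
    · subst hcr
      have hne' : ((l, m) : Fin (K + 1) × ℕ) ≠ (l₀, n) := by
        rintro h'
        simp only [Prod.mk.injEq] at h'
        exact hne (by rw [h'.1, h'.2])
      refine Eq.symm ((hcand (l, m) hne' hai).trans ?_)
      rw [Params.cost, if_neg hr, add_zero, if_neg]
      rintro ⟨_, h2⟩
      rw [← net.score_eq] at h2
      exact hthr rfl h2
    · simp only [Params.linkVar, if_neg hne, if_pos hai, Params.cost, if_neg hr, hcr, false_and,
        if_false, add_zero]

end Network

/-! ### Averaging over the marks and then over the positions -/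

namespace Params

variable {K : ℕ} (p : Params K)

/-- The exponent that a node with role `q.1` in layer `q.2` at `z` contributes on average, when the
selected node is at `x`. -/
noncomputable def meanExp (o : Subject) (a : Criterion) (κ s : ℝ) (k l₀ : Fin (K + 1)) (c : Channel)
    (q : Role × Fin (K + 1)) (x z : Plane) : ℝ≥0∞ :=
  nlog (p.meanFactor o a κ s k l₀ q.1 q.2 (p.scoreOf a l₀ c (p.candDist o k l₀ x))
    (p.refDist o k l₀ q.1 q.2 x z))

lemma measurable_meanExp (o : Subject) (a : Criterion) (κ s : ℝ) (k l₀ : Fin (K + 1)) (c : Channel)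
    (q : Role × Fin (K + 1)) :
    Measurable fun r : Plane × Plane => p.meanExp o a κ s k l₀ c q r.1 r.2 :=
  ((p.measurable_meanFactor o a κ s k l₀ q.1 q.2).comp
    ((((p.measurable_scoreOf a l₀ c).comp (p.measurable_candDist o k l₀)).comp
      measurable_fst).prodMk (p.measurable_refDist o k l₀ q.1 q.2))).nlog

lemma cost_antitone (o : Subject) (a : Criterion) (κ s : ℝ) (r : Role) (l : Fin (K + 1))
    (c : Channel) (d g : ℝ) : Antitone fun t => p.cost o a κ s t r l c d g := by
  intro t t' h
  refine add_le_add ?_ le_rfl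
  by_cases h' : r = o.candRole ∧ t' < κ * p.scoreOf a l c d
  · rw [if_pos h', if_pos ⟨h'.1, h.trans_lt h'.2⟩]
  · rw [if_neg h']
    exact zero_le

lemma meanFactor_monotone (o : Subject) (a : Criterion) (κ s : ℝ) (k l₀ : Fin (K + 1))
    (r : Role) (l : Fin (K + 1)) (d : ℝ) :
    Monotone fun t => p.meanFactor o a κ s k l₀ r l t d := fun _ _ h =>
  Finset.sum_le_sum fun c _ => mul_le_mul_right (lintegral_mono fun g =>
    nexp_antitone (p.cost_antitone o a κ s r l c d g h)) _

/-- A strict inequality `t < κ * score` does not change when `t` increases slightly, so the factor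
is constant to the right of `t`. Together with monotonicity this supplies the hypotheses of
`mecke_threshold`. -/
lemma eventually_meanFactor_eq (o : Subject) (a : Criterion) (κ s : ℝ) (k l₀ : Fin (K + 1))
    (r : Role) (l : Fin (K + 1)) (t d : ℝ) :
    ∀ᶠ t' in 𝓝[≥] t, p.meanFactor o a κ s k l₀ r l t' d = p.meanFactor o a κ s k l₀ r l t d := by
  have h : ∀ c, ∀ᶠ t' in 𝓝[≥] t, (t' < κ * p.scoreOf a l c d ↔ t < κ * p.scoreOf a l c d) := by
    intro c
    by_cases hc : t < κ * p.scoreOf a l c d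
    · filter_upwards [nhdsWithin_le_nhds (Iio_mem_nhds hc)] with t' ht'
      exact ⟨fun _ => hc, fun _ => ht'⟩
    · filter_upwards [self_mem_nhdsWithin] with t' ht'
      exact ⟨fun h => lt_of_le_of_lt ht' h, fun h => absurd h hc⟩
  filter_upwards [eventually_all.2 h] with t' ht'
  simp only [meanFactor, cost, ht']

end Params

namespace Network

variable {K : ℕ} {p : Params K} {Ω : Type*} [MeasurableSpace Ω] {μ : Measure Ω}
  [IsProbabilityMeasure μ] (net : Network p μ)

/-- Averaging over the marks for fixed positions of the nodes. -/
lemma lintegral_nexp_totalVar (o : Subject) (a : Criterion) (κ s : ℝ) (k l₀ : Fin (K + 1))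
    (c : Channel) (n : ℕ) (ν : Role × Fin (K + 1) → Config) :
    ∫⁻ ω, nexp (totalVar p o a κ s k l₀ c n ν (net.marks ω)) ∂μ
      = ENNReal.ofReal (p.rhoSel o k l₀ c (p.candDist o k l₀ ((ν (o.candRole, l₀)).2 n)))
        * nexp (reducedSum (ν (o.candRole, l₀)) n
            (p.meanExp o a κ s k l₀ c (o.candRole, l₀) ((ν (o.candRole, l₀)).2 n))
          + ∑ q ∈ Finset.univ.erase (o.candRole, l₀), pointSum (ν q)
            (p.meanExp o a κ s k l₀ c q ((ν (o.candRole, l₀)).2 n))) := by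
  set x := (ν (o.candRole, l₀)).2 n with hx
  have hmeas : ∀ i, Measurable (p.linkVar o a κ s k l₀ c n ν i) := fun i =>
    (p.measurable_linkVar o a κ s k l₀ c n i).comp measurable_prodMk_left
  have hind : iIndepFun (fun (i : (Role × Fin (K + 1)) × ℕ) ω => p.linkVar o a κ s k l₀ c n ν i
      (net.marks ω (linkOf o (l₀, n) i.1.1 (i.1.2, i.2)))) μ :=
    (net.iIndepFun_marks.precomp (linkOf_injective o (l₀, n))).comp _ hmeas
  have h1 := lintegral_nexp_tsum (fun i => (hmeas i).comp (net.measurable_linkMarks _)) hind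
  rw [show (∫⁻ ω, nexp (totalVar p o a κ s k l₀ c n ν (net.marks ω)) ∂μ) = _ from h1]
  have hρ : ENNReal.ofReal (p.rhoSel o k l₀ c (p.candDist o k l₀ x)) ≤ 1 := by
    have hm := p.losProb_refDist_mem o k l₀ o.candRole l₀ x x
    rw [p.refDist_candRole] at hm
    rw [← p.channelProb_losProb_candRole, ← sum_ofReal_channelProb hm]
    exact Finset.single_le_sum (f := fun c => ENNReal.ofReal (channelProb _ c))
      (fun _ _ => zero_le) (Finset.mem_univ c)
  -- Three kinds of indices: the selected node yields the probability of its environment, any other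
  -- existing node its averaged cost, and an index without a node yields nothing.
  have hval : ∀ i : (Role × Fin (K + 1)) × ℕ, nlog (∫⁻ ω, nexp (p.linkVar o a κ s k l₀ c n ν i
      (net.marks ω (linkOf o (l₀, n) i.1.1 (i.1.2, i.2)))) ∂μ)
      = if i = ((o.candRole, l₀), n) then nlog (ENNReal.ofReal (p.rhoSel o k l₀ c (p.candDist o k l₀ x)))
        else if (i.2 : ℕ∞) < (ν i.1).1 then p.meanExp o a κ s k l₀ c i.1 x ((ν i.1).2 i.2)
        else 0 := by
    intro i
    have hmem := p.losProb_refDist_mem o k l₀ i.1.1 i.1.2 x ((ν i.1).2 i.2)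
    split_ifs with hi hlt
    · congr 1
      subst hi
      rw [p.refDist_candRole] at hmem
      rw [← p.channelProb_losProb_candRole o k l₀ c, ← net.measure_channelOf_unif
        (linkOf o (l₀, n) o.candRole (l₀, n)) hmem]
      refine lintegral_congr fun ω => ?_
      simp only [Params.linkVar, if_true, Params.refDist_candRole]
      by_cases h : channelOf (p.losProb o k l₀ o.candRole l₀
          (p.candDist o k l₀ ((ν (o.candRole, l₀)).2 n)))
          (net.marks ω (linkOf o (l₀, n) o.candRole (l₀, n)) none) = c
      · rw [if_pos h, nexp_zero]
        exact (if_pos h).symm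
      · rw [if_neg h, nexp_top]
        exact (if_neg h).symm
    · rw [Params.meanExp, Params.meanFactor]
      congr 1
      rw [← net.lintegral_link (linkOf o (l₀, n) i.1.1 (i.1.2, i.2)) hmem
        (ψ := fun c' g => nexp (p.cost o a κ s (p.scoreOf a l₀ c (p.candDist o k l₀ x)) i.1.1 i.1.2
          c' (p.refDist o k l₀ i.1.1 i.1.2 x ((ν i.1).2 i.2)) g)) fun c' =>
          ((p.measurable_cost o a κ s i.1.1 i.1.2 c').comp (measurable_const.prodMk
            (measurable_const.prodMk measurable_id))).nexp]
      refine lintegral_congr fun ω => ?_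
      simp only [Params.linkVar, if_neg hi, if_pos hlt]
      rfl
    · have : ∀ ω, p.linkVar o a κ s k l₀ c n ν i
          (net.marks ω (linkOf o (l₀, n) i.1.1 (i.1.2, i.2))) = 0 := by
        intro ω
        unfold Params.linkVar
        exact (if_neg hi).trans (if_neg hlt)
      simp [this]
  simp only [Function.comp_apply]
  rw [tsum_congr hval, ENNReal.tsum_eq_add_tsum_ite ((o.candRole, l₀), n), if_pos rfl, nexp_add, nexp_nlog hρ]
  congr 2
  rw [ENNReal.tsum_prod', tsum_fintype, ← Finset.add_sum_erase _ _ (Finset.mem_univ (o.candRole, l₀))]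
  congr 1
  · refine tsum_congr fun m => ?_
    by_cases hm : m = n
    · simp [hm]
    · simp [hm]
  · refine Finset.sum_congr rfl fun q hq => tsum_congr fun m => ?_
    have : q ≠ (o.candRole, l₀) := Finset.ne_of_mem_erase hq
    simp [this]

open Classical in
/-- The Laplace transform of interference plus noise on the event of a main link, as an integral
over the position of the selected node. -/
theorem tsum_lintegral_eq_lintegral_plane (o : Subject) (a : Criterion) (κ s : ℝ)
    (k l₀ : Fin (K + 1)) (c : Channel) {B : Set ℝ} (hB : MeasurableSet B) :
    ∑' n : ℕ, ∫⁻ ω, (if net.MarginAssociated o a κ k (l₀, n) ω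
        ∧ net.linkChannel k (o.txNode (l₀, n)) (o.rxNode (l₀, n)) ω = c
        ∧ net.linkDist k (o.txNode (l₀, n)) (o.rxNode (l₀, n)) ω ∈ B
      then nexp (ENNReal.ofReal s
        * net.interferencePlusNoise k (o.txNode (l₀, n)) (o.rxNode (l₀, n)) ω) else 0) ∂μ
      = ∫⁻ x, (B.indicator 1 (p.candDist o k l₀ x)
          * nexp (ENNReal.ofReal s * ENNReal.ofReal p.noise)
          * ENNReal.ofReal (p.rhoSel o k l₀ c (p.candDist o k l₀ x)))
        * nexp (∑ q : Role × Fin (K + 1), ∫⁻ z, (1 - p.meanFactor o a κ s k l₀ q.1 q.2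
            (p.scoreOf a l₀ c (p.candDist o k l₀ x)) (p.refDist o k l₀ q.1 q.2 x z))
          ∂(ENNReal.ofReal (p.dens q.1 q.2) • (volume : Measure Plane)))
        ∂(ENNReal.ofReal (p.dens o.candRole l₀) • (volume : Measure Plane)) := by
  set q₀ : Role × Fin (K + 1) := (o.candRole, l₀) with hq₀
  have hsf : ∀ q : Role × Fin (K + 1),
      SigmaFinite (ENNReal.ofReal (p.dens q.1 q.2) • (volume : Measure Plane)) := fun q =>
    inferInstanceAs (SigmaFinite ((p.dens q.1 q.2).toNNReal • (volume : Measure Plane)))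
  have hρm : Measurable fun x => ENNReal.ofReal (p.rhoSel o k l₀ c (p.candDist o k l₀ x)) := by
    simp_rw [← p.channelProb_losProb_candRole]
    exact (((Params.measurable_channelProb c).comp
      (p.measurable_losProb o k l₀ o.candRole l₀)).comp (p.measurable_candDist o k l₀)).ennreal_ofReal
  have hg : Measurable fun x => B.indicator (1 : ℝ → ℝ≥0∞) (p.candDist o k l₀ x)
      * nexp (ENNReal.ofReal s * ENNReal.ofReal p.noise) :=
    ((measurable_one.indicator hB).comp (p.measurable_candDist o k l₀)).mul_const _
  have hpt : ∀ n : ℕ, Measurable fun ν : Role × Fin (K + 1) → Config => (ν q₀).2 n := fun n =>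
    (measurable_pi_apply n).comp (measurable_snd.comp (measurable_pi_apply q₀))
  have hn : ∀ n : ℕ, ∫⁻ ω, (if net.MarginAssociated o a κ k (l₀, n) ω
        ∧ net.linkChannel k (o.txNode (l₀, n)) (o.rxNode (l₀, n)) ω = c
        ∧ net.linkDist k (o.txNode (l₀, n)) (o.rxNode (l₀, n)) ω ∈ B
      then nexp (ENNReal.ofReal s
        * net.interferencePlusNoise k (o.txNode (l₀, n)) (o.rxNode (l₀, n)) ω) else 0) ∂μ
      = ∫⁻ ω, (if (n : ℕ∞) < net.num q₀.1 q₀.2 ω then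
        (B.indicator 1 (p.candDist o k l₀ (net.pos q₀.1 q₀.2 n ω))
          * nexp (ENNReal.ofReal s * ENNReal.ofReal p.noise)
          * ENNReal.ofReal (p.rhoSel o k l₀ c (p.candDist o k l₀ (net.pos q₀.1 q₀.2 n ω))))
        * nexp (reducedSum (config (net.num q₀.1 q₀.2) (net.pos q₀.1 q₀.2) ω) n
            (p.meanExp o a κ s k l₀ c q₀ (net.pos q₀.1 q₀.2 n ω))
          + ∑ q ∈ Finset.univ.erase q₀, pointSum (config (net.num q.1 q.2) (net.pos q.1 q.2) ω)
            (p.meanExp o a κ s k l₀ c q (net.pos q₀.1 q₀.2 n ω))) else 0) ∂μ := by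
    intro n
    simp_rw [net.ite_mul_nexp_eq o a κ k l₀ c n B]
    let F : (Role × Fin (K + 1) → Config) → (Node K × Node K → Option Channel → ℝ) → ℝ≥0∞ :=
      fun ν M => if (n : ℕ∞) < (ν q₀).1 then
          B.indicator 1 (p.candDist o k l₀ ((ν q₀).2 n))
          * nexp (ENNReal.ofReal s * ENNReal.ofReal p.noise)
          * nexp (totalVar p o a κ s k l₀ c n ν M) else 0
    have hF : Measurable fun q : (Role × Fin (K + 1) → Config)
        × (Node K × Node K → Option Channel → ℝ) => F q.1 q.2 := by
      refine Measurable.ite ?_ (Measurable.mul ?_ ?_) measurable_const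
      · have h1 : Measurable fun q : (Role × Fin (K + 1) → Config)
            × (Node K × Node K → Option Channel → ℝ) => q.1 q₀ :=
          (measurable_pi_apply q₀).comp measurable_fst
        exact h1 (measurableSet_natCast_lt n)
      · exact hg.comp ((hpt n).comp measurable_fst)
      · exact (measurable_totalVar p o a κ s k l₀ c n).nexp
    have h1 := lintegral_comp_of_indepFun net.measurable_nodes net.measurable_marks
      net.indepFun_nodes_marks hF
    refine h1.trans (lintegral_congr fun ω => ?_)
    by_cases hlt : (n : ℕ∞) < net.num q₀.1 q₀.2 ω
    · have hlt' : (n : ℕ∞) < (net.nodes ω q₀).1 := hlt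
      simp only [F, if_pos hlt, if_pos hlt']
      have hm : Measurable fun ω' => nexp (totalVar p o a κ s k l₀ c n (net.nodes ω)
          (net.marks ω')) := ((measurable_totalVar p o a κ s k l₀ c n).comp
        (measurable_const.prodMk net.measurable_marks)).nexp
      rw [lintegral_const_mul _ hm, net.lintegral_nexp_totalVar, ← mul_assoc]
      rfl
    · have hlt' : ¬ (n : ℕ∞) < (net.nodes ω q₀).1 := hlt
      simp only [F, if_neg hlt, if_neg hlt', lintegral_zero]
  simp_rw [hn]
  -- Within the process of the selected node, link lengths to the typical node do not involve `x`
  -- (`refDist_candRole`). Thus `x` acts there through its score alone, as the threshold form of the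
  -- Mecke formula requires.
  let φ₀ : ℝ → Plane → ℝ≥0∞ := fun t z => nlog (p.meanFactor o a κ s k l₀ q₀.1 q₀.2 t
    (p.candDist o k l₀ z))
  have hmecke := mecke_of_iIndepFun (μ := μ) (N := fun q : Role × Fin (K + 1) => net.num q.1 q.2)
    (X := fun q => net.pos q.1 q.2) (fun q => net.poisson q.1 q.2) net.iIndepFun_nodes q₀
    (T := fun x => p.scoreOf a l₀ c (p.candDist o k l₀ x))
    ((p.measurable_scoreOf a l₀ c).comp (p.measurable_candDist o k l₀)) (φ₀ := φ₀)
    ((p.measurable_meanFactor o a κ s k l₀ q₀.1 q₀.2).comp (measurable_fst.prodMk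
      ((p.measurable_candDist o k l₀).comp measurable_snd))).nlog
    (fun z t t' h => nlog_antitone (p.meanFactor_monotone o a κ s k l₀ _ _ _ h))
    (fun t z => tendsto_const_nhds.congr' ((p.eventually_meanFactor_eq o a κ s k l₀ q₀.1 q₀.2 t
      (p.candDist o k l₀ z)).mono fun t' ht' => by simp only [φ₀, ht']))
    (φ := p.meanExp o a κ s k l₀ c) (p.measurable_meanExp o a κ s k l₀ c)
    (fun x => by funext z; simp only [Params.meanExp, φ₀, hq₀, p.refDist_candRole])
    (hg.mul hρm)
  refine hmecke.trans (lintegral_congr fun x => ?_)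
  simp only [Pi.mul_apply]
  congr 2
  refine Finset.sum_congr rfl fun q _ => lintegral_congr fun z => ?_
  rw [Params.meanExp, nexp_nlog]
  exact p.meanFactor_le_one o a κ s k l₀ q.1 q.2 _ (abs_le_spatialDist _ _)

end Network

/-! ### The weighted density of the main link length -/

namespace Params

variable {K : ℕ} (p : Params K)

/-- The exponent of the mean over all nodes but the selected one, when the selected node lies in
layer `l₀`, with environment `c` and at distance `y`. -/
noncomputable def totExp (o : Subject) (a : Criterion) (κ s : ℝ) (k l₀ : Fin (K + 1)) (c : Channel)
    (y : ℝ) : ℝ≥0∞ :=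
  ∑ q : Role × Fin (K + 1), ENNReal.ofReal (p.dens q.1 q.2) *
    ∫⁻ u in Set.Ioi |p.refHeight o k l₀ q.1 q.2|, ENNReal.ofReal (2 * Real.pi * u)
      * (1 - p.meanFactor o a κ s k l₀ q.1 q.2 (p.scoreOf a l₀ c y) u)

/-- The density at `y` of the main link length, weighted by the Laplace transform at `s` of
interference plus noise. -/
noncomputable def mainDens (o : Subject) (a : Criterion) (κ s : ℝ) (k l₀ : Fin (K + 1))
    (c : Channel) (y : ℝ) : ℝ≥0∞ :=
  ENNReal.ofReal (p.dens o.candRole l₀) * ENNReal.ofReal (2 * Real.pi * y)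
    * (nexp (ENNReal.ofReal s * ENNReal.ofReal p.noise) * ENNReal.ofReal (p.rhoSel o k l₀ c y)
      * nexp (p.totExp o a κ s k l₀ c y))

lemma measurable_rhoSel (o : Subject) (k l : Fin (K + 1)) (c : Channel) :
    Measurable (p.rhoSel o k l c) := by
  have : p.rhoSel o k l c = fun d => channelProb (p.losProb o k l o.candRole l d) c := by
    funext d
    rw [channelProb_losProb_candRole]
  rw [this]
  exact (measurable_channelProb c).comp (p.measurable_losProb _ _ _ _ _)

lemma measurable_totExp (o : Subject) (a : Criterion) (κ s : ℝ) (k l₀ : Fin (K + 1)) (c : Channel) :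
    Measurable (p.totExp o a κ s k l₀ c) := by
  refine Finset.measurable_sum _ fun q _ => Measurable.const_mul ?_ _
  refine Measurable.lintegral_prod_right' (f := fun r : ℝ × ℝ => ENNReal.ofReal (2 * Real.pi * r.2)
      * (1 - p.meanFactor o a κ s k l₀ q.1 q.2 (p.scoreOf a l₀ c r.1) r.2)) ?_
  refine Measurable.mul (by fun_prop) (Measurable.const_sub ?_ _)
  exact (p.measurable_meanFactor o a κ s k l₀ q.1 q.2).comp
    (((p.measurable_scoreOf a l₀ c).comp measurable_fst).prodMk measurable_snd)

lemma measurable_mainDens (o : Subject) (a : Criterion) (κ s : ℝ) (k l₀ : Fin (K + 1))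
    (c : Channel) : Measurable (p.mainDens o a κ s k l₀ c) :=
  Measurable.mul (by fun_prop)
    (((p.measurable_rhoSel o k l₀ c).ennreal_ofReal.const_mul _).mul
      (p.measurable_totExp o a κ s k l₀ c).nexp)

lemma hdiff_nonneg (i j : Fin (K + 1)) : 0 ≤ p.hdiff i j := abs_nonneg _

lemma abs_refHeight_candRole (o : Subject) (k l₀ l : Fin (K + 1)) :
    |p.refHeight o k l₀ o.candRole l| = p.hdiff k l := by
  cases o
  · rfl
  · exact abs_sub_comm _ _

end Params

namespace Network

variable {K : ℕ} {p : Params K} {Ω : Type*} [MeasurableSpace Ω] {μ : Measure Ω}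
  [IsProbabilityMeasure μ] (net : Network p μ)

open Classical in
/-- The Laplace transform of interference plus noise on the event of a main link, as an integral
over the length of the main link. -/
theorem tsum_lintegral_eq_lintegral_mainDens (o : Subject) (a : Criterion) (κ s : ℝ)
    (k l₀ : Fin (K + 1)) (c : Channel) {B : Set ℝ} (hB : MeasurableSet B) :
    ∑' n : ℕ, ∫⁻ ω, (if net.MarginAssociated o a κ k (l₀, n) ω
        ∧ net.linkChannel k (o.txNode (l₀, n)) (o.rxNode (l₀, n)) ω = c
        ∧ net.linkDist k (o.txNode (l₀, n)) (o.rxNode (l₀, n)) ω ∈ B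
      then nexp (ENNReal.ofReal s
        * net.interferencePlusNoise k (o.txNode (l₀, n)) (o.rxNode (l₀, n)) ω) else 0) ∂μ
      = ∫⁻ y in B ∩ Set.Ioi (p.hdiff k l₀), p.mainDens o a κ s k l₀ c y := by
  rw [net.tsum_lintegral_eq_lintegral_plane o a κ s k l₀ c hB, lintegral_smul_measure]
  have hin : ∀ x : Plane, ∑ q : Role × Fin (K + 1),
      ∫⁻ z, (1 - p.meanFactor o a κ s k l₀ q.1 q.2
            (p.scoreOf a l₀ c (p.candDist o k l₀ x)) (p.refDist o k l₀ q.1 q.2 x z))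
          ∂(ENNReal.ofReal (p.dens q.1 q.2) • (volume : Measure Plane))
      = p.totExp o a κ s k l₀ c (p.candDist o k l₀ x) := by
    intro x
    refine Finset.sum_congr rfl fun q _ => ?_
    rw [lintegral_smul_measure, smul_eq_mul]
    congr 1
    have hm : Measurable fun u => 1 - p.meanFactor o a κ s k l₀ q.1 q.2
        (p.scoreOf a l₀ c (p.candDist o k l₀ x)) u :=
      ((p.measurable_meanFactor o a κ s k l₀ q.1 q.2).comp
        (measurable_const.prodMk measurable_id)).const_sub _
    rw [← lintegral_spatialDist _ hm]
    -- After the shift by `x`, only the score of the selected node remains, so the exponent is a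
    -- function of the main link length.
    exact lintegral_refPoint o q.1 x (fun v => 1 - p.meanFactor o a κ s k l₀ q.1 q.2
        (p.scoreOf a l₀ c (p.candDist o k l₀ x)) (spatialDist (p.refHeight o k l₀ q.1 q.2) v))
  simp_rw [hin]
  have hm : Measurable fun y => B.indicator 1 y * nexp (ENNReal.ofReal s * ENNReal.ofReal p.noise)
      * ENNReal.ofReal (p.rhoSel o k l₀ c y) * nexp (p.totExp o a κ s k l₀ c y) :=
    (((measurable_one.indicator hB).mul_const _).mul
      (p.measurable_rhoSel o k l₀ c).ennreal_ofReal).mul (p.measurable_totExp o a κ s k l₀ c).nexp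
  have hm2 : Measurable fun y => ENNReal.ofReal (2 * Real.pi * y) * (B.indicator 1 y
      * nexp (ENNReal.ofReal s * ENNReal.ofReal p.noise)
      * ENNReal.ofReal (p.rhoSel o k l₀ c y) * nexp (p.totExp o a κ s k l₀ c y)) :=
    Measurable.mul (by fun_prop) hm
  rw [show ∫⁻ x, B.indicator 1 (p.candDist o k l₀ x)
        * nexp (ENNReal.ofReal s * ENNReal.ofReal p.noise)
        * ENNReal.ofReal (p.rhoSel o k l₀ c (p.candDist o k l₀ x))
        * nexp (p.totExp o a κ s k l₀ c (p.candDist o k l₀ x)) = _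
      from lintegral_spatialDist _ hm, p.abs_refHeight_candRole, smul_eq_mul,
    ← lintegral_const_mul _ hm2,
    ← Measure.restrict_restrict hB, ← lintegral_indicator hB]
  refine lintegral_congr fun y => ?_
  by_cases hy : y ∈ B
  · simp only [Set.indicator_of_mem hy, Params.mainDens, Pi.one_apply]
    ring
  · simp only [Set.indicator_of_notMem hy, zero_mul, mul_zero]

end Network

/-! ### Splitting the exponent by role and environment -/

namespace Params

variable {K : ℕ} (p : Params K)

/-- `exclusion` is the distance at which the two scores tie, and scores decrease strictly with
distance. -/
lemma scoreOf_lt_scoreOf_iff (a : Criterion) (l₀ l : Fin (K + 1)) (c c' : Channel) {y u : ℝ}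
    (hy : 0 < y) (hu : 0 < u) :
    p.scoreOf a l₀ c y < p.scoreOf a l c' u ↔ u < p.exclusion a l₀ l c c' y := by
  have hb := p.bias_pos l
  have hb₀ := p.bias_pos l₀
  cases a
  · simp only [scoreOf, exclusion]
    rw [lt_div_iff₀ hb₀, ← div_eq_mul_inv, ← div_eq_mul_inv, div_lt_div_iff₀ hy hu]
    constructor <;> intro h <;> linarith
  · simp only [scoreOf, exclusion]
    have hα := p.alpha_pos c'
    have hA : 0 ≤ y ^ p.alpha c * p.bias l / p.bias l₀ := by positivity
    rw [one_div, Real.lt_rpow_inv_iff_of_pos hu.le hA hα, Real.rpow_neg hy.le, Real.rpow_neg hu.le,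
      ← div_eq_mul_inv, ← div_eq_mul_inv,
      div_lt_div_iff₀ (Real.rpow_pos_of_pos hy _) (Real.rpow_pos_of_pos hu _), lt_div_iff₀ hb₀]
    constructor <;> intro h <;> linarith

lemma exclusion_self (a : Criterion) (l : Fin (K + 1)) (c : Channel) {y : ℝ} (hy : 0 ≤ y) :
    p.exclusion a l l c c y = y := by
  have hb := (p.bias_pos l).ne'
  cases a
  · simp only [exclusion]
    field_simp
  · simp only [exclusion]
    rw [mul_div_assoc, div_self hb, mul_one, one_div, Real.rpow_rpow_inv hy (p.alpha_pos c).ne']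

/-- Laplace transform at `s` of the power received over a link of length `u`. -/
noncomputable def lapFactor (s : ℝ) (l : Fin (K + 1)) (c : Channel) (u : ℝ) : ℝ :=
  (1 / (1 + s * p.power l * u ^ (-p.alpha c) / p.m c)) ^ p.m c

lemma lapFactor_mem {s : ℝ} (hs : 0 ≤ s) (l : Fin (K + 1)) (c : Channel) {u : ℝ} (hu : 0 ≤ u) :
    p.lapFactor s l c u ∈ Set.Icc (0 : ℝ) 1 := by
  have h : 0 ≤ s * p.power l * u ^ (-p.alpha c) / p.m c := by
    have := (p.power_pos l).le
    positivity
  refine ⟨by rw [lapFactor]; positivity, pow_le_one₀ (by positivity) ?_⟩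
  rw [div_le_one (by linarith)]
  linarith

lemma measurable_lapFactor (s : ℝ) (l : Fin (K + 1)) (c : Channel) :
    Measurable (p.lapFactor s l c) := by
  unfold lapFactor
  fun_prop

lemma lintegral_nexp_power {s : ℝ} (hs : 0 ≤ s) (l : Fin (K + 1)) (c : Channel) {u : ℝ}
    (hu : 0 ≤ u) :
    ∫⁻ g, nexp (ENNReal.ofReal s * ENNReal.ofReal (p.power l * g * u ^ (-p.alpha c)))
      ∂(gammaMeasure (p.m c) (p.m c)) = ENNReal.ofReal (p.lapFactor s l c u) := by
  have hm : (0 : ℝ) < p.m c := by exact_mod_cast p.m_pos c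
  have hP := (p.power_pos l).le
  have hθ : 0 ≤ s * p.power l * u ^ (-p.alpha c) := by positivity
  have h0 : ∀ᵐ g ∂(gammaMeasure (p.m c) (p.m c)), 0 ≤ g := by
    rw [ae_iff]
    simp only [not_le]
    exact gammaMeasure_Iio_zero (p.m c) (p.m c)
  rw [lintegral_congr_ae (h0.mono fun g hg => ?_),
    lintegral_exp_neg_mul_gammaMeasure hm hm hθ, Real.rpow_natCast, lapFactor]
  · congr 2
    field_simp
  · have hg : (0 : ℝ) ≤ g := hg
    rw [← ENNReal.ofReal_mul hs, nexp_ofReal (by positivity)]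
    congr 3
    ring

lemma lintegral_nexp_cost (o : Subject) (a : Criterion) (κ : ℝ) {s : ℝ} (hs : 0 ≤ s) (t : ℝ)
    (r : Role) (l : Fin (K + 1)) (c : Channel) {u : ℝ} (hu : 0 ≤ u) :
    ∫⁻ g, nexp (p.cost o a κ s t r l c u g) ∂(gammaMeasure (p.m c) (p.m c))
      = if r = o.candRole ∧ t < κ * p.scoreOf a l c u then 0
        else if r = .tx then ENNReal.ofReal (p.lapFactor s l c u) else 1 := by
  simp only [cost]
  split_ifs with h1 h2 h2
  · simp
  · simp
  · simpa using p.lintegral_nexp_power hs l c hu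
  · simp

/-- The environment probabilities add up to one, so the complement splits environment by
environment, which is the thinning into LoS and NLoS nodes. A forbidden candidate counts fully; an
admissible transmitter counts with `1 - lapFactor`. -/
lemma one_sub_meanFactor (o : Subject) (a : Criterion) (κ : ℝ) {s : ℝ} (hs : 0 ≤ s)
    (k l₀ : Fin (K + 1)) (r : Role) (l : Fin (K + 1)) (t : ℝ) {u : ℝ}
    (hu : |p.refHeight o k l₀ r l| ≤ u) :
    1 - p.meanFactor o a κ s k l₀ r l t u
      = ∑ c, ENNReal.ofReal (channelProb (p.losProb o k l₀ r l u) c)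
        * ((if r = o.candRole ∧ t < κ * p.scoreOf a l c u then 1 else 0)
          + if r = .tx ∧ ¬ (r = o.candRole ∧ t < κ * p.scoreOf a l c u)
            then ENNReal.ofReal (1 - p.lapFactor s l c u) else 0) := by
  have hu0 : 0 ≤ u := (abs_nonneg _).trans hu
  have hle := p.meanFactor_le_one o a κ s k l₀ r l t hu
  refine (ENNReal.eq_sub_of_add_eq (hle.trans_lt ENNReal.one_lt_top).ne ?_).symm
  rw [meanFactor, ← Finset.sum_add_distrib]
  refine Eq.trans ?_ (sum_ofReal_channelProb (p.losProb_mem o k l₀ r l hu))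
  refine Finset.sum_congr rfl fun c _ => ?_
  rw [← mul_add, p.lintegral_nexp_cost o a κ hs t r l c hu0]
  have hL := p.lapFactor_mem hs l c hu0
  by_cases h1 : r = o.candRole ∧ t < κ * p.scoreOf a l c u
  · simp [h1]
  · by_cases h2 : r = .tx
    · simp only [if_neg h1, if_pos h2, if_pos (And.intro h2 h1), zero_add]
      rw [← ENNReal.ofReal_add (by linarith [hL.2]) hL.1]
      simp
    · simp only [if_neg h1, h2, false_and, if_false, zero_add]
      simp

/-- Contribution to `totExp` of the candidates in layer `l` with environment `c'`. -/
noncomputable def candExp (o : Subject) (a : Criterion) (κ : ℝ) (k l₀ : Fin (K + 1)) (c : Channel)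
    (y : ℝ) (l : Fin (K + 1)) (c' : Channel) : ℝ≥0∞ :=
  ENNReal.ofReal (p.dens o.candRole l) * ∫⁻ u in Set.Ioi (p.hdiff k l),
    (ENNReal.ofReal (2 * Real.pi * u) * ENNReal.ofReal (p.rhoSel o k l c' u))
      * {u | p.scoreOf a l₀ c y < κ * p.scoreOf a l c' u}.indicator 1 u

/-- Contribution to `totExp` of the interferers in layer `l` with environment `c'`. -/
noncomputable def interfExp (o : Subject) (a : Criterion) (κ s : ℝ) (k l₀ : Fin (K + 1))
    (c : Channel) (y : ℝ) (l : Fin (K + 1)) (c' : Channel) : ℝ≥0∞ :=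
  ENNReal.ofReal (p.dens .tx l) * ∫⁻ u in Set.Ioi |p.refHeight o k l₀ .tx l|,
    (ENNReal.ofReal (2 * Real.pi * u)
      * ENNReal.ofReal (channelProb (p.losProb o k l₀ .tx l u) c'))
      * {u | ¬ (Role.tx = o.candRole ∧ p.scoreOf a l₀ c y < κ * p.scoreOf a l c' u)}.indicator
        (fun u => ENNReal.ofReal (1 - p.lapFactor s l c' u)) u

lemma measurableSet_scoreOf (a : Criterion) (κ t : ℝ) (l : Fin (K + 1)) (c : Channel) :
    MeasurableSet {u | t < κ * p.scoreOf a l c u} :=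
  measurableSet_lt measurable_const ((p.measurable_scoreOf a l c).const_mul κ)

-- The first sum becomes the void probabilities that express association, the second one the Laplace
-- exponent of the admissible interferers. For `.receiver` both come from the transmitters; for
-- `.transmitter` they come from different roles.
open Classical in
lemma totExp_eq (o : Subject) (a : Criterion) (κ : ℝ) {s : ℝ} (hs : 0 ≤ s) (k l₀ : Fin (K + 1))
    (c : Channel) (y : ℝ) :
    p.totExp o a κ s k l₀ c y
      = ∑ q : Fin (K + 1) × Channel, p.candExp o a κ k l₀ c y q.1 q.2
        + ∑ q : Fin (K + 1) × Channel, p.interfExp o a κ s k l₀ c y q.1 q.2 := by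
  set t := p.scoreOf a l₀ c y with ht
  let w : Role → Fin (K + 1) → Channel → ℝ → ℝ≥0∞ := fun r l c' u =>
    ENNReal.ofReal (2 * Real.pi * u) * ENNReal.ofReal (channelProb (p.losProb o k l₀ r l u) c')
  let S : Fin (K + 1) → Channel → Set ℝ := fun l c' => {u | t < κ * p.scoreOf a l c' u}
  let T : Fin (K + 1) → Channel → Set ℝ := fun l c' =>
    {u | ¬ (Role.tx = o.candRole ∧ t < κ * p.scoreOf a l c' u)}
  have hS : ∀ l c', MeasurableSet (S l c') := fun l c' => p.measurableSet_scoreOf a κ t l c'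
  have hT : ∀ l c', MeasurableSet (T l c') := fun l c' =>
    ((MeasurableSet.const _).inter (hS l c')).compl
  have hw : ∀ r l c', Measurable (w r l c') := fun r l c' => Measurable.mul (by fun_prop)
    ((measurable_channelProb c').comp (p.measurable_losProb o k l₀ r l)).ennreal_ofReal
  have hI : ∀ l c', Measurable ((T l c').indicator
      fun u => ENNReal.ofReal (1 - p.lapFactor s l c' u)) := fun l c' =>
    ((p.measurable_lapFactor s l c').const_sub 1).ennreal_ofReal.indicator (hT l c')
  have hq : ∀ r l, ∫⁻ u in Set.Ioi |p.refHeight o k l₀ r l|, ENNReal.ofReal (2 * Real.pi * u)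
      * (1 - p.meanFactor o a κ s k l₀ r l t u)
      = ∑ c', ((if r = o.candRole then ∫⁻ u in Set.Ioi |p.refHeight o k l₀ r l|,
          w r l c' u * (S l c').indicator 1 u else 0)
        + if r = .tx then ∫⁻ u in Set.Ioi |p.refHeight o k l₀ r l|,
          w r l c' u * (T l c').indicator (fun u => ENNReal.ofReal (1 - p.lapFactor s l c' u)) u
          else 0) := by
    intro r l
    have h1 : ∀ c', Measurable fun u => w r l c' u * (S l c').indicator 1 u := fun c' =>
      (hw r l c').mul (measurable_one.indicator (hS l c'))
    have h2 : ∀ c', Measurable fun u => w r l c' u * (T l c').indicator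
      (fun u => ENNReal.ofReal (1 - p.lapFactor s l c' u)) u := fun c' => (hw r l c').mul (hI l c')
    have h3 : ∀ c', Measurable fun u => (if r = o.candRole then
        w r l c' u * (S l c').indicator 1 u else 0) := by
      intro c'
      split_ifs
      exacts [h1 c', measurable_const]
    have h4 : ∀ c', Measurable fun u => (if r = .tx then w r l c' u * (T l c').indicator
        (fun u => ENNReal.ofReal (1 - p.lapFactor s l c' u)) u else 0) := by
      intro c'
      split_ifs
      exacts [h2 c', measurable_const]
    have h5 : ∀ u ∈ Set.Ioi |p.refHeight o k l₀ r l|, ENNReal.ofReal (2 * Real.pi * u)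
        * (1 - p.meanFactor o a κ s k l₀ r l t u) = ∑ c', ((if r = o.candRole then
        w r l c' u * (S l c').indicator 1 u else 0) + (if r = .tx then w r l c' u *
        (T l c').indicator (fun u => ENNReal.ofReal (1 - p.lapFactor s l c' u)) u else 0)) := by
      intro u hu
      rw [p.one_sub_meanFactor o a κ hs k l₀ r l t (le_of_lt hu), Finset.mul_sum]
      refine Finset.sum_congr rfl fun c' _ => ?_
      rw [← mul_assoc, mul_add]
      congr 1
      · by_cases h : r = o.candRole <;> by_cases h' : u ∈ S l c'
        · rw [if_pos h, if_pos ⟨h, h'⟩, Set.indicator_of_mem h']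
          rfl
        · rw [if_pos h, if_neg (fun h'' => h' h''.2), Set.indicator_of_notMem h']
        · simp [h]
        · simp [h]
      · by_cases h : r = .tx
        · subst h
          by_cases h' : u ∈ T l c'
          · rw [if_pos rfl, if_pos ⟨rfl, h'⟩, Set.indicator_of_mem h']
          · rw [if_pos rfl, if_neg (fun h'' => h' h''.2), Set.indicator_of_notMem h']
        · simp [h]
    rw [setLIntegral_congr_fun measurableSet_Ioi h5]
    refine (lintegral_finsetSum _ fun c' _ => ?_).trans (Finset.sum_congr rfl fun c' _ => ?_)
    · exact (h3 c').add (h4 c')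
    rw [lintegral_add_left (h3 c')]
    congr 1
    · split_ifs <;> simp
    · split_ifs <;> simp
  simp only [totExp, ← ht, hq, Fintype.sum_prod_type, ← Finset.sum_add_distrib, Finset.mul_sum,
    mul_add]
  rw [sum_role]
  simp only [Finset.sum_add_distrib]
  have hcand : ∀ l c', (∫⁻ u in Set.Ioi |p.refHeight o k l₀ o.candRole l|,
      w o.candRole l c' u * (S l c').indicator 1 u)
      = ∫⁻ u in Set.Ioi (p.hdiff k l),
    (ENNReal.ofReal (2 * Real.pi * u) * ENNReal.ofReal (p.rhoSel o k l c' u))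
      * (S l c').indicator 1 u := by
    intro l c'
    rw [p.abs_refHeight_candRole]
    cases o <;> cases c' <;> rfl
  cases o
  · simp only [Subject.candRole] at hcand ⊢
    simp only [hcand, if_true, reduceCtorEq, if_false, mul_zero, Finset.sum_const_zero, add_zero]
    rfl
  · simp only [Subject.candRole] at hcand ⊢
    simp only [hcand, if_true, reduceCtorEq, if_false, mul_zero, Finset.sum_const_zero, add_zero,
      zero_add]
    rw [add_comm]
    rfl

end Params

/-! ### The exponents at margin `1` as the analytic expressions -/

namespace Params

variable {K : ℕ} (p : Params K)

lemma rhoSel_mem (o : Subject) (k l : Fin (K + 1)) (c : Channel) {d : ℝ} (hd : p.hdiff k l ≤ d) :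
    p.rhoSel o k l c d ∈ Set.Icc (0 : ℝ) 1 := by
  have h : p.losProb o k l o.candRole l d ∈ Set.Icc (0 : ℝ) 1 :=
    p.losProb_mem o k l _ l (by rwa [p.abs_refHeight_candRole])
  rw [← channelProb_losProb_candRole]
  refine ⟨channelProb_nonneg h c, ?_⟩
  cases c
  · exact h.2
  · have := h.1
    simp only [channelProb]
    linarith

lemma nearestExponent_nonneg (o : Subject) (k l : Fin (K + 1)) (c : Channel) {v : ℝ}
    (hv : p.hdiff k l ≤ v) : 0 ≤ p.nearestExponent o k l c v := by
  refine intervalIntegral.integral_nonneg hv fun x hx => ?_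
  have h1 := (p.rhoSel_mem o k l c hx.1).1
  have h2 : 0 ≤ p.candDens o l := p.dens_nonneg _ _
  have h3 := (p.hdiff_nonneg k l).trans hx.1
  positivity

lemma ofReal_nearestExponent (o : Subject) (k l : Fin (K + 1)) (c : Channel) {v : ℝ}
    (hv : p.hdiff k l ≤ v) :
    ENNReal.ofReal (p.nearestExponent o k l c v)
      = ENNReal.ofReal (p.dens o.candRole l) * ∫⁻ u in Set.Ioc (p.hdiff k l) v,
        ENNReal.ofReal (2 * Real.pi * u) * ENNReal.ofReal (p.rhoSel o k l c u) := by
  have h2 : 0 ≤ p.candDens o l := p.dens_nonneg _ _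
  have hmeas : Measurable fun x => 2 * Real.pi * p.candDens o l * x * p.rhoSel o k l c x :=
    Measurable.mul (by fun_prop) (p.measurable_rhoSel o k l c)
  have hnn : ∀ x ∈ Set.Ioc (p.hdiff k l) v,
      0 ≤ 2 * Real.pi * p.candDens o l * x * p.rhoSel o k l c x := by
    intro x hx
    have h1 := (p.rhoSel_mem o k l c hx.1.le).1
    have h3 := (p.hdiff_nonneg k l).trans hx.1.le
    positivity
  have hint : IntegrableOn (fun x => 2 * Real.pi * p.candDens o l * x * p.rhoSel o k l c x)
      (Set.Ioc (p.hdiff k l) v) := by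
    refine IntegrableOn.of_bound (by simp) hmeas.aestronglyMeasurable
      (2 * Real.pi * p.candDens o l * v * 1) ?_
    refine (ae_restrict_iff' measurableSet_Ioc).2 (Eventually.of_forall fun x hx => ?_)
    have h1 := (p.rhoSel_mem o k l c hx.1.le).1
    have h1' := (p.rhoSel_mem o k l c hx.1.le).2
    have h3 := (p.hdiff_nonneg k l).trans hx.1.le
    have hx2 := hx.2
    have hv0 := h3.trans hx2
    rw [Real.norm_of_nonneg (hnn x hx)]
    gcongr
  have hm : Measurable fun u => ENNReal.ofReal (2 * Real.pi * u)
      * ENNReal.ofReal (p.rhoSel o k l c u) :=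
    Measurable.mul (by fun_prop) (p.measurable_rhoSel o k l c).ennreal_ofReal
  rw [nearestExponent, intervalIntegral.integral_of_le hv,
    ofReal_integral_eq_lintegral_ofReal hint
      ((ae_restrict_iff' measurableSet_Ioc).2 (Eventually.of_forall hnn)),
    ← lintegral_const_mul _ hm]
  refine setLIntegral_congr_fun measurableSet_Ioc fun x hx => ?_
  have h3 := (p.hdiff_nonneg k l).trans hx.1.le
  rw [← ENNReal.ofReal_mul (by positivity), ← ENNReal.ofReal_mul (p.dens_nonneg _ _)]
  congr 1
  simp only [candDens]
  ring

/-- At margin `1` the forbidden candidates are those closer than `exclusion`, and the exponent is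
their mean number. The `max` makes the range empty when `exclusion` is below the altitude
difference. -/
lemma candExp_one (o : Subject) (a : Criterion) (k l₀ l : Fin (K + 1)) (c c' : Channel) {y : ℝ}
    (hy : 0 < y) :
    p.candExp o a 1 k l₀ c y l c' = ENNReal.ofReal (p.nearestExponent o k l c'
      (max (p.exclusion a l₀ l c c' y) (p.hdiff k l))) := by
  rw [p.ofReal_nearestExponent o k l c' (le_max_right _ _), candExp,
    ← setLIntegral_congr (Ioo_ae_eq_Ioc (μ := volume))]
  congr 1
  rw [← lintegral_indicator measurableSet_Ioi, ← lintegral_indicator measurableSet_Ioo]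
  refine lintegral_congr fun u => ?_
  by_cases hu : u ∈ Set.Ioi (p.hdiff k l)
  · have hu0 : 0 < u := lt_of_le_of_lt (p.hdiff_nonneg k l) hu
    have hiff := p.scoreOf_lt_scoreOf_iff a l₀ l c c' hy hu0
    rw [Set.indicator_of_mem hu]
    by_cases hR : u < p.exclusion a l₀ l c c' y
    · rw [Set.indicator_of_mem, Set.indicator_of_mem, Pi.one_apply, mul_one]
      · exact ⟨hu, lt_max_of_lt_left hR⟩
      · simpa [hiff] using hR
    · rw [Set.indicator_of_notMem, Set.indicator_of_notMem, mul_zero]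
      · exact fun h => (lt_max_iff.1 h.2).elim hR (lt_asymm hu)
      · simpa [hiff] using hR
  · rw [Set.indicator_of_notMem hu, Set.indicator_of_notMem (fun h => hu h.1)]

lemma ofReal_nearestCCDF (o : Subject) (k l : Fin (K + 1)) (c : Channel) (v : ℝ) :
    ENNReal.ofReal (p.nearestCCDF o k l c v)
      = nexp (ENNReal.ofReal (p.nearestExponent o k l c (max v (p.hdiff k l)))) := by
  rw [nexp_ofReal (p.nearestExponent_nonneg o k l c (le_max_right _ _)), nearestCCDF]

lemma nearestCCDF_nonneg (o : Subject) (k l : Fin (K + 1)) (c : Channel) (v : ℝ) :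
    0 ≤ p.nearestCCDF o k l c v := (Real.exp_pos _).le

lemma nearestPDF_eq (o : Subject) (k l : Fin (K + 1)) (c : Channel) {y : ℝ}
    (hy : p.hdiff k l ≤ y) :
    p.nearestPDF o k l c y
      = 2 * Real.pi * p.candDens o l * y * p.rhoSel o k l c y * p.nearestCCDF o k l c y := by
  rw [nearestPDF, if_neg (not_lt.2 hy), nearestCCDF, max_eq_left hy]

/-- By `exclusion_self`, the exponential in the PDF of the selected type is exactly the CCDF factor
that is missing from the product. -/
lemma assocDensity_eq (o : Subject) (a : Criterion) (k l : Fin (K + 1)) (c : Channel) {y : ℝ}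
    (hy : p.hdiff k l ≤ y) :
    p.assocDensity o a k l c y = 2 * Real.pi * p.candDens o l * y * p.rhoSel o k l c y
      * ∏ q : Fin (K + 1) × Channel, p.nearestCCDF o k q.1 q.2 (p.exclusion a l q.1 c q.2 y) := by
  rw [assocDensity, p.nearestPDF_eq o k l c hy, mul_assoc,
    ← Finset.mul_prod_erase _ _ (Finset.mem_univ (l, c)),
    p.exclusion_self a l c ((p.hdiff_nonneg k l).trans hy)]

lemma assocDensity_of_lt (o : Subject) (a : Criterion) (k l : Fin (K + 1)) (c : Channel) {y : ℝ}
    (hy : y < p.hdiff k l) : p.assocDensity o a k l c y = 0 := by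
  rw [assocDensity, nearestPDF, if_pos hy, zero_mul]

lemma assocDensity_nonneg (o : Subject) (a : Criterion) (k l : Fin (K + 1)) (c : Channel) (y : ℝ) :
    0 ≤ p.assocDensity o a k l c y := by
  rcases lt_or_ge y (p.hdiff k l) with hy | hy
  · rw [p.assocDensity_of_lt o a k l c hy]
  · rw [p.assocDensity_eq o a k l c hy]
    have h1 := (p.rhoSel_mem o k l c hy).1
    have h2 : 0 ≤ p.candDens o l := p.dens_nonneg _ _
    have h3 := (p.hdiff_nonneg k l).trans hy
    have h4 : 0 ≤ ∏ q : Fin (K + 1) × Channel,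
        p.nearestCCDF o k q.1 q.2 (p.exclusion a l q.1 c q.2 y) :=
      Finset.prod_nonneg fun q _ => p.nearestCCDF_nonneg _ _ _ _ _
    positivity

lemma abs_refHeight_tx (o : Subject) (i j l : Fin (K + 1)) :
    |p.refHeight o (o.selecting i j) (o.selected i j) .tx l| = p.hdiff i l := by
  cases o <;> rfl

lemma channelProb_losProb_tx (o : Subject) (i j l : Fin (K + 1)) (c : Channel) (u : ℝ) :
    channelProb (p.losProb o (o.selecting i j) (o.selected i j) .tx l u) c = p.rho i l c u := by
  cases o <;> cases c <;> rfl

lemma rho_mem (i l : Fin (K + 1)) (c : Channel) {d : ℝ} (hd : p.hdiff i l ≤ d) :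
    p.rho i l c d ∈ Set.Icc (0 : ℝ) 1 :=
  p.rhoSel_mem .receiver i l c hd

/-- For `.receiver` the interferers are themselves candidates, hence no closer than `exclusion`; for
`.transmitter` they are not and `chi = 0` imposes nothing. -/
lemma nexp_interfExp_one (o : Subject) (a : Criterion) {s : ℝ} (i j l : Fin (K + 1))
    (c c' : Channel) {y : ℝ} (hy : 0 < y) :
    nexp (p.interfExp o a 1 s (o.selecting i j) (o.selected i j) c y l c')
      = ENNReal.ofReal (p.lapInterference o a i j c y l c' s) := by
  rw [lapInterference, ofReal_expNeg]
  congr 1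
  rw [interfExp, p.abs_refHeight_tx, mul_comm (2 * Real.pi), ENNReal.ofReal_mul (p.dens_nonneg _ _),
    mul_assoc]
  congr 1
  have hm : Measurable fun x => ENNReal.ofReal (x * p.rho i l c' x *
        (1 - (1 / (1 + s * p.power l * x ^ (-p.alpha c') / p.m c')) ^ p.m c')) := by
    have h1 : Measurable (p.rho i l c') := p.measurable_rhoSel .receiver i l c'
    have h2 := p.measurable_lapFactor s l c'
    unfold lapFactor at h2
    exact ((measurable_id.mul h1).mul (h2.const_sub 1)).ennreal_ofReal
  -- An interferer exactly at the exclusion distance is admissible, so closed half-lines match the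
  -- strict comparison of scores. The endpoints, and below the point `0`, are null.
  rw [← lintegral_const_mul _ hm, setLIntegral_congr (Ioi_ae_eq_Ici (μ := volume)),
    setLIntegral_congr (Ioi_ae_eq_Ici (μ := volume)),
    ← lintegral_indicator measurableSet_Ici, ← lintegral_indicator measurableSet_Ici]
  refine lintegral_congr_ae ?_
  filter_upwards [Measure.ae_ne volume 0] with u hu0
  by_cases hu : u ∈ Set.Ici (p.hdiff i l)
  swap
  · rw [Set.indicator_of_notMem hu, Set.indicator_of_notMem]
    exact fun h => hu ((le_max_right _ _).trans (Set.mem_Ici.1 h))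
  have hu1 : 0 < u := lt_of_le_of_ne ((p.hdiff_nonneg i l).trans hu) (Ne.symm hu0)
  have hval : ENNReal.ofReal (2 * Real.pi * u) * ENNReal.ofReal (p.rho i l c' u)
      * ENNReal.ofReal (1 - p.lapFactor s l c' u) = ENNReal.ofReal (2 * Real.pi)
      * ENNReal.ofReal (u * p.rho i l c' u *
        (1 - (1 / (1 + s * p.power l * u ^ (-p.alpha c') / p.m c')) ^ p.m c')) := by
    have h1 := (p.rho_mem i l c' hu).1
    rw [← ENNReal.ofReal_mul (by positivity), ← ENNReal.ofReal_mul (by positivity),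
      ← ENNReal.ofReal_mul (by positivity), lapFactor]
    congr 1
    ring
  have hiff := p.scoreOf_lt_scoreOf_iff a (o.selected i j) l c c' hy hu1
  rw [Set.indicator_of_mem hu, p.channelProb_losProb_tx]
  have hchi : (¬ (Role.tx = o.candRole ∧ p.scoreOf a (o.selected i j) c y
      < 1 * p.scoreOf a l c' u)) ↔ p.chi o a j l c c' y ≤ u := by
    rw [one_mul, hiff]
    cases o
    · simp [Subject.candRole, chi, Subject.selected]
    · simp [Subject.candRole, chi, hu1.le]
  by_cases hR : p.chi o a j l c c' y ≤ u
  · rw [Set.indicator_of_mem (hchi.2 hR), Set.indicator_of_mem, hval]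
    exact max_le hR hu
  · rw [Set.indicator_of_notMem fun h => hR (hchi.1 h), mul_zero,
      Set.indicator_of_notMem]
    exact fun h => hR ((le_max_left _ _).trans (Set.mem_Ici.1 h))

lemma lapInterference_nonneg (o : Subject) (a : Criterion) (i j : Fin (K + 1)) (c : Channel)
    (y : ℝ) (l : Fin (K + 1)) (c' : Channel) (s : ℝ) :
    0 ≤ p.lapInterference o a i j c y l c' s := expNeg_nonneg _

lemma lapTotal_nonneg (o : Subject) (a : Criterion) (i j : Fin (K + 1)) (c : Channel)
    (y s : ℝ) : 0 ≤ p.lapTotal o a i j c y s :=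
  mul_nonneg (Real.exp_pos _).le (Finset.prod_nonneg fun _ _ => expNeg_nonneg _)

/-- For margin `1`, the weighted density is given by the analytic expressions. -/
theorem mainDens_one (o : Subject) (a : Criterion) {s : ℝ} (hs : 0 ≤ s) (i j : Fin (K + 1))
    (c : Channel) {y : ℝ} (hy : p.hdiff (o.selecting i j) (o.selected i j) < y) :
    p.mainDens o a 1 s (o.selecting i j) (o.selected i j) c y
      = ENNReal.ofReal (p.assocDensity o a (o.selecting i j) (o.selected i j) c y)
        * ENNReal.ofReal (p.lapTotal o a i j c y s) := by
  have hy0 : 0 < y := lt_of_le_of_lt (p.hdiff_nonneg _ _) hy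
  have hρ := (p.rhoSel_mem o (o.selecting i j) (o.selected i j) c hy.le).1
  have hd : 0 ≤ p.candDens o (o.selected i j) := p.dens_nonneg _ _
  rw [mainDens, p.totExp_eq o a 1 hs, nexp_add, nexp_sum, nexp_sum]
  simp_rw [p.nexp_interfExp_one o a i j _ c _ hy0, p.candExp_one o a _ _ _ c _ hy0,
    ← p.ofReal_nearestCCDF]
  rw [← ENNReal.ofReal_prod_of_nonneg fun _ _ => p.nearestCCDF_nonneg _ _ _ _ _,
    ← ENNReal.ofReal_prod_of_nonneg fun _ _ => p.lapInterference_nonneg _ _ _ _ _ _ _ _ _,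
    p.assocDensity_eq o a _ _ c hy.le, lapTotal, ← ENNReal.ofReal_mul hs,
    nexp_ofReal (mul_nonneg hs p.noise_nonneg),
    ENNReal.ofReal_mul (Real.exp_pos _).le,
    ENNReal.ofReal_mul (mul_nonneg (by positivity) hρ),
    show 2 * Real.pi * p.candDens o (o.selected i j) * y
      * p.rhoSel o (o.selecting i j) (o.selected i j) c y
      = p.candDens o (o.selected i j) * (2 * Real.pi * y)
        * p.rhoSel o (o.selecting i j) (o.selected i j) c y by ring,
    ENNReal.ofReal_mul (p := p.candDens o (o.selected i j) * (2 * Real.pi * y)) (by positivity),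
    ENNReal.ofReal_mul hd]
  simp only [candDens, neg_mul]
  ring

end Params

/-! ### The limit `κ → 1` of the margin densities -/

namespace Params

variable {K : ℕ} (p : Params K)

lemma scoreOf_pos (a : Criterion) (l : Fin (K + 1)) (c : Channel) {d : ℝ} (hd : 0 < d) :
    0 < p.scoreOf a l c d := by
  have := p.bias_pos l
  cases a <;> simp only [scoreOf] <;> positivity

lemma scoreOf_injOn (a : Criterion) (l : Fin (K + 1)) (c : Channel) :
    Set.InjOn (p.scoreOf a l c) (Set.Ioi 0) := by
  intro u hu v hv h
  have hu : 0 < u := hu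
  have hv : 0 < v := hv
  have h1 := p.scoreOf_lt_scoreOf_iff a l l c c hu hv
  have h2 := p.scoreOf_lt_scoreOf_iff a l l c c hv hu
  rw [p.exclusion_self a l c hu.le] at h1
  rw [p.exclusion_self a l c hv.le] at h2
  exact le_antisymm (not_lt.1 fun h' => (h1.2 h').ne h) (not_lt.1 fun h' => (h2.2 h').ne h.symm)

lemma tendsto_scoreOf (a : Criterion) (l : Fin (K + 1)) (c : Channel) :
    Tendsto (p.scoreOf a l c) atTop (𝓝 0) := by
  cases a
  · have h := tendsto_inv_atTop_zero.const_mul (p.bias l)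
    rwa [mul_zero] at h
  · have h := (tendsto_rpow_neg_atTop (p.alpha_pos c)).const_mul (p.bias l)
    rwa [mul_zero] at h

lemma candExp_integrand_le (a : Criterion) {κ κ' : ℝ} (h : κ ≤ κ') (t : ℝ)
    (l : Fin (K + 1)) (c : Channel) {u : ℝ} (hu : 0 < u) :
    {u | t < κ * p.scoreOf a l c u}.indicator (1 : ℝ → ℝ≥0∞) u
      ≤ {u | t < κ' * p.scoreOf a l c u}.indicator 1 u := by
  by_cases h1 : t < κ * p.scoreOf a l c u
  · have h2 : t < κ' * p.scoreOf a l c u :=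
      h1.trans_le (mul_le_mul_of_nonneg_right h (p.scoreOf_pos a l c hu).le)
    rw [Set.indicator_of_mem (s := {u | t < κ * p.scoreOf a l c u}) h1,
      Set.indicator_of_mem (s := {u | t < κ' * p.scoreOf a l c u}) h2]
  · rw [Set.indicator_of_notMem (s := {u | t < κ * p.scoreOf a l c u}) h1]
    exact zero_le

lemma candExp_mono (o : Subject) (a : Criterion) {κ κ' : ℝ} (h : κ ≤ κ') (k l₀ : Fin (K + 1))
    (c : Channel) (y : ℝ) (l : Fin (K + 1)) (c' : Channel) :
    p.candExp o a κ k l₀ c y l c' ≤ p.candExp o a κ' k l₀ c y l c' := by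
  refine mul_le_mul_right (setLIntegral_mono' measurableSet_Ioi fun u hu => ?_) _
  exact mul_le_mul_right (p.candExp_integrand_le a h _ l c'
    (lt_of_le_of_lt (p.hdiff_nonneg k l) hu)) _

/-- Scores tend to `0` at infinity while the threshold is positive, so the forbidden candidates lie
within a bounded distance `M`. -/
lemma lintegral_candExp_lt_top (o : Subject) (a : Criterion) (κ : ℝ) (k l₀ : Fin (K + 1))
    (c : Channel) {y : ℝ} (hy : 0 < y) (l : Fin (K + 1)) (c' : Channel) :
    ∫⁻ u in Set.Ioi (p.hdiff k l),
      (ENNReal.ofReal (2 * Real.pi * u) * ENNReal.ofReal (p.rhoSel o k l c' u))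
      * {u | p.scoreOf a l₀ c y < κ * p.scoreOf a l c' u}.indicator 1 u ≠ ∞ := by
  have hlim : Tendsto (fun u => κ * p.scoreOf a l c' u) atTop (𝓝 0) := by
    simpa using (p.tendsto_scoreOf a l c').const_mul κ
  obtain ⟨M, hM⟩ := eventually_atTop.1 (hlim.eventually_lt_const (p.scoreOf_pos a l₀ c hy))
  refine ne_top_of_le_ne_top (b := ∫⁻ u in Set.Ioi (p.hdiff k l),
    (Set.Ioo (p.hdiff k l) M).indicator (fun _ => ENNReal.ofReal (2 * Real.pi * M)) u) ?_
    (setLIntegral_mono' measurableSet_Ioi fun u hu => ?_)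
  · rw [lintegral_indicator measurableSet_Ioo, setLIntegral_const]
    refine ENNReal.mul_ne_top ENNReal.ofReal_ne_top ?_
    exact ((Measure.restrict_apply_le _ _).trans_lt (by simp)).ne
  · by_cases h : p.scoreOf a l₀ c y < κ * p.scoreOf a l c' u
    · have huM : u < M := not_le.1 fun hle => lt_asymm (hM u hle) h
      have hu0 := lt_of_le_of_lt (p.hdiff_nonneg k l) hu
      rw [Set.indicator_of_mem (s := {u | p.scoreOf a l₀ c y < κ * p.scoreOf a l c' u}) h,
        Set.indicator_of_mem (s := Set.Ioo (p.hdiff k l) M) ⟨hu, huM⟩, Pi.one_apply, mul_one]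
      refine (mul_le_of_le_one_right' ?_).trans ?_
      · exact ENNReal.ofReal_le_one.2 (p.rhoSel_mem o k l c' (le_of_lt hu)).2
      · gcongr
    · rw [Set.indicator_of_notMem (s := {u | p.scoreOf a l₀ c y < κ * p.scoreOf a l c' u}) h,
        mul_zero]
      exact zero_le

/-- The margin `2` dominates. The integrand converges unless the score of `u` ties with the
threshold, which by `scoreOf_injOn` happens for at most one `u > 0`. -/
lemma tendsto_candExp (o : Subject) (a : Criterion) (k l₀ : Fin (K + 1))
    (c : Channel) {y : ℝ} (hy : 0 < y) (l : Fin (K + 1)) (c' : Channel) {κ : ℕ → ℝ}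
    (hκ : ∀ n, κ n ∈ Set.Icc (1 : ℝ) 2) (hlim : Tendsto κ atTop (𝓝 1)) :
    Tendsto (fun n => p.candExp o a (κ n) k l₀ c y l c') atTop (𝓝 (p.candExp o a 1 k l₀ c y l c')) := by
  refine ENNReal.Tendsto.const_mul ?_ (Or.inr ENNReal.ofReal_ne_top)
  have hm : ∀ κ : ℝ, Measurable fun u => (ENNReal.ofReal (2 * Real.pi * u)
      * ENNReal.ofReal (p.rhoSel o k l c' u))
      * {u | p.scoreOf a l₀ c y < κ * p.scoreOf a l c' u}.indicator 1 u := fun κ =>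
    (Measurable.mul (by fun_prop) (p.measurable_rhoSel o k l c').ennreal_ofReal).mul
      (measurable_one.indicator (p.measurableSet_scoreOf a κ _ l c'))
  refine tendsto_lintegral_of_dominated_convergence _ (fun n => hm (κ n)) (fun n => ?_)
    (p.lintegral_candExp_lt_top o a 2 k l₀ c hy l c') ?_
  · refine (ae_restrict_iff' measurableSet_Ioi).2 (Eventually.of_forall fun u hu => ?_)
    exact mul_le_mul_right (p.candExp_integrand_le a (hκ n).2 _ l c'
      (lt_of_le_of_lt (p.hdiff_nonneg k l) hu)) _
  · have hnull : volume {u | u ∈ Set.Ioi (0 : ℝ) ∧ p.scoreOf a l c' u = p.scoreOf a l₀ c y} = 0 :=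
      Set.Subsingleton.measure_zero (fun u hu v hv =>
        p.scoreOf_injOn a l c' hu.1 hv.1 (hu.2.trans hv.2.symm)) _
    refine (ae_restrict_iff' measurableSet_Ioi).2 ?_
    filter_upwards [measure_eq_zero_iff_ae_notMem.1 hnull] with u hne hu
    have hu0 : 0 < u := lt_of_le_of_lt (p.hdiff_nonneg k l) hu
    refine tendsto_const_nhds.congr' ?_
    rcases lt_trichotomy (p.scoreOf a l c' u) (p.scoreOf a l₀ c y) with h | h | h
    · have h1 : Tendsto (fun n => κ n * p.scoreOf a l c' u) atTop (𝓝 (1 * p.scoreOf a l c' u)) :=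
        hlim.mul_const _
      rw [one_mul] at h1
      filter_upwards [h1.eventually_lt_const h] with n hn
      have hn' : ¬ p.scoreOf a l₀ c y < 1 * p.scoreOf a l c' u := by linarith
      have hn'' : ¬ p.scoreOf a l₀ c y < κ n * p.scoreOf a l c' u := not_lt.2 hn.le
      simp only [Set.indicator_apply, Set.mem_ofPred_eq, if_neg hn', if_neg hn'']
    · exact absurd ⟨hu0, h⟩ hne
    · refine Eventually.of_forall fun n => ?_
      have h1 : p.scoreOf a l₀ c y < 1 * p.scoreOf a l c' u := by rwa [one_mul]
      have h2 : p.scoreOf a l₀ c y < κ n * p.scoreOf a l c' u := h1.trans_le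
        (mul_le_mul_of_nonneg_right (hκ n).1 (p.scoreOf_pos a l c' hu0).le)
      simp only [Set.indicator_apply, Set.mem_ofPred_eq, if_pos h1, if_pos h2]

lemma totExp_zero (o : Subject) (a : Criterion) (κ : ℝ) (k l₀ : Fin (K + 1)) (c : Channel)
    (y : ℝ) :
    p.totExp o a κ 0 k l₀ c y = ∑ q : Fin (K + 1) × Channel, p.candExp o a κ k l₀ c y q.1 q.2 := by
  rw [p.totExp_eq o a κ le_rfl]
  refine (congrArg _ ?_).trans (add_zero _)
  refine Finset.sum_eq_zero fun q _ => ?_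
  have : ∀ u, ENNReal.ofReal (1 - p.lapFactor 0 q.1 q.2 u) = 0 := fun u => by simp [lapFactor]
  simp [interfExp, this]

lemma mainDens_le (o : Subject) (a : Criterion) {κ : ℝ} (hκ : 1 ≤ κ) (k l₀ : Fin (K + 1))
    (c : Channel) (y : ℝ) : p.mainDens o a κ 0 k l₀ c y ≤ p.mainDens o a 1 0 k l₀ c y := by
  refine mul_le_mul_right (mul_le_mul_right (nexp_antitone ?_) _) _
  rw [totExp_zero, totExp_zero]
  exact Finset.sum_le_sum fun q _ => p.candExp_mono o a hκ k l₀ c y q.1 q.2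

lemma tendsto_mainDens (o : Subject) (a : Criterion) (k l₀ : Fin (K + 1))
    (c : Channel) {y : ℝ} (hy : 0 < y) {κ : ℕ → ℝ}
    (hκ : ∀ n, κ n ∈ Set.Icc (1 : ℝ) 2) (hlim : Tendsto κ atTop (𝓝 1)) :
    Tendsto (fun n => p.mainDens o a (κ n) 0 k l₀ c y) atTop (𝓝 (p.mainDens o a 1 0 k l₀ c y)) := by
  refine ENNReal.Tendsto.const_mul (ENNReal.Tendsto.const_mul ?_ (Or.inr ?_)) (Or.inr ?_)
  · refine (continuous_nexp.tendsto _).comp ?_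
    simp only [totExp_zero]
    exact tendsto_finsetSum _ fun q _ => p.tendsto_candExp o a k l₀ c hy q.1 q.2 hκ hlim
  · exact ENNReal.mul_ne_top (nexp_ne_top _) ENNReal.ofReal_ne_top
  · exact ENNReal.mul_ne_top ENNReal.ofReal_ne_top ENNReal.ofReal_ne_top

lemma tendsto_lintegral_mainDens (o : Subject) (a : Criterion) (k l₀ : Fin (K + 1))
    (c : Channel) {κ : ℕ → ℝ} (hκ : ∀ n, κ n ∈ Set.Icc (1 : ℝ) 2) (hlim : Tendsto κ atTop (𝓝 1)) :
    Tendsto (fun n => ∫⁻ y in Set.Ioi (p.hdiff k l₀), p.mainDens o a (κ n) 0 k l₀ c y) atTop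
      (𝓝 (∫⁻ y in Set.Ioi (p.hdiff k l₀), p.mainDens o a 1 0 k l₀ c y)) := by
  simp_rw [← lintegral_indicator measurableSet_Ioi]
  refine tendsto_lintegral_of_le
    (fun n => (p.measurable_mainDens o a (κ n) 0 k l₀ c).indicator measurableSet_Ioi)
    (fun n y => Set.indicator_le_indicator (p.mainDens_le o a (hκ n).1 k l₀ c y)) fun y => ?_
  by_cases hy : y ∈ Set.Ioi (p.hdiff k l₀)
  · simp_rw [Set.indicator_of_mem hy]
    exact p.tendsto_mainDens o a k l₀ c (lt_of_le_of_lt (p.hdiff_nonneg k l₀) hy) hκ hlim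
  · simp_rw [Set.indicator_of_notMem hy]
    exact tendsto_const_nhds

end Params

/-! ### Measurability, and almost sure uniqueness of the associated node -/

namespace Network

variable {K : ℕ} {p : Params K} {Ω : Type*} [MeasurableSpace Ω] {μ : Measure Ω}
  (net : Network p μ)

lemma measurable_place (r : Role) (v : Node K) : Measurable (net.place r v) := by
  cases v with
  | none => exact measurable_const
  | some q => exact (net.poisson r q.1).measurable_pos q.2

lemma measurable_linkDist (k : Fin (K + 1)) (t r : Node K) : Measurable (net.linkDist k t r) := by
  have h1 := net.measurable_place .tx t
  have h2 := net.measurable_place .rx r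
  unfold linkDist
  fun_prop

lemma measurable_linkChannel (k : Fin (K + 1)) (t r : Node K) :
    Measurable (net.linkChannel k t r) :=
  measurable_channelOf.comp (((p.rhoLoS_measurable _ _).comp
    (net.measurable_linkDist k t r)).prodMk (net.unif_measurable t r))

lemma measurable_apply_channel_real {α : Type*} [MeasurableSpace α] {f : Channel → α → ℝ}
    (hf : ∀ c, Measurable (f c)) {C : α → Channel} (hC : Measurable C) :
    Measurable fun x => f (C x) x := by
  have h : (fun x => f (C x) x) = fun x => if C x = .los then f .los x else f .nlos x := by
    funext x
    cases h : C x <;> simp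
  rw [h]
  exact Measurable.ite (hC (measurableSet_singleton _)) (hf _) (hf _)

lemma measurable_rxPower (k : Fin (K + 1)) (t r : Node K) : Measurable (net.rxPower k t r) := by
  have h := fun c => net.gain_measurable c t r
  have h' := net.measurable_linkDist k t r
  refine measurable_apply_channel_real (f := fun c ω => p.power (layerOf k t) * net.gain c t r ω
    * net.linkDist k t r ω ^ (-p.alpha c)) (fun c => ?_) (net.measurable_linkChannel k t r)
  exact ((h c).const_mul _).mul (h'.pow_const _)

lemma measurableSet_active (r : Role) (q : Fin (K + 1) × ℕ) :
    MeasurableSet {ω | net.Active r q ω} :=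
  (net.poisson r q.1).measurable_num (MeasurableSet.of_discrete (s := Set.Ioi (q.2 : ℕ∞)))

lemma measurable_score (o : Subject) (a : Criterion) (k : Fin (K + 1)) (q : Fin (K + 1) × ℕ) :
    Measurable (net.score o a k q) := by
  have : net.score o a k q = fun ω => p.scoreOf a q.1
      (net.linkChannel k (o.txNode q) (o.rxNode q) ω)
      (net.linkDist k (o.txNode q) (o.rxNode q) ω) := funext fun ω => net.score_eq o a k q ω
  rw [this]
  exact measurable_apply_channel_real (f := fun c ω => p.scoreOf a q.1 c
    (net.linkDist k (o.txNode q) (o.rxNode q) ω)) (fun c => (p.measurable_scoreOf a q.1 c).comp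
    (net.measurable_linkDist _ _ _)) (net.measurable_linkChannel _ _ _)

lemma measurableSet_marginAssociated (o : Subject) (a : Criterion) (κ : ℝ) (k : Fin (K + 1))
    (q : Fin (K + 1) × ℕ) : MeasurableSet {ω | net.MarginAssociated o a κ k q ω} := by
  have : {ω | net.MarginAssociated o a κ k q ω} = {ω | net.Active o.candRole q ω} ∩
      ⋂ q', {ω | q' ≠ q → net.Active o.candRole q' ω →
        κ * net.score o a k q' ω ≤ net.score o a k q ω} := by
    ext ω
    simp [MarginAssociated]
  rw [this]
  refine (net.measurableSet_active _ q).inter (MeasurableSet.iInter fun q' => ?_)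
  by_cases h : q' = q
  · simp [h]
  · simp only [ne_eq, h, not_false_iff, true_implies]
    exact (net.measurableSet_active _ q').himp (measurableSet_le
      ((net.measurable_score o a k q').const_mul κ) (net.measurable_score o a k q))

/-- The event of `mainLink` with the margin `κ`. -/
def marginLink (o : Subject) (a : Criterion) (κ : ℝ) (k : Fin (K + 1)) (q : Fin (K + 1) × ℕ)
    (c : Channel) (B : Set ℝ) : Set Ω :=
  {ω | net.MarginAssociated o a κ k q ω ∧ net.linkChannel k (o.txNode q) (o.rxNode q) ω = c ∧
    net.linkDist k (o.txNode q) (o.rxNode q) ω ∈ B}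

lemma marginLink_one (o : Subject) (a : Criterion) (k : Fin (K + 1)) (q : Fin (K + 1) × ℕ)
    (c : Channel) (B : Set ℝ) : net.marginLink o a 1 k q c B = net.mainLink o a k q c B := by
  ext ω
  simp only [marginLink, mainLink, Set.mem_ofPred_eq, net.marginAssociated_one]

lemma measurableSet_marginLink (o : Subject) (a : Criterion) (κ : ℝ) (k : Fin (K + 1))
    (q : Fin (K + 1) × ℕ) (c : Channel) {B : Set ℝ} (hB : MeasurableSet B) :
    MeasurableSet (net.marginLink o a κ k q c B) :=
  (net.measurableSet_marginAssociated o a κ k q).inter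
    ((net.measurable_linkChannel _ _ _ (measurableSet_singleton c)).inter
      (net.measurable_linkDist _ _ _ hB))

lemma measurableSet_mainLink (o : Subject) (a : Criterion) (k : Fin (K + 1))
    (q : Fin (K + 1) × ℕ) (c : Channel) {B : Set ℝ} (hB : MeasurableSet B) :
    MeasurableSet (net.mainLink o a k q c B) := by
  rw [← marginLink_one]
  exact net.measurableSet_marginLink o a 1 k q c hB

lemma measurable_interferencePlusNoise (k : Fin (K + 1)) (t r : Node K) :
    Measurable (net.interferencePlusNoise k t r) := by
  classical
  refine Measurable.add_const (Measurable.tsum fun q => ?_) _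
  exact Measurable.ite ((net.measurableSet_active _ q).inter (MeasurableSet.const _))
    (net.measurable_rxPower k _ _).ennreal_ofReal measurable_const

lemma measurableSet_succeeds (o : Subject) (k : Fin (K + 1)) (q : Fin (K + 1) × ℕ) :
    MeasurableSet (net.succeeds o k q) :=
  measurableSet_lt measurable_const ((net.measurable_rxPower k _ _).ennreal_ofReal.div
    (net.measurable_interferencePlusNoise k _ _))

lemma linkDist_nonneg (k : Fin (K + 1)) (t r : Node K) (ω : Ω) : 0 ≤ net.linkDist k t r ω :=
  Real.sqrt_nonneg _

lemma score_pos (o : Subject) (a : Criterion) (k : Fin (K + 1)) (q : Fin (K + 1) × ℕ) {ω : Ω}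
    (h : 0 < net.linkDist k (o.txNode q) (o.rxNode q) ω) : 0 < net.score o a k q ω := by
  rw [score_eq]
  exact p.scoreOf_pos a _ _ h

lemma score_nonneg (o : Subject) (a : Criterion) (k : Fin (K + 1)) (q : Fin (K + 1) × ℕ) (ω : Ω) :
    0 ≤ net.score o a k q ω := by
  have hb := (p.bias_pos q.1).le
  have hd := net.linkDist_nonneg k (o.txNode q) (o.rxNode q) ω
  cases a <;> simp only [score] <;> positivity

variable [IsProbabilityMeasure μ]

theorem tsum_setLIntegral_nexp (o : Subject) (a : Criterion) (κ s : ℝ)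
    (k l₀ : Fin (K + 1)) (c : Channel) {B : Set ℝ} (hB : MeasurableSet B) :
    ∑' n : ℕ, ∫⁻ ω in net.marginLink o a κ k (l₀, n) c B, nexp (ENNReal.ofReal s
        * net.interferencePlusNoise k (o.txNode (l₀, n)) (o.rxNode (l₀, n)) ω) ∂μ
      = ∫⁻ y in B ∩ Set.Ioi (p.hdiff k l₀), p.mainDens o a κ s k l₀ c y := by
  classical
  rw [← net.tsum_lintegral_eq_lintegral_mainDens o a κ s k l₀ c hB]
  refine tsum_congr fun n => ?_
  rw [← lintegral_indicator (net.measurableSet_marginLink o a κ k (l₀, n) c hB)]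
  refine lintegral_congr fun ω => ?_
  rw [Set.indicator_apply]
  exact if_congr Iff.rfl rfl rfl

/-- The case `s = 0`: since `0 * ∞ = 0`, the integrand is `1` even where the interference is
infinite. -/
lemma tsum_measure_marginLink (o : Subject) (a : Criterion) (κ : ℝ)
    (k l₀ : Fin (K + 1)) (c : Channel) {B : Set ℝ} (hB : MeasurableSet B) :
    ∑' n : ℕ, μ (net.marginLink o a κ k (l₀, n) c B)
      = ∫⁻ y in B ∩ Set.Ioi (p.hdiff k l₀), p.mainDens o a κ 0 k l₀ c y := by
  simp [← net.tsum_setLIntegral_nexp o a κ 0 k l₀ c hB]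

/-- The main link length has a density on `(h, ∞)` with `h ≥ 0`. Length `0` has to be discarded
because `0⁻¹ = 0` and `0 ^ (-α) = 0` give such a node the score `0`. -/
lemma ae_linkDist_pos (o : Subject) (a : Criterion) (k : Fin (K + 1)) :
    ∀ᵐ ω ∂μ, ∀ q, net.Associated o a k q ω →
      0 < net.linkDist k (o.txNode q) (o.rxNode q) ω := by
  rw [ae_all_iff]
  rintro ⟨l, n⟩
  have h : ∀ c, μ (net.mainLink o a k (l, n) c (Set.Iic 0)) = 0 := by
    intro c
    have h1 := net.tsum_measure_marginLink o a 1 k l c (B := Set.Iic 0) measurableSet_Iic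
    have h2 : Set.Iic 0 ∩ Set.Ioi (p.hdiff k l) = ∅ := by
      ext y
      simp only [Set.mem_inter_iff, Set.mem_Iic, Set.mem_Ioi, Set.mem_empty_iff_false, iff_false]
      rintro ⟨h3, h4⟩
      linarith [p.hdiff_nonneg k l]
    rw [h2, Measure.restrict_empty, lintegral_zero_measure, ENNReal.tsum_eq_zero] at h1
    simpa only [marginLink_one] using h1 n
  filter_upwards [measure_eq_zero_iff_ae_notMem.1 (h .los),
    measure_eq_zero_iff_ae_notMem.1 (h .nlos)] with ω h1 h2 hass
  by_contra hpos
  cases hc : net.linkChannel k (o.txNode (l, n)) (o.rxNode (l, n)) ω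
  · exact h1 ⟨hass, hc, not_lt.1 hpos⟩
  · exact h2 ⟨hass, hc, not_lt.1 hpos⟩

/-- Almost surely, the typical node is associated with at most one node. -/
theorem ae_associated_unique (o : Subject) (a : Criterion) (k : Fin (K + 1)) :
    ∀ᵐ ω ∂μ, ∀ q q', net.Associated o a k q ω → net.Associated o a k q' ω → q = q' := by
  -- `V κ` below counts the nodes that win with margin `κ` at positive distance, and `J` is the
  -- event that some node wins with margin `1`.
  let E : ℝ → (Fin (K + 1) × Channel) × ℕ → Set Ω := fun κ i =>
    net.marginLink o a κ k (i.1.1, i.2) i.1.2 (Set.Ioi 0)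
  have hE : ∀ κ i, MeasurableSet (E κ i) := fun κ i =>
    net.measurableSet_marginLink o a κ k _ _ measurableSet_Ioi
  let V : ℝ → Ω → ℝ≥0∞ := fun κ ω => ∑' i, (E κ i).indicator 1 ω
  have hV : ∀ κ, Measurable (V κ) := fun κ =>
    Measurable.tsum fun i => measurable_one.indicator (hE κ i)
  have hint : ∀ κ, ∫⁻ ω, V κ ω ∂μ = ∑ q : Fin (K + 1) × Channel,
      ∫⁻ y in Set.Ioi (p.hdiff k q.1), p.mainDens o a κ 0 k q.1 q.2 y := by
    intro κ
    rw [lintegral_tsum fun i => (measurable_one.indicator (hE κ i)).aemeasurable,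
      ENNReal.tsum_prod', tsum_fintype]
    refine Finset.sum_congr rfl fun q _ => ?_
    have h1 := net.tsum_measure_marginLink o a κ k q.1 q.2 (B := Set.Ioi 0) measurableSet_Ioi
    rw [Set.inter_eq_right.2 (Set.Ioi_subset_Ioi (p.hdiff_nonneg k q.1))] at h1
    rw [← h1]
    exact tsum_congr fun n => lintegral_indicator_one (hE κ (q, n))
  have hsub : ∀ κ, 1 ≤ κ → ∀ i, E κ i ⊆ E 1 i := by
    rintro κ hκ i ω ⟨⟨h1, h2⟩, h3⟩
    refine ⟨⟨h1, fun q' hq' hact => ?_⟩, h3⟩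
    rw [one_mul]
    exact (le_mul_of_one_le_left (net.score_nonneg _ _ _ _ _) hκ).trans (h2 q' hq' hact)
  -- Two nodes with positive scores cannot each exceed the other by a factor `κ > 1`.
  have huniq : ∀ κ, 1 < κ → ∀ i i' ω, ω ∈ E κ i → ω ∈ E κ i' → i = i' := by
    intro κ hκ i i' ω h h'
    by_cases hq : (i.1.1, i.2) = (i'.1.1, i'.2)
    · have hc : i.1.2 = i'.1.2 := by
        rw [← h.2.1, ← h'.2.1, hq]
      simp only [Prod.mk.injEq] at hq
      exact Prod.ext (Prod.ext hq.1 hc) hq.2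
    · have h1 := h.1.2 _ (Ne.symm hq) h'.1.1
      have h2 := h'.1.2 _ hq h.1.1
      have h3 := net.score_pos o a k (i.1.1, i.2) h.2.2
      have h4 := net.score_pos o a k (i'.1.1, i'.2) h'.2.2
      nlinarith
  let J : Set Ω := ⋃ i, E 1 i
  have hVJ : ∀ κ, 1 < κ → ∀ ω, V κ ω ≤ J.indicator 1 ω := by
    intro κ hκ ω
    by_cases h : ∃ i, ω ∈ E κ i
    · obtain ⟨i, hi⟩ := h
      have hJ : ω ∈ J := Set.mem_iUnion.2 ⟨i, hsub κ hκ.le i hi⟩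
      rw [Set.indicator_of_mem hJ]
      simp only [V]
      rw [tsum_eq_single i fun i' hne => Set.indicator_of_notMem
        (fun hi' => hne (huniq κ hκ i' i ω hi' hi)) _, Set.indicator_of_mem hi]
    · push Not at h
      simp only [V]
      rw [ENNReal.tsum_eq_zero.2 fun i => Set.indicator_of_notMem (h i) _]
      exact zero_le
  have hJV : ∀ ω, J.indicator 1 ω ≤ V 1 ω := by
    intro ω
    by_cases h : ω ∈ J
    · obtain ⟨i, hi⟩ := Set.mem_iUnion.1 h
      refine le_trans (le_of_eq ?_) (ENNReal.le_tsum i)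
      rw [Set.indicator_of_mem h, Set.indicator_of_mem hi]
    · rw [Set.indicator_of_notMem h]
      exact zero_le
  let κ : ℕ → ℝ := fun n => 1 + 1 / ((n : ℝ) + 1)
  have hκ1 : ∀ n, 1 < κ n := fun n => by
    have : (0 : ℝ) < 1 / ((n : ℝ) + 1) := by positivity
    simp only [κ]
    linarith
  have hκ2 : ∀ n, κ n ∈ Set.Icc (1 : ℝ) 2 := fun n => by
    refine ⟨(hκ1 n).le, ?_⟩
    have : 1 / ((n : ℝ) + 1) ≤ 1 := by
      rw [div_le_one (by positivity)]
      linarith [(Nat.cast_nonneg n : (0 : ℝ) ≤ n)]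
    simp only [κ]
    linarith
  have hκlim : Tendsto κ atTop (𝓝 1) := by
    have h := (tendsto_one_div_add_atTop_nhds_zero_nat (𝕜 := ℝ)).const_add 1
    rwa [add_zero] at h
  have hlim : Tendsto (fun n => ∫⁻ ω, V (κ n) ω ∂μ) atTop (𝓝 (∫⁻ ω, V 1 ω ∂μ)) := by
    simp_rw [hint]
    exact tendsto_finsetSum _ fun q _ => p.tendsto_lintegral_mainDens o a k q.1 q.2 hκ2 hκlim
  -- The mean of `V 1` is the limit of the means of `V κ`, each at most `μ J`. As `J.indicator 1 ≤ V
  -- 1` everywhere, the two agree almost surely and `V 1 ≤ 1`.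
  have hle : ∫⁻ ω, V 1 ω ∂μ ≤ ∫⁻ ω, J.indicator 1 ω ∂μ :=
    le_of_tendsto' hlim fun n => lintegral_mono (hVJ _ (hκ1 n))
  have hfin : ∫⁻ ω, J.indicator 1 ω ∂μ ≠ ∞ :=
    ((lintegral_mono fun ω => Set.indicator_le_self' (fun _ _ => zero_le) ω).trans_lt
      (by simp : ∫⁻ ω, (1 : Ω → ℝ≥0∞) ω ∂μ < ∞)).ne
  have hae := ae_eq_of_ae_le_of_lintegral_le (Eventually.of_forall hJV) hfin
    (hV 1).aemeasurable hle
  filter_upwards [hae, net.ae_linkDist_pos o a k] with ω hω hpos q q' hq hq'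
  have hV1 : V 1 ω ≤ 1 := hω ▸ Set.indicator_le_self' (fun _ _ => zero_le) ω
  by_contra hne
  let i : (Fin (K + 1) × Channel) × ℕ := ((q.1, net.linkChannel k (o.txNode q) (o.rxNode q) ω), q.2)
  let i' : (Fin (K + 1) × Channel) × ℕ :=
    ((q'.1, net.linkChannel k (o.txNode q') (o.rxNode q') ω), q'.2)
  have hi : ω ∈ E 1 i := ⟨(net.marginAssociated_one o a k q ω).2 hq, rfl, hpos q hq⟩
  have hi' : ω ∈ E 1 i' := ⟨(net.marginAssociated_one o a k q' ω).2 hq', rfl, hpos q' hq'⟩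
  have hii : i ≠ i' := by
    intro h
    simp only [i, i', Prod.mk.injEq] at h
    exact hne (Prod.ext h.1.1 h.2)
  have h2 : (1 : ℝ≥0∞) + 1 ≤ V 1 ω := by
    refine le_trans (le_of_eq ?_) (ENNReal.sum_le_tsum {i, i'})
    rw [Finset.sum_pair hii, Set.indicator_of_mem hi, Set.indicator_of_mem hi']
    rfl
  exact absurd (h2.trans hV1) (by norm_num)

end Network

/-! ### The main link density without normalisation -/

namespace Params

variable {K : ℕ} (p : Params K)

/-- The density of the length of a main link from layer `j` to layer `i`, not normalized. -/
noncomputable def linkDensity (o : Subject) (a : Criterion) (i j : Fin (K + 1)) (c : Channel)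
    (y : ℝ) : ℝ := p.assocDensity o a (o.selecting i j) (o.selected i j) c y

lemma linkDensity_nonneg (o : Subject) (a : Criterion) (i j : Fin (K + 1)) (c : Channel) (y : ℝ) :
    0 ≤ p.linkDensity o a i j c y := p.assocDensity_nonneg _ _ _ _ _ _

lemma hdiff_selecting (o : Subject) (i j : Fin (K + 1)) :
    p.hdiff (o.selecting i j) (o.selected i j) = p.hdiff i j := by
  cases o
  · rfl
  · exact abs_sub_comm _ _

lemma linkDensity_of_lt (o : Subject) (a : Criterion) (i j : Fin (K + 1)) (c : Channel) {y : ℝ}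
    (hy : y < p.hdiff i j) : p.linkDensity o a i j c y = 0 :=
  p.assocDensity_of_lt _ _ _ _ _ (by rwa [hdiff_selecting])

lemma lapTotal_zero (o : Subject) (a : Criterion) (i j : Fin (K + 1)) (c : Channel) (y : ℝ) :
    p.lapTotal o a i j c y 0 = 1 := by
  simp [lapTotal, lapInterference, expNeg]

/-- Besides identifying the density, this yields measurability in `y` of the analytic expression,
since `mainDens` is measurable. -/
lemma lapTotal_mul_linkDensity_ae_eq (o : Subject) (a : Criterion) {s : ℝ} (hs : 0 ≤ s)
    (i j : Fin (K + 1)) (c : Channel) :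
    (fun y => p.lapTotal o a i j c y s * p.linkDensity o a i j c y) =ᵐ[volume]
      (Set.Ioi (p.hdiff i j)).indicator fun y =>
        (p.mainDens o a 1 s (o.selecting i j) (o.selected i j) c y).toReal := by
  filter_upwards [Measure.ae_ne volume (p.hdiff i j)] with y hy
  rcases lt_or_gt_of_ne hy with h | h
  · rw [p.linkDensity_of_lt o a i j c h, mul_zero, Set.indicator_of_notMem]
    exact not_lt.2 h.le
  · rw [Set.indicator_of_mem (Set.mem_Ioi.2 h), p.mainDens_one o a hs i j c (by rwa [hdiff_selecting]),
      ENNReal.toReal_mul, ENNReal.toReal_ofReal (p.assocDensity_nonneg _ _ _ _ _ _),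
      ENNReal.toReal_ofReal (p.lapTotal_nonneg _ _ _ _ _ _ _), mul_comm]
    rfl

lemma aemeasurable_lapTotal_mul_linkDensity (o : Subject) (a : Criterion) {s : ℝ} (hs : 0 ≤ s)
    (i j : Fin (K + 1)) (c : Channel) :
    AEMeasurable fun y => p.lapTotal o a i j c y s * p.linkDensity o a i j c y :=
  ((p.measurable_mainDens o a 1 s _ _ c).ennreal_toReal.indicator
    measurableSet_Ioi).aemeasurable.congr (p.lapTotal_mul_linkDensity_ae_eq o a hs i j c).symm

lemma aemeasurable_linkDensity (o : Subject) (a : Criterion) (i j : Fin (K + 1)) (c : Channel) :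
    AEMeasurable (p.linkDensity o a i j c) := by
  simpa only [lapTotal_zero, one_mul] using
    p.aemeasurable_lapTotal_mul_linkDensity o a le_rfl i j c

lemma setLIntegral_mainDens_one (o : Subject) (a : Criterion) {s : ℝ} (hs : 0 ≤ s)
    (i j : Fin (K + 1)) (c : Channel) (B : Set ℝ) :
    ∫⁻ y in B ∩ Set.Ioi (p.hdiff (o.selecting i j) (o.selected i j)),
        p.mainDens o a 1 s (o.selecting i j) (o.selected i j) c y
      = ∫⁻ y in B, ENNReal.ofReal (p.lapTotal o a i j c y s * p.linkDensity o a i j c y) := by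
  rw [hdiff_selecting, Set.inter_comm, ← Measure.restrict_restrict measurableSet_Ioi,
    ← lintegral_indicator measurableSet_Ioi]
  refine lintegral_congr_ae ?_
  filter_upwards [ae_restrict_of_ae (p.lapTotal_mul_linkDensity_ae_eq o a hs i j c)] with y hy
  rw [hy]
  by_cases h : y ∈ Set.Ioi (p.hdiff i j)
  · rw [Set.indicator_of_mem h, Set.indicator_of_mem h, ENNReal.ofReal_toReal]
    rw [p.mainDens_one o a hs i j c (by rwa [hdiff_selecting])]
    exact ENNReal.mul_ne_top ENNReal.ofReal_ne_top ENNReal.ofReal_ne_top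
  · rw [Set.indicator_of_notMem h, Set.indicator_of_notMem h, ENNReal.ofReal_zero]

lemma assocProb_eq (o : Subject) (a : Criterion) (i j : Fin (K + 1)) (c : Channel) :
    p.assocProb o a i j c = ∫ y, p.linkDensity o a i j c y := by
  rw [assocProb, ← integral_indicator measurableSet_Ioi]
  refine integral_congr_ae ?_
  filter_upwards [Measure.ae_ne volume 0] with y hy
  by_cases h : y ∈ Set.Ioi 0
  · rw [Set.indicator_of_mem h]
    rfl
  · rw [Set.indicator_of_notMem h, p.linkDensity_of_lt]
    exact (lt_of_le_of_ne (not_lt.1 h) hy).trans_le (p.hdiff_nonneg i j)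

/-- If the association probability is `0`, then `linkDensity` vanishes almost everywhere and both
sides are `0`; otherwise the normalisation cancels. -/
lemma assocProb_mul_setIntegral {o : Subject} {a : Criterion} {i j : Fin (K + 1)} {c : Channel}
    (hint : Integrable (p.linkDensity o a i j c)) (g : ℝ → ℝ) (B : Set ℝ) :
    p.assocProb o a i j c * ∫ y in B, g y * p.mainPDF o a i j c y
      = ∫ y in B, g y * p.linkDensity o a i j c y := by
  by_cases h : p.assocProb o a i j c = 0
  · rw [h, zero_mul]
    rw [assocProb_eq, integral_eq_zero_iff_of_nonneg (p.linkDensity_nonneg o a i j c) hint] at h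
    refine (integral_eq_zero_of_ae ?_).symm
    filter_upwards [ae_restrict_of_ae h] with y hy
    rw [hy]
    simp
  · rw [← integral_const_mul]
    refine integral_congr_ae (Eventually.of_forall fun y => ?_)
    simp only [mainPDF, linkDensity]
    field_simp

lemma integrable_mul_mainPDF {o : Subject} {a : Criterion} {i j : Fin (K + 1)} {c : Channel}
    {g : ℝ → ℝ} (h : Integrable fun y => g y * p.linkDensity o a i j c y) :
    Integrable fun y => g y * p.mainPDF o a i j c y := by
  have := h.div_const (p.assocProb o a i j c)
  simp only [mul_div_assoc] at this
  exact this

end Params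

/-! ### Association probability, length distribution and Laplace transform -/

namespace Network

variable {K : ℕ} {p : Params K} {Ω : Type*} [MeasurableSpace Ω] {μ : Measure Ω}
  [IsProbabilityMeasure μ] (net : Network p μ)

lemma tsum_setLIntegral_mainLink (o : Subject) (a : Criterion) {s : ℝ} (hs : 0 ≤ s)
    (i j : Fin (K + 1)) (c : Channel) {B : Set ℝ} (hB : MeasurableSet B) :
    ∑' n : ℕ, ∫⁻ ω in net.mainLink o a (o.selecting i j) (o.selected i j, n) c B,
      nexp (ENNReal.ofReal s * net.interferencePlusNoise (o.selecting i j)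
        (o.txNode (o.selected i j, n)) (o.rxNode (o.selected i j, n)) ω) ∂μ
      = ∫⁻ y in B, ENNReal.ofReal (p.lapTotal o a i j c y s * p.linkDensity o a i j c y) := by
  have h := net.tsum_setLIntegral_nexp o a 1 s (o.selecting i j) (o.selected i j) c hB
  simp only [marginLink_one] at h
  rw [h, p.setLIntegral_mainDens_one o a hs i j c B]

lemma tsum_measure_mainLink (o : Subject) (a : Criterion) (i j : Fin (K + 1)) (c : Channel)
    {B : Set ℝ} (hB : MeasurableSet B) :
    ∑' n : ℕ, μ (net.mainLink o a (o.selecting i j) (o.selected i j, n) c B)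
      = ∫⁻ y in B, ENNReal.ofReal (p.linkDensity o a i j c y) := by
  have h := net.tsum_setLIntegral_mainLink o a le_rfl i j c hB
  simpa [p.lapTotal_zero] using h

/-- Events that determine the associated node are almost surely disjoint. -/
lemma measure_iUnion_associated (o : Subject) (a : Criterion) (k : Fin (K + 1)) {ι : Type*}
    [Countable ι] (node : ι → Fin (K + 1) × ℕ) {A : ι → Set Ω} (hA : ∀ i, MeasurableSet (A i))
    (hsub : ∀ i, ∀ ω ∈ A i, net.Associated o a k (node i) ω)
    (hdisj : ∀ i i', i ≠ i' → node i = node i' → Disjoint (A i) (A i')) :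
    μ (⋃ i, A i) = ∑' i, μ (A i) := by
  refine measure_iUnion₀ (fun i i' hne => ?_) fun i => (hA i).nullMeasurableSet
  refine measure_eq_zero_iff_ae_notMem.2 ?_
  filter_upwards [net.ae_associated_unique o a k] with ω hω hmem
  have h := hω _ _ (hsub i ω hmem.1) (hsub i' ω hmem.2)
  exact Set.disjoint_left.1 (hdisj i i' hne h) hmem.1 hmem.2

lemma measure_iUnion_mainLink_inter (o : Subject) (a : Criterion) (k l : Fin (K + 1)) (c : Channel)
    {B : Set ℝ} (hB : MeasurableSet B) {S : ℕ → Set Ω} (hS : ∀ n, MeasurableSet (S n)) :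
    μ (⋃ n, net.mainLink o a k (l, n) c B ∩ S n) = ∑' n, μ (net.mainLink o a k (l, n) c B ∩ S n) := by
  refine net.measure_iUnion_associated o a k (fun n => (l, n))
    (fun n => (net.measurableSet_mainLink o a k (l, n) c hB).inter (hS n)) (fun n ω h => h.1.1)
    fun n n' hne h => absurd (Prod.mk.inj h).2 hne

lemma measure_iUnion_mainLink (o : Subject) (a : Criterion) (i j : Fin (K + 1)) (c : Channel)
    {B : Set ℝ} (hB : MeasurableSet B) :
    μ (⋃ n, net.mainLink o a (o.selecting i j) (o.selected i j, n) c B)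
      = ∫⁻ y in B, ENNReal.ofReal (p.linkDensity o a i j c y) := by
  rw [← net.tsum_measure_mainLink o a i j c hB]
  have := net.measure_iUnion_mainLink_inter o a (o.selecting i j) (o.selected i j) c hB
    (S := fun _ => Set.univ) fun _ => MeasurableSet.univ
  simpa using this

/-- Its integral is the probability of an event of the network, hence finite; no analytic estimate
is involved. -/
lemma integrable_linkDensity (net : Network p μ) (o : Subject) (a : Criterion) (i j : Fin (K + 1)) (c : Channel) :
    Integrable (p.linkDensity o a i j c) := by
  refine ⟨(p.aemeasurable_linkDensity o a i j c).aestronglyMeasurable, ?_⟩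
  rw [hasFiniteIntegral_iff_ofReal (Eventually.of_forall (p.linkDensity_nonneg o a i j c)),
    ← setLIntegral_univ, ← net.measure_iUnion_mainLink o a i j c MeasurableSet.univ]
  exact measure_lt_top _ _

lemma measureReal_iUnion_mainLink (o : Subject) (a : Criterion) (i j : Fin (K + 1)) (c : Channel)
    {B : Set ℝ} (hB : MeasurableSet B) :
    μ.real (⋃ n, net.mainLink o a (o.selecting i j) (o.selected i j, n) c B)
      = ∫ y in B, p.linkDensity o a i j c y := by
  rw [measureReal_def, net.measure_iUnion_mainLink o a i j c hB,
    integral_eq_lintegral_of_nonneg_ae (Eventually.of_forall (p.linkDensity_nonneg o a i j c))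
    (net.integrable_linkDensity o a i j c).aestronglyMeasurable.restrict]

lemma integrable_lapTotal_mul_linkDensity (net : Network p μ) (o : Subject) (a : Criterion) {s : ℝ} (hs : 0 ≤ s)
    (i j : Fin (K + 1)) (c : Channel) :
    Integrable fun y => p.lapTotal o a i j c y s * p.linkDensity o a i j c y := by
  refine ⟨(p.aemeasurable_lapTotal_mul_linkDensity o a hs i j c).aestronglyMeasurable, ?_⟩
  rw [hasFiniteIntegral_iff_ofReal (Eventually.of_forall fun y =>
    mul_nonneg (p.lapTotal_nonneg _ _ _ _ _ _ _) (p.linkDensity_nonneg o a i j c y)),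
    ← setLIntegral_univ, ← net.tsum_setLIntegral_mainLink o a hs i j c MeasurableSet.univ]
  refine (ENNReal.tsum_le_tsum fun n => (lintegral_mono fun ω => nexp_le_one _)).trans_lt ?_
  simp only [lintegral_one, Measure.restrict_apply_univ]
  rw [net.tsum_measure_mainLink o a i j c MeasurableSet.univ,
    ← net.measure_iUnion_mainLink o a i j c MeasurableSet.univ]
  exact measure_lt_top _ _

lemma hasSum_setIntegral_mainLink (o : Subject) (a : Criterion) {s : ℝ} (hs : 0 ≤ s)
    (i j : Fin (K + 1)) (c : Channel) {B : Set ℝ} (hB : MeasurableSet B) :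
    HasSum (fun n : ℕ => ∫ ω in net.mainLink o a (o.selecting i j) (o.selected i j, n) c B,
        expNeg (ENNReal.ofReal s * net.interferencePlusNoise (o.selecting i j)
          (o.txNode (o.selected i j, n)) (o.rxNode (o.selected i j, n)) ω) ∂μ)
      (∫ y in B, p.lapTotal o a i j c y s * p.linkDensity o a i j c y) := by
  have h := net.tsum_setLIntegral_mainLink o a hs i j c hB
  have hint := net.integrable_lapTotal_mul_linkDensity o a hs i j c
  have hnn : ∀ y, 0 ≤ p.lapTotal o a i j c y s * p.linkDensity o a i j c y := fun y =>
    mul_nonneg (p.lapTotal_nonneg _ _ _ _ _ _ _) (p.linkDensity_nonneg o a i j c y)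
  have hfin : ∫⁻ y in B, ENNReal.ofReal (p.lapTotal o a i j c y s * p.linkDensity o a i j c y)
      ≠ ∞ := by
    rw [← ofReal_integral_eq_lintegral_ofReal hint.integrableOn (Eventually.of_forall hnn)]
    exact ENNReal.ofReal_ne_top
  have hterm : ∀ n : ℕ, ∫ ω in net.mainLink o a (o.selecting i j) (o.selected i j, n) c B,
        expNeg (ENNReal.ofReal s * net.interferencePlusNoise (o.selecting i j)
          (o.txNode (o.selected i j, n)) (o.rxNode (o.selected i j, n)) ω) ∂μ
      = (∫⁻ ω in net.mainLink o a (o.selecting i j) (o.selected i j, n) c B,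
        nexp (ENNReal.ofReal s * net.interferencePlusNoise (o.selecting i j)
          (o.txNode (o.selected i j, n)) (o.rxNode (o.selected i j, n)) ω) ∂μ).toReal := by
    intro n
    simp_rw [← toReal_nexp]
    exact integral_toReal
      ((net.measurable_interferencePlusNoise _ _ _).const_mul _).nexp.aemeasurable
      (Eventually.of_forall fun ω => (nexp_ne_top _).lt_top)
  simp_rw [hterm]
  rw [integral_eq_lintegral_of_nonneg_ae (Eventually.of_forall hnn)
    hint.aestronglyMeasurable.restrict, ← h, ENNReal.tsum_toReal_eq]
  · exact ENNReal.hasSum_toReal (h ▸ hfin)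
  · exact ENNReal.ne_top_of_tsum_ne_top (h ▸ hfin)

end Network

/-! ### Averaging over the gain of the main link -/

/-- Probability that the gain exceeds the level given by `r` and the interference plus noise `v`. -/
noncomputable def successTail (m : ℕ) (r : ℝ) (v : ℝ≥0∞) : ℝ≥0∞ :=
  if v = ∞ then 0 else ENNReal.ofReal (erlangTail m (r * v.toReal))

lemma successTail_top (m : ℕ) (r : ℝ) : successTail m r ∞ = 0 := if_pos rfl

lemma measurable_erlangTail (m : ℕ) : Measurable (erlangTail m) := by
  unfold erlangTail
  fun_prop

lemma measurable_successTail (m : ℕ) : Measurable fun q : ℝ × ℝ≥0∞ => successTail m q.1 q.2 :=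
  Measurable.ite (measurable_snd (measurableSet_singleton ∞)) measurable_const
    ((measurable_erlangTail m).comp (measurable_fst.mul measurable_snd.ennreal_toReal)).ennreal_ofReal

namespace Params

variable {K : ℕ} (p : Params K)

lemma lintegral_gain_success (i j : Fin (K + 1)) (c : Channel) {y : ℝ} (hy : 0 < y) (v : ℝ≥0∞) :
    ∫⁻ g, {g | ENNReal.ofReal (p.beta i j) * v < ENNReal.ofReal (p.power j * g * y ^ (-p.alpha c))}.indicator
      1 g ∂(gammaMeasure (p.m c) (p.m c)) = successTail (p.m c) (p.lapArg i j c y) v := by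
  have hm : (0 : ℝ) < p.m c := by exact_mod_cast p.m_pos c
  have hβ := p.beta_pos i j
  have hP := p.power_pos j
  have hyα : 0 < y ^ (-p.alpha c) := Real.rpow_pos_of_pos hy _
  rcases eq_or_ne v ∞ with rfl | hv
  · rw [successTail_top, ENNReal.mul_top (by simpa using hβ)]
    simp
  have hset : {g | ENNReal.ofReal (p.beta i j) * v < ENNReal.ofReal (p.power j * g * y ^ (-p.alpha c))}
      = Set.Ioi (p.beta i j * v.toReal / (p.power j * y ^ (-p.alpha c))) := by
    ext g
    rw [Set.mem_ofPred_eq, Set.mem_Ioi, div_lt_iff₀ (by positivity)]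
    nth_rewrite 1 [← ENNReal.ofReal_toReal hv]
    rw [← ENNReal.ofReal_mul hβ.le, ENNReal.ofReal_lt_ofReal_iff_of_nonneg (by positivity)]
    constructor <;> intro h <;> linarith
  rw [hset, lintegral_indicator_one measurableSet_Ioi,
    gammaMeasure_Ioi (p.m_pos c) hm (by positivity), successTail, if_neg hv]
  congr 2
  rw [lapArg]
  ring

lemma linkVar_congr (o : Subject) (a : Criterion) (κ s : ℝ) (k l₀ : Fin (K + 1)) (c : Channel)
    (n : ℕ) (ν : Role × Fin (K + 1) → Config) {w w' : Option Channel → ℝ} (h : w none = w' none) :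
    p.linkVar o a κ s k l₀ c n ν ((o.candRole, l₀), n) w
      = p.linkVar o a κ s k l₀ c n ν ((o.candRole, l₀), n) w' := by
  simp only [linkVar, if_true, h]

end Params

namespace Network

variable {K : ℕ} {p : Params K} {Ω : Type*} [MeasurableSpace Ω] {μ : Measure Ω}
  (net : Network p μ)

/-- Of the marks of the main link only the uniform variable matters for the exponent, never a gain.
-/
lemma totalVar_congr (o : Subject) (a : Criterion) (κ s : ℝ) (k l₀ : Fin (K + 1)) (c : Channel)
    (n : ℕ) (ν : Role × Fin (K + 1) → Config) {M M' : Node K × Node K → Option Channel → ℝ}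
    (h : ∀ L, L ≠ (o.txNode (l₀, n), o.rxNode (l₀, n)) → M L = M' L)
    (h' : M (o.txNode (l₀, n), o.rxNode (l₀, n)) none
      = M' (o.txNode (l₀, n), o.rxNode (l₀, n)) none) :
    totalVar p o a κ s k l₀ c n ν M = totalVar p o a κ s k l₀ c n ν M' := by
  refine tsum_congr fun i => ?_
  by_cases hi : i = ((o.candRole, l₀), n)
  · subst hi
    refine p.linkVar_congr o a κ s k l₀ c n ν ?_
    simpa only [linkOf_candRole] using h'
  · rw [h]
    rw [← linkOf_candRole o (l₀, n)]
    exact fun hL => hi (linkOf_injective o (l₀, n) (a₁ := i) (a₂ := ((o.candRole, l₀), n)) hL)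

/-- Multiplying out the quotient is legitimate for interference `0` or `∞` as well, because the
target is positive and finite. -/
lemma mem_succeeds_iff (o : Subject) (k : Fin (K + 1)) (q : Fin (K + 1) × ℕ) (ω : Ω) :
    ω ∈ net.succeeds o k q ↔
      ENNReal.ofReal (p.beta (layerOf k (o.rxNode q)) (layerOf k (o.txNode q)))
        * net.interferencePlusNoise k (o.txNode q) (o.rxNode q) ω
        < ENNReal.ofReal (net.rxPower k (o.txNode q) (o.rxNode q) ω) := by
  have hβ := p.beta_pos (layerOf k (o.rxNode q)) (layerOf k (o.txNode q))
  exact ENNReal.lt_div_iff_mul_lt (Or.inr ENNReal.ofReal_ne_top)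
    (Or.inr (by simpa using hβ))

-- Taking `nlog` in `ite_mul_nexp_eq` at `s = 1` recovers the event and the interference from the
-- exponent. Both are therefore unaffected by the gain of the main link.
open Classical in
lemma totalVar_add_noise (o : Subject) (a : Criterion) (k l : Fin (K + 1)) (c : Channel) (n : ℕ)
    {ω : Ω} (hn : net.Active o.candRole (l, n) ω) :
    totalVar p o a 1 1 k l c n (net.nodes ω) (net.marks ω) + ENNReal.ofReal p.noise
      = if ω ∈ net.mainLink o a k (l, n) c Set.univ
        then net.interferencePlusNoise k (o.txNode (l, n)) (o.rxNode (l, n)) ω else ∞ := by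
  have h := net.ite_mul_nexp_eq o a 1 (s := 1) k l c n Set.univ ω
  have hn' : (n : ℕ∞) < (net.nodes ω (o.candRole, l)).1 := hn
  rw [if_pos hn'] at h
  simp only [ENNReal.ofReal_one, one_mul, Set.indicator_univ, Pi.one_apply, ← nexp_add] at h
  replace h := congrArg nlog h
  rw [nlog_nexp] at h
  rw [add_comm, ← h]
  have hiff : (net.MarginAssociated o a 1 k (l, n) ω
        ∧ net.linkChannel k (o.txNode (l, n)) (o.rxNode (l, n)) ω = c
        ∧ net.linkDist k (o.txNode (l, n)) (o.rxNode (l, n)) ω ∈ Set.univ)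
      ↔ ω ∈ net.mainLink o a k (l, n) c Set.univ := by
    rw [← marginLink_one]
    rfl
  by_cases hM : ω ∈ net.mainLink o a k (l, n) c Set.univ
  · rw [if_pos hM, if_pos (hiff.2 hM), nlog_nexp]
  · rw [if_neg hM, if_neg (fun h' => hM (hiff.1 h')), ← nexp_top, nlog_nexp]

variable [IsProbabilityMeasure μ]

/-- The gain of the main link is independent of everything else that matters. -/
lemma lintegral_gain_resample (o : Subject) (a : Criterion) (κ s : ℝ) (k l : Fin (K + 1))
    (c c' : Channel) (n : ℕ) {F : (Role × Fin (K + 1) → Config) → ℝ≥0∞ → ℝ → ℝ≥0∞}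
    (hF : Measurable fun q : ((Role × Fin (K + 1) → Config) × ℝ≥0∞) × ℝ => F q.1.1 q.1.2 q.2) :
    ∫⁻ ω, F (net.nodes ω) (totalVar p o a κ s k l c n (net.nodes ω) (net.marks ω))
        (net.gain c' (o.txNode (l, n)) (o.rxNode (l, n)) ω) ∂μ
      = ∫⁻ ω, ∫⁻ g, F (net.nodes ω) (totalVar p o a κ s k l c n (net.nodes ω) (net.marks ω)) g
        ∂(gammaMeasure (p.m c') (p.m c')) ∂μ := by
  set L : Node K × Node K := (o.txNode (l, n), o.rxNode (l, n)) with hL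
  let T := fun ν M => totalVar p o a κ s k l c n ν M
  have hT : Measurable fun q : (Role × Fin (K + 1) → Config) ×
      (Node K × Node K → Option Channel → ℝ) => T q.1 q.2 := measurable_totalVar p o a κ s k l c n
  let Φ : (Role × Fin (K + 1) → Config) → (Node K × Node K → Option Channel → ℝ) → ℝ≥0∞ :=
    fun ν M => F ν (T ν M) (M L (some c'))
  let Ψ : (Role × Fin (K + 1) → Config) → (Node K × Node K → Option Channel → ℝ) → ℝ≥0∞ :=
    fun ν M => ∫⁻ g, F ν (T ν M) g ∂(gammaMeasure (p.m c') (p.m c'))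
  have hΦ : Measurable fun q : (Role × Fin (K + 1) → Config) ×
      (Node K × Node K → Option Channel → ℝ) => Φ q.1 q.2 :=
    hF.comp ((measurable_fst.prodMk hT).prodMk
      ((measurable_pi_apply (some c')).comp ((measurable_pi_apply L).comp measurable_snd)))
  have hΨ : Measurable fun q : (Role × Fin (K + 1) → Config) ×
      (Node K × Node K → Option Channel → ℝ) => Ψ q.1 q.2 := by
    refine Measurable.lintegral_prod_right' (f := fun r : ((Role × Fin (K + 1) → Config) ×
      (Node K × Node K → Option Channel → ℝ)) × ℝ => F r.1.1 (T r.1.1 r.1.2) r.2) ?_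
    exact hF.comp (((measurable_fst.comp measurable_fst).prodMk
      (hT.comp measurable_fst)).prodMk measurable_snd)
  have h1 := lintegral_comp_of_indepFun net.measurable_nodes net.measurable_marks
      net.indepFun_nodes_marks hΦ
  have h2 := lintegral_comp_of_indepFun net.measurable_nodes net.measurable_marks
      net.indepFun_nodes_marks hΨ
  refine h1.trans (Eq.trans (lintegral_congr fun ω => ?_) h2.symm)
  set ν := net.nodes ω
  let curry : (Option Channel × Node K × Node K → ℝ) → Node K × Node K → Option Channel → ℝ :=
    fun M L q => M (q, L)
  have hcurry : Measurable curry := measurable_pi_lambda _ fun L => measurable_pi_lambda _ fun q =>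
    measurable_pi_apply (q, L)
  have hmarks : ∀ i : Option Channel × Node K × Node K,
      Measurable fun ω => i.1.elim (net.unif i.2.1 i.2.2 ω) (fun c => net.gain c i.2.1 i.2.2 ω) :=
    fun i => net.measurable_mark i.2 i.1
  have h3 := lintegral_update_of_iIndepFun hmarks net.marks_indep (some c', L)
    (F := fun M => Φ ν (curry M)) ((hΦ.comp measurable_prodMk_left).comp hcurry)
  refine Eq.trans h3 (lintegral_congr fun ω₁ => ?_)
  have h4 : ∀ ω₂, Φ ν (curry (Function.update (fun j : Option Channel × Node K × Node K =>
      j.1.elim (net.unif j.2.1 j.2.2 ω₁) (fun c => net.gain c j.2.1 j.2.2 ω₁)) (some c', L)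
      (net.gain c' L.1 L.2 ω₂))) = F ν (T ν (net.marks ω₁)) (net.gain c' L.1 L.2 ω₂) := by
    intro ω₂
    -- Replacing the gain of the main link leaves the exponent unchanged, so the fresh copy can be
    -- integrated alone.
    have h5 : ∀ M : Option Channel × Node K × Node K → ℝ, ∀ g : ℝ,
        T ν (curry (Function.update M (some c', L) g)) = T ν (curry M) := by
      intro M g
      refine totalVar_congr o a κ s k l c n ν (fun L' hL' => ?_) ?_
      · funext q
        simp only [curry]
        rw [Function.update_of_ne]
        exact fun h => hL' (Prod.mk.inj h).2
      · simp only [curry]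
        rw [Function.update_of_ne]
        simp
    simp only [Φ, h5]
    simp only [curry, Function.update_self]
    rfl
  refine (lintegral_congr h4).trans ?_
  have h6 := lintegral_map (μ := μ) (f := fun g => F ν (T ν (net.marks ω₁)) g)
    (hF.comp (measurable_prodMk_left (x := (ν, T ν (net.marks ω₁)))))
    (net.gain_measurable c' L.1 L.2)
  rw [net.gain_law c' L.1 L.2] at h6
  exact h6.symm

end Network

namespace Params

variable {K : ℕ} (p : Params K)

lemma measurable_lapArg (i j : Fin (K + 1)) (c : Channel) : Measurable (p.lapArg i j c) := by
  unfold lapArg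
  fun_prop

end Params

namespace Network

variable {K : ℕ} {p : Params K} {Ω : Type*} [MeasurableSpace Ω] {μ : Measure Ω}
  [IsProbabilityMeasure μ] (net : Network p μ)

/-- The event is written through the positions, the exponent and the gain of the main link, and the
gain is integrated out. Positive lengths are needed to solve the SINR condition for the gain. -/
lemma measure_mainLink_inter_succeeds_of_subset (o : Subject) (a : Criterion) (k l : Fin (K + 1))
    (n : ℕ) (c : Channel) {B : Set ℝ} (hB : MeasurableSet B) (hpos : B ⊆ Set.Ioi 0) :
    μ (net.mainLink o a k (l, n) c B ∩ net.succeeds o k (l, n))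
      = ∫⁻ ω in net.mainLink o a k (l, n) c B, successTail (p.m c)
        (p.lapArg (layerOf k (o.rxNode (l, n))) (layerOf k (o.txNode (l, n))) c
          (net.linkDist k (o.txNode (l, n)) (o.rxNode (l, n)) ω))
        (net.interferencePlusNoise k (o.txNode (l, n)) (o.rxNode (l, n)) ω) ∂μ := by
  classical
  set i := layerOf k (o.rxNode (l, n)) with hi
  set j := layerOf k (o.txNode (l, n)) with hj
  let Y : (Role × Fin (K + 1) → Config) → ℝ := fun ν => p.candDist o k l ((ν (o.candRole, l)).2 n)
  have hpt : Measurable fun ν : Role × Fin (K + 1) → Config => ν (o.candRole, l) :=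
    measurable_pi_apply _
  have hY : Measurable Y := (p.measurable_candDist o k l).comp
    ((measurable_pi_apply n).comp (measurable_snd.comp hpt))
  have hYω : ∀ ω, Y (net.nodes ω) = net.linkDist k (o.txNode (l, n)) (o.rxNode (l, n)) ω :=
    fun ω => (net.linkDist_candidate o k (l, n) ω).symm
  let A : Set (Role × Fin (K + 1) → Config) := {ν | (n : ℕ∞) < (ν (o.candRole, l)).1} ∩ Y ⁻¹' B
  have hA : MeasurableSet A := (hpt (measurableSet_natCast_lt n)).inter (hY hB)
  -- Off the main link event the exponent `t` is `∞`, which makes the strict inequality fail; no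
  -- separate indicator of association is required.
  let F : (Role × Fin (K + 1) → Config) → ℝ≥0∞ → ℝ → ℝ≥0∞ := fun ν t g =>
    A.indicator 1 ν * {g | ENNReal.ofReal (p.beta i j) * (t + ENNReal.ofReal p.noise)
      < ENNReal.ofReal (p.power j * g * Y ν ^ (-p.alpha c))}.indicator 1 g
  have hF : Measurable fun q : ((Role × Fin (K + 1) → Config) × ℝ≥0∞) × ℝ =>
      F q.1.1 q.1.2 q.2 := by
    refine Measurable.mul ((measurable_one.indicator hA).comp
      (measurable_fst.comp measurable_fst)) ?_
    have hY' : Measurable fun q : ((Role × Fin (K + 1) → Config) × ℝ≥0∞) × ℝ => Y q.1.1 :=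
      hY.comp (measurable_fst.comp measurable_fst)
    refine Measurable.ite (p := fun q : ((Role × Fin (K + 1) → Config) × ℝ≥0∞) × ℝ =>
      ENNReal.ofReal (p.beta i j) * (q.1.2 + ENNReal.ofReal p.noise)
      < ENNReal.ofReal (p.power j * q.2 * Y q.1.1 ^ (-p.alpha c))) (measurableSet_lt ?_ ?_)
      measurable_const measurable_const
    · fun_prop
    · exact ((measurable_snd.const_mul _).mul (hY'.pow_const _)).ennreal_ofReal
  let T : Ω → ℝ≥0∞ := fun ω => totalVar p o a 1 1 k l c n (net.nodes ω) (net.marks ω)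
  have hML : ∀ ω, net.nodes ω ∈ A → (ω ∈ net.mainLink o a k (l, n) c Set.univ
      ↔ ω ∈ net.mainLink o a k (l, n) c B) := fun ω hω =>
    ⟨fun h => ⟨h.1, h.2.1, hYω ω ▸ hω.2⟩, fun h => ⟨h.1, h.2.1, trivial⟩⟩
  have hMA : ∀ ω, ω ∈ net.mainLink o a k (l, n) c B → net.nodes ω ∈ A := fun ω h =>
    ⟨h.1.1, by rw [Set.mem_preimage, hYω]; exact h.2.2⟩
  have hTA : ∀ ω, net.nodes ω ∈ A → T ω + ENNReal.ofReal p.noise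
      = if ω ∈ net.mainLink o a k (l, n) c B
        then net.interferencePlusNoise k (o.txNode (l, n)) (o.rxNode (l, n)) ω else ∞ := by
    intro ω hω
    rw [net.totalVar_add_noise o a k l c n hω.1]
    exact if_congr (hML ω hω) rfl rfl
  have hβ : ENNReal.ofReal (p.beta i j) ≠ 0 := by simpa using p.beta_pos i j
  have h1 : μ (net.mainLink o a k (l, n) c B ∩ net.succeeds o k (l, n))
      = ∫⁻ ω, F (net.nodes ω) (T ω) (net.gain c (o.txNode (l, n)) (o.rxNode (l, n)) ω) ∂μ := by
    rw [← lintegral_indicator_one ((net.measurableSet_mainLink o a k (l, n) c hB).inter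
      (net.measurableSet_succeeds o k (l, n)))]
    refine lintegral_congr fun ω => ?_
    simp only [F]
    by_cases hω : net.nodes ω ∈ A
    · rw [Set.indicator_of_mem hω, Pi.one_apply, one_mul, hTA ω hω, hYω]
      by_cases hM : ω ∈ net.mainLink o a k (l, n) c B
      · have hs := net.mem_succeeds_iff o k (l, n) ω
        rw [rxPower, hM.2.1] at hs
        rw [if_pos hM]
        by_cases hS : ω ∈ net.succeeds o k (l, n)
        · rw [Set.indicator_of_mem (Set.mem_inter hM hS), Set.indicator_of_mem]
          · rfl
          · exact hs.1 hS
        · rw [Set.indicator_of_notMem fun h => hS h.2, Set.indicator_of_notMem]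
          exact fun h => hS (hs.2 h)
      · rw [Set.indicator_of_notMem fun h => hM h.1, if_neg hM, Set.indicator_of_notMem]
        rw [Set.mem_ofPred_eq, ENNReal.mul_top hβ]
        exact not_top_lt
    · rw [Set.indicator_of_notMem hω, zero_mul, Set.indicator_of_notMem fun h => hω (hMA ω h.1)]
  rw [h1, net.lintegral_gain_resample o a 1 1 k l c c n hF,
    ← lintegral_indicator (net.measurableSet_mainLink o a k (l, n) c hB)]
  refine lintegral_congr fun ω => ?_
  simp only [F]
  by_cases hω : net.nodes ω ∈ A
  · have hy : 0 < Y (net.nodes ω) := hpos hω.2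
    simp only [Set.indicator_of_mem hω, Pi.one_apply, one_mul]
    rw [p.lintegral_gain_success i j c hy]
    by_cases hM : ω ∈ net.mainLink o a k (l, n) c B
    · rw [Set.indicator_of_mem hM, hYω]
      congr 1
      exact (hTA ω hω).trans (if_pos hM)
    · rw [Set.indicator_of_notMem hM, ← successTail_top (p.m c) (p.lapArg i j c (Y (net.nodes ω)))]
      congr 1
      exact (hTA ω hω).trans (if_neg hM)
  · rw [Set.indicator_of_notMem fun h => hω (hMA ω h)]
    simp only [Set.indicator_of_notMem hω, zero_mul, lintegral_zero]

lemma mainLink_ae_eq (o : Subject) (a : Criterion) (k : Fin (K + 1)) (q : Fin (K + 1) × ℕ)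
    (c : Channel) (B : Set ℝ) :
    net.mainLink o a k q c B =ᵐ[μ] net.mainLink o a k q c (B ∩ Set.Ioi 0) := by
  filter_upwards [net.ae_linkDist_pos o a k] with ω hω
  refine propext ⟨fun h => ⟨h.1, h.2.1, h.2.2, hω q h.1⟩, fun h => ⟨h.1, h.2.1, h.2.2.1⟩⟩

/-- The success probability on the event of a main link, by averaging over its gain. -/
theorem measure_mainLink_inter_succeeds (o : Subject) (a : Criterion) (k l : Fin (K + 1))
    (n : ℕ) (c : Channel) {B : Set ℝ} (hB : MeasurableSet B) :
    μ (net.mainLink o a k (l, n) c B ∩ net.succeeds o k (l, n))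
      = ∫⁻ ω in net.mainLink o a k (l, n) c B, successTail (p.m c)
        (p.lapArg (layerOf k (o.rxNode (l, n))) (layerOf k (o.txNode (l, n))) c
          (net.linkDist k (o.txNode (l, n)) (o.rxNode (l, n)) ω))
        (net.interferencePlusNoise k (o.txNode (l, n)) (o.rxNode (l, n)) ω) ∂μ := by
  have h := net.mainLink_ae_eq o a k (l, n) c B
  have h' : (net.mainLink o a k (l, n) c B ∩ net.succeeds o k (l, n) : Set Ω) =ᵐ[μ]
      (net.mainLink o a k (l, n) c (B ∩ Set.Ioi 0) ∩ net.succeeds o k (l, n) : Set Ω) :=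
    h.inter (ae_eq_refl _)
  rw [Measure.restrict_congr_set h, measure_congr h']
  exact net.measure_mainLink_inter_succeeds_of_subset o a k l n c (hB.inter measurableSet_Ioi)
    Set.inter_subset_right

end Network

/-! ### Erlang tails and derivatives of Laplace transforms -/

section LaplaceTransform

variable {Q : Measure ℝ≥0∞} [IsProbabilityMeasure Q]

lemma tendsto_lintegral_nexp {s : ℝ} (hs : 0 < s) {u : ℕ → ℝ} (hu : Tendsto u atTop (𝓝 s)) :
    Tendsto (fun n => ∫⁻ v, nexp (ENNReal.ofReal (u n) * v) ∂Q) atTop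
      (𝓝 (∫⁻ v, nexp (ENNReal.ofReal s * v) ∂Q)) := by
  refine tendsto_lintegral_of_dominated_convergence (fun _ => 1)
    (fun n => (measurable_id.const_mul _).nexp) (fun n => Eventually.of_forall fun v => nexp_le_one _)
    (by simp) (Eventually.of_forall fun v => ?_)
  refine (continuous_nexp.tendsto _).comp (ENNReal.Tendsto.mul_const ?_ (Or.inl ?_))
  · exact (ENNReal.continuous_ofReal.tendsto s).comp hu
  · simpa using hs

/-- A Laplace transform is determined on `(0, ∞)` by its values at rational points. -/
lemma lintegral_nexp_eq_of_forall_rat {L : ℝ → ℝ} (hL : AntitoneOn L (Set.Ioi 0))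
    (h : ∀ r : ℚ, 0 < (r : ℝ) → ∫⁻ v, nexp (ENNReal.ofReal r * v) ∂Q = ENNReal.ofReal (L r))
    {s : ℝ} (hs : 0 < s) : ∫⁻ v, nexp (ENNReal.ofReal s * v) ∂Q = ENNReal.ofReal (L s) := by
  refine le_antisymm ?_ ?_
  -- The transform is continuous and `L` only monotone: rational points above `s` give the upper
  -- bound, those below `s` the lower one.
  · obtain ⟨u, -, hu, hlim⟩ := Real.exists_seq_rat_strictAnti_tendsto s
    refine le_of_tendsto' (tendsto_lintegral_nexp hs hlim) fun n => ?_
    rw [h _ (hs.trans (hu n))]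
    exact ENNReal.ofReal_le_ofReal (hL hs (hs.trans (hu n)) (hu n).le)
  · obtain ⟨u, -, hu, hlim⟩ := Real.exists_seq_rat_strictMono_tendsto s
    refine ge_of_tendsto (tendsto_lintegral_nexp hs hlim) ?_
    filter_upwards [hlim.eventually_const_lt hs] with n hn
    rw [h _ hn]
    exact ENNReal.ofReal_le_ofReal (hL hn hs (hu n).le)

/-- The Erlang tail at a random level is a combination of derivatives of the Laplace transform of
the level. -/
lemma sum_iteratedDeriv_eq_lintegral_successTail {L : ℝ → ℝ} (hL0 : ∀ s, 0 ≤ L s)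
    (hL : ∀ s, 0 < s → ∫⁻ v, nexp (ENNReal.ofReal s * v) ∂Q = ENNReal.ofReal (L s)) (m : ℕ)
    {l : ℝ} (hl : 0 < l) :
    0 ≤ ∑ n ∈ Finset.range m, (-l) ^ n / (n.factorial : ℝ) * iteratedDeriv n L l ∧
    ENNReal.ofReal (∑ n ∈ Finset.range m, (-l) ^ n / (n.factorial : ℝ) * iteratedDeriv n L l)
      = ∫⁻ v, successTail m l v ∂Q := by
  -- An infinite level contributes `0` both to the Laplace transform at `s > 0` and to
  -- `successTail`. On the finite levels `L` is the moment generating function of `-v`, which can be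
  -- differentiated in the interior of its domain.
  set Q' := Q.restrict {∞}ᶜ with hQ'
  have hms : MeasurableSet ({∞}ᶜ : Set ℝ≥0∞) := (measurableSet_singleton ∞).compl
  let X : ℝ≥0∞ → ℝ := fun v => -v.toReal
  have hX : Measurable X := by
    simp only [X]
    fun_prop
  have hexp : ∀ s, 0 < s → Integrable (fun v => Real.exp (s * X v)) Q' := by
    intro s hs
    refine Integrable.of_bound (by fun_prop) 1 (Eventually.of_forall fun v => ?_)
    rw [Real.norm_of_nonneg (Real.exp_pos _).le, Real.exp_le_one_iff]
    have := ENNReal.toReal_nonneg (a := v)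
    simp only [X]
    nlinarith
  have hmgf : ∀ s, 0 < s → L s = mgf X Q' s := by
    intro s hs
    rw [mgf, ← ENNReal.toReal_ofReal (hL0 s), ← hL s hs,
      integral_eq_lintegral_of_nonneg_ae (Eventually.of_forall fun v => (Real.exp_pos _).le)
        (hexp s hs).aestronglyMeasurable, hQ', ← lintegral_indicator hms]
    congr 1
    refine lintegral_congr fun v => ?_
    by_cases hv : v = ∞
    · rw [Set.indicator_of_notMem (by simpa using hv), hv, ENNReal.mul_top (by simpa using hs),
        nexp_top]
    · rw [Set.indicator_of_mem (by simpa using hv),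
        nexp_of_ne_top (ENNReal.mul_ne_top ENNReal.ofReal_ne_top hv), ENNReal.toReal_mul,
        ENNReal.toReal_ofReal hs.le]
      simp only [X, mul_neg]
  have hint : l ∈ interior (integrableExpSet X Q') :=
    mem_interior.2 ⟨Set.Ioi 0, fun s hs => hexp s hs, isOpen_Ioi, hl⟩
  have hderiv : ∀ n, iteratedDeriv n L l = ∫ v, X v ^ n * Real.exp (l * X v) ∂Q' := by
    intro n
    have he : L =ᶠ[𝓝 l] mgf X Q' := by
      filter_upwards [Ioi_mem_nhds hl] with s hs using hmgf s hs
    rw [he.iteratedDeriv_eq, iteratedDeriv_mgf hint]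
  have hterm : ∀ n, Integrable (fun v => (-l) ^ n / (n.factorial : ℝ)
      * (X v ^ n * Real.exp (l * X v))) Q' := fun n =>
    (integrable_pow_mul_exp_of_mem_interior_integrableExpSet hint n).const_mul _
  have hsum : ∀ v, ∑ n ∈ Finset.range m, (-l) ^ n / (n.factorial : ℝ)
      * (X v ^ n * Real.exp (l * X v)) = erlangTail m (l * v.toReal) := by
    -- The signs cancel: `(-l) ^ n * (-v) ^ n = (l * v) ^ n`.
    intro v
    rw [erlangTail]
    refine Finset.sum_congr rfl fun n _ => ?_
    simp only [X]
    rw [mul_neg, mul_pow, neg_pow l, neg_pow v.toReal]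
    have : ((-1 : ℝ) ^ n) * (-1) ^ n = 1 := by rw [← mul_pow]; simp
    linear_combination (l ^ n * v.toReal ^ n / (n.factorial : ℝ) * Real.exp (-(l * v.toReal))) * this
  have heq : ∑ n ∈ Finset.range m, (-l) ^ n / (n.factorial : ℝ) * iteratedDeriv n L l
      = ∫ v, erlangTail m (l * v.toReal) ∂Q' := by
    simp_rw [hderiv, ← hsum, ← integral_const_mul]
    exact (integral_finsetSum _ fun n _ => hterm n).symm
  have hnn : ∀ v : ℝ≥0∞, 0 ≤ erlangTail m (l * v.toReal) := fun v =>
    erlangTail_nonneg m (mul_nonneg hl.le ENNReal.toReal_nonneg)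
  have hintE : Integrable (fun v : ℝ≥0∞ => erlangTail m (l * v.toReal)) Q' := by
    simp_rw [← hsum]
    exact integrable_finsetSum _ fun n _ => hterm n
  rw [heq]
  refine ⟨integral_nonneg hnn, ?_⟩
  rw [ofReal_integral_eq_lintegral_ofReal hintE (Eventually.of_forall hnn), hQ',
    ← lintegral_indicator hms]
  refine lintegral_congr fun v => ?_
  by_cases hv : v = ∞
  · rw [Set.indicator_of_notMem (by simpa using hv), hv, successTail_top]
  · rw [Set.indicator_of_mem (by simpa using hv), successTail, if_neg hv]

end LaplaceTransform

/-! ### The conditional law of the interference given the main link length -/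

namespace Params

variable {K : ℕ} (p : Params K)

lemma lapFactor_antitoneOn (l : Fin (K + 1)) (c : Channel) {u : ℝ} (hu : 0 ≤ u) :
    AntitoneOn (fun s => p.lapFactor s l c u) (Set.Ioi 0) := by
  intro s hs s' hs' h
  have hs : 0 < s := hs
  have hs' : 0 < s' := hs'
  have hP := p.power_pos l
  simp only [lapFactor]
  gcongr

/-- Permits the passage from rational to all `s > 0` for fixed `y`. -/
lemma lapTotal_antitoneOn (o : Subject) (a : Criterion) (i j : Fin (K + 1)) (c : Channel) (y : ℝ) :
    AntitoneOn (fun s => p.lapTotal o a i j c y s) (Set.Ioi 0) := by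
  intro s hs s' hs' h
  refine mul_le_mul ?_ (Finset.prod_le_prod (fun q _ => p.lapInterference_nonneg _ _ _ _ _ _ _ _ _)
    fun q _ => ?_) (Finset.prod_nonneg fun q _ => p.lapInterference_nonneg _ _ _ _ _ _ _ _ _)
    (Real.exp_pos _).le
  · rw [Real.exp_le_exp]
    have := p.noise_nonneg
    nlinarith
  · simp only [lapInterference, ← toReal_nexp]
    refine ENNReal.toReal_mono (nexp_ne_top _) (nexp_antitone (mul_le_mul_right ?_ _))
    refine setLIntegral_mono' measurableSet_Ioi fun x hx => ENNReal.ofReal_le_ofReal ?_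
    have hx1 : p.hdiff i q.1 < x := lt_of_le_of_lt (le_max_right _ _) hx
    have hx0 : 0 ≤ x := (p.hdiff_nonneg i q.1).trans hx1.le
    have h1 := p.lapFactor_antitoneOn q.1 q.2 hx0 hs hs' h
    simp only [lapFactor] at h1
    refine mul_le_mul_of_nonneg_left (by linarith) ?_
    exact mul_nonneg hx0 (p.rho_mem i q.1 q.2 hx1.le).1

end Params

namespace Network

variable {K : ℕ} {p : Params K} {Ω : Type*} [MeasurableSpace Ω] {μ : Measure Ω}
  (net : Network p μ)

/-- Length of the main link, and interference plus noise. -/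
noncomputable def linkPair (o : Subject) (i j : Fin (K + 1)) (n : ℕ) (ω : Ω) : ℝ × ℝ≥0∞ :=
  (net.linkDist (o.selecting i j) (o.txNode (o.selected i j, n)) (o.rxNode (o.selected i j, n)) ω,
    net.interferencePlusNoise (o.selecting i j) (o.txNode (o.selected i j, n))
      (o.rxNode (o.selected i j, n)) ω)

lemma measurable_linkPair (o : Subject) (i j : Fin (K + 1)) (n : ℕ) :
    Measurable (net.linkPair o i j n) :=
  (net.measurable_linkDist _ _ _).prodMk (net.measurable_interferencePlusNoise _ _ _)

variable [IsProbabilityMeasure μ]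

/-- The interference plus noise has a conditional distribution given the main link. -/
theorem exists_kernel (o : Subject) (a : Criterion) (i j : Fin (K + 1)) (c : Channel) :
    ∃ κ : Kernel ℝ ℝ≥0∞, IsMarkovKernel κ ∧ ∀ f : ℝ × ℝ≥0∞ → ℝ≥0∞, Measurable f →
      ∀ B : Set ℝ, MeasurableSet B →
      ∑' n, ∫⁻ ω in net.mainLink o a (o.selecting i j) (o.selected i j, n) c B,
          f (net.linkPair o i j n ω) ∂μ
        = ∫⁻ y in B, ENNReal.ofReal (p.linkDensity o a i j c y) * ∫⁻ v, f (y, v) ∂(κ y) := by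
  -- `ν` is the joint law of length and interference on the main link event, summed over the
  -- candidates; its conditional kernel is the one sought.
  let ν : Measure (ℝ × ℝ≥0∞) := Measure.sum fun n =>
    (μ.restrict (net.mainLink o a (o.selecting i j) (o.selected i j, n) c Set.univ)).map
      (net.linkPair o i j n)
  have hν : ∀ f : ℝ × ℝ≥0∞ → ℝ≥0∞, Measurable f → ∀ B : Set ℝ, MeasurableSet B →
      ∫⁻ q in B ×ˢ Set.univ, f q ∂ν
      = ∑' n, ∫⁻ ω in net.mainLink o a (o.selecting i j) (o.selected i j, n) c B,
          f (net.linkPair o i j n ω) ∂μ := by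
    intro f hf B hB
    have hBu : MeasurableSet (B ×ˢ (Set.univ : Set ℝ≥0∞)) := hB.prod MeasurableSet.univ
    simp only [ν]
    rw [Measure.restrict_sum _ hBu, lintegral_sum_measure]
    refine tsum_congr fun n => ?_
    rw [setLIntegral_map hBu hf (net.measurable_linkPair o i j n),
      Measure.restrict_restrict (net.measurable_linkPair o i j n hBu)]
    congr 2
    ext ω
    constructor
    · rintro ⟨h1, h2⟩
      exact ⟨h2.1, h2.2.1, h1.1⟩
    · rintro h
      exact ⟨⟨h.2.2, trivial⟩, h.1, h.2.1, trivial⟩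
  have hfst : ν.fst = volume.withDensity fun y => ENNReal.ofReal (p.linkDensity o a i j c y) := by
    ext B hB
    rw [Measure.fst_apply hB, withDensity_apply _ hB, ← net.tsum_measure_mainLink o a i j c hB,
      ← Set.prod_univ, ← setLIntegral_one, hν _ measurable_const B hB]
    simp
  -- Although `ν` is an infinite sum, uniqueness of the associated node bounds its mass by a
  -- probability.
  have hfin : IsFiniteMeasure ν := by
    refine ⟨?_⟩
    rw [← Measure.fst_univ, hfst, withDensity_apply _ MeasurableSet.univ,
      ← net.measure_iUnion_mainLink o a i j c MeasurableSet.univ]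
    exact measure_lt_top _ _
  refine ⟨ν.condKernel, inferInstance, fun f hf B hB => ?_⟩
  rw [← hν f hf B hB, ← Measure.setLIntegral_condKernel_univ_right hf hB, hfst,
    restrict_withDensity hB, lintegral_withDensity_eq_lintegral_mul₀
      (p.aemeasurable_linkDensity o a i j c).ennreal_ofReal.restrict]
  · rfl
  · exact (hf.lintegral_kernel_prod_right' (κ := ν.condKernel)).aemeasurable

/-- For each rational `s` the two sides, weighted by the density, have equal integrals over every
`B`, hence agree almost everywhere. Countably many null sets are discarded, and monotonicity yields
all real `s`. A null set common to all `s` is essential, since the derivatives are taken at a point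
that depends on `y`. -/
lemma ae_lintegral_nexp_kernel {o : Subject} {a : Criterion} {i j : Fin (K + 1)} {c : Channel}
    {κ : Kernel ℝ ℝ≥0∞} [IsMarkovKernel κ]
    (hκ : ∀ f : ℝ × ℝ≥0∞ → ℝ≥0∞, Measurable f →
      ∀ B : Set ℝ, MeasurableSet B →
      ∑' n, ∫⁻ ω in net.mainLink o a (o.selecting i j) (o.selected i j, n) c B,
          f (net.linkPair o i j n ω) ∂μ
        = ∫⁻ y in B, ENNReal.ofReal (p.linkDensity o a i j c y) * ∫⁻ v, f (y, v) ∂(κ y)) :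
    ∀ᵐ y, p.linkDensity o a i j c y ≠ 0 → ∀ s, 0 < s →
      ∫⁻ v, nexp (ENNReal.ofReal s * v) ∂(κ y) = ENNReal.ofReal (p.lapTotal o a i j c y s) := by
  have h : ∀ r : ℚ, 0 < (r : ℝ) → ∀ᵐ y, p.linkDensity o a i j c y ≠ 0 →
      ∫⁻ v, nexp (ENNReal.ofReal r * v) ∂(κ y) = ENNReal.ofReal (p.lapTotal o a i j c y r) := by
    intro r hr
    have hm : Measurable fun q : ℝ × ℝ≥0∞ => nexp (ENNReal.ofReal r * q.2) :=
      (measurable_snd.const_mul _).nexp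
    have hae : (fun y => ENNReal.ofReal (p.linkDensity o a i j c y)
        * ∫⁻ v, nexp (ENNReal.ofReal r * v) ∂(κ y)) =ᵐ[volume]
        fun y => ENNReal.ofReal (p.lapTotal o a i j c y r * p.linkDensity o a i j c y) := by
      refine ae_eq_of_forall_setLIntegral_eq_of_sigmaFinite₀ ?_ ?_ fun B hB _ => ?_
      · exact (p.aemeasurable_linkDensity o a i j c).ennreal_ofReal.mul
          (hm.lintegral_kernel_prod_right' (κ := κ)).aemeasurable
      · exact (p.aemeasurable_lapTotal_mul_linkDensity o a hr.le i j c).ennreal_ofReal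
      · rw [← net.tsum_setLIntegral_mainLink o a hr.le i j c hB]
        exact (hκ _ hm B hB).symm
    filter_upwards [hae] with y hy hd
    rw [mul_comm, ENNReal.ofReal_mul (p.lapTotal_nonneg _ _ _ _ _ _ _)] at hy
    refine (ENNReal.mul_left_inj ?_ ENNReal.ofReal_ne_top).1 hy
    simpa using lt_of_le_of_ne (p.linkDensity_nonneg o a i j c y) (Ne.symm hd)
  have h' : ∀ᵐ y, ∀ r : ℚ, 0 < (r : ℝ) → p.linkDensity o a i j c y ≠ 0 →
      ∫⁻ v, nexp (ENNReal.ofReal r * v) ∂(κ y) = ENNReal.ofReal (p.lapTotal o a i j c y r) := by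
    rw [ae_all_iff]
    intro r
    by_cases hr : 0 < (r : ℝ)
    · filter_upwards [h r hr] with y hy _ using hy
    · exact Eventually.of_forall fun y h => absurd h hr
  filter_upwards [h'] with y hy hd s hs
  exact lintegral_nexp_eq_of_forall_rat (p.lapTotal_antitoneOn o a i j c y)
    (fun r hr => hy r hr hd) hs

/-- Applies the derivative formula to the law `κ y` at `l = lapArg y`. Where the density vanishes
nothing is known about `κ y`, and both sides are `0`. -/
lemma ae_condSTP_kernel {o : Subject} {a : Criterion} {i j : Fin (K + 1)} {c : Channel}
    {κ : Kernel ℝ ℝ≥0∞} [IsMarkovKernel κ]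
    (hκ : ∀ f : ℝ × ℝ≥0∞ → ℝ≥0∞, Measurable f →
      ∀ B : Set ℝ, MeasurableSet B →
      ∑' n, ∫⁻ ω in net.mainLink o a (o.selecting i j) (o.selected i j, n) c B,
          f (net.linkPair o i j n ω) ∂μ
        = ∫⁻ y in B, ENNReal.ofReal (p.linkDensity o a i j c y) * ∫⁻ v, f (y, v) ∂(κ y)) :
    ∀ᵐ y, 0 ≤ p.condSTP o a i j c y * p.linkDensity o a i j c y ∧
      ENNReal.ofReal (p.condSTP o a i j c y * p.linkDensity o a i j c y)
      = ENNReal.ofReal (p.linkDensity o a i j c y)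
        * ∫⁻ v, successTail (p.m c) (p.lapArg i j c y) v ∂(κ y) := by
  filter_upwards [net.ae_lintegral_nexp_kernel hκ, Measure.ae_ne volume 0] with y hy hy0
  by_cases hd : p.linkDensity o a i j c y = 0
  · simp [hd]
  have hpos : 0 < y := by
    refine lt_of_le_of_ne ((p.hdiff_nonneg i j).trans ?_) (Ne.symm hy0)
    exact not_lt.1 fun h => hd (p.linkDensity_of_lt o a i j c h)
  have hl : 0 < p.lapArg i j c y := by
    have h1 := p.beta_pos i j
    have h2 := p.power_pos j
    have h3 : (0 : ℝ) < p.m c := by exact_mod_cast p.m_pos c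
    unfold Params.lapArg
    positivity
  have h := sum_iteratedDeriv_eq_lintegral_successTail (Q := κ y)
    (fun s => p.lapTotal_nonneg o a i j c y s) (hy hd) (p.m c) hl
  refine ⟨mul_nonneg h.1 (p.linkDensity_nonneg _ _ _ _ _ _), ?_⟩
  rw [ENNReal.ofReal_mul (show 0 ≤ p.condSTP o a i j c y from h.1), mul_comm, ← h.2]
  rfl

/-- The conditional success probability is nonnegative where it matters, measurable, and gives the
success probability on the event of a main link. -/
theorem condSTP_spec (o : Subject) (a : Criterion) (i j : Fin (K + 1)) (c : Channel) :
    (∀ᵐ y, 0 ≤ p.condSTP o a i j c y * p.linkDensity o a i j c y) ∧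
    AEMeasurable (fun y => p.condSTP o a i j c y * p.linkDensity o a i j c y) ∧
    ∀ B : Set ℝ, MeasurableSet B →
      ∑' n, μ (net.mainLink o a (o.selecting i j) (o.selected i j, n) c B
        ∩ net.succeeds o (o.selecting i j) (o.selected i j, n))
      = ∫⁻ y in B, ENNReal.ofReal (p.condSTP o a i j c y * p.linkDensity o a i j c y) := by
  obtain ⟨κ, hM, hκ⟩ := net.exists_kernel o a i j c
  have hae := net.ae_condSTP_kernel hκ
  have hm : Measurable fun q : ℝ × ℝ≥0∞ => successTail (p.m c) (p.lapArg i j c q.1) q.2 :=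
    (measurable_successTail (p.m c)).comp
      (((p.measurable_lapArg i j c).comp measurable_fst).prodMk measurable_snd)
  refine ⟨hae.mono fun y h => h.1, ?_, fun B hB => ?_⟩
  · refine AEMeasurable.congr (f := fun y => (ENNReal.ofReal (p.linkDensity o a i j c y)
        * ∫⁻ v, successTail (p.m c) (p.lapArg i j c y) v ∂(κ y)).toReal) ?_ ?_
    · exact ((p.aemeasurable_linkDensity o a i j c).ennreal_ofReal.mul
        (hm.lintegral_kernel_prod_right' (κ := κ)).aemeasurable).ennreal_toReal
    · filter_upwards [hae] with y hy
      rw [← hy.2, ENNReal.toReal_ofReal hy.1]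
  · rw [lintegral_congr_ae (ae_restrict_of_ae (hae.mono fun y h => h.2))]
    refine Eq.trans (tsum_congr fun n => ?_) (hκ _ hm B hB)
    rw [net.measure_mainLink_inter_succeeds o a _ _ n c hB]
    cases o <;> rfl

end Network

/-! ### Summation over the main links: STP and ASE -/

namespace Network

variable {K : ℕ} {p : Params K} {Ω : Type*} [MeasurableSpace Ω] {μ : Measure Ω}
  (net : Network p μ)

lemma measurableSet_succeeds_layer (o : Subject) (a : Criterion) (k l : Fin (K + 1)) :
    MeasurableSet {ω | ∃ n : ℕ, net.Associated o a k (l, n) ω ∧ ω ∈ net.succeeds o k (l, n)} := by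
  have h : {ω | ∃ n : ℕ, net.Associated o a k (l, n) ω ∧ ω ∈ net.succeeds o k (l, n)}
      = ⋃ n : ℕ, {ω | net.MarginAssociated o a 1 k (l, n) ω} ∩ net.succeeds o k (l, n) := by
    ext ω
    simp [net.marginAssociated_one]
  rw [h]
  exact MeasurableSet.iUnion fun n => (net.measurableSet_marginAssociated o a 1 k (l, n)).inter
    (net.measurableSet_succeeds o k (l, n))

variable [IsProbabilityMeasure μ]

lemma integrable_condSTP_mul_linkDensity (net : Network p μ) (o : Subject) (a : Criterion)
    (i j : Fin (K + 1)) (c : Channel) :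
    Integrable fun y => p.condSTP o a i j c y * p.linkDensity o a i j c y := by
  obtain ⟨h0, hm, h⟩ := net.condSTP_spec o a i j c
  refine ⟨hm.aestronglyMeasurable, ?_⟩
  rw [hasFiniteIntegral_iff_ofReal h0, ← setLIntegral_univ, ← h _ MeasurableSet.univ]
  refine (ENNReal.tsum_le_tsum fun n => measure_mono Set.inter_subset_left).trans_lt ?_
  rw [net.tsum_measure_mainLink o a i j c MeasurableSet.univ,
    ← net.measure_iUnion_mainLink o a i j c MeasurableSet.univ]
  exact measure_lt_top _ _

lemma toReal_tsum_measure_succeeds (o : Subject) (a : Criterion) (i j : Fin (K + 1)) (c : Channel)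
    {B : Set ℝ} (hB : MeasurableSet B) :
    (∑' n, μ (net.mainLink o a (o.selecting i j) (o.selected i j, n) c B
        ∩ net.succeeds o (o.selecting i j) (o.selected i j, n))).toReal
      = ∫ y in B, p.condSTP o a i j c y * p.linkDensity o a i j c y := by
  obtain ⟨h0, hm, h⟩ := net.condSTP_spec o a i j c
  rw [h B hB, integral_eq_lintegral_of_nonneg_ae (ae_restrict_of_ae h0)
    hm.restrict.aestronglyMeasurable]

lemma tsum_measure_succeeds_ne_top (o : Subject) (a : Criterion) (k l : Fin (K + 1)) (c : Channel)
    {B : Set ℝ} (hB : MeasurableSet B) :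
    ∑' n, μ (net.mainLink o a k (l, n) c B ∩ net.succeeds o k (l, n)) ≠ ∞ := by
  rw [← net.measure_iUnion_mainLink_inter o a k l c hB
    (S := fun n => net.succeeds o k (l, n)) fun n => net.measurableSet_succeeds o k (l, n)]
  exact measure_ne_top _ _

/-- The density vanishes below the altitude difference, so the integral over `(h, ∞)` is the
integral over the line. -/
lemma fP_eq (o : Subject) (a : Criterion) (i j : Fin (K + 1)) (c : Channel) :
    p.fP o a i j c = (∑' n, μ (net.mainLink o a (o.selecting i j) (o.selected i j, n) c Set.univ
        ∩ net.succeeds o (o.selecting i j) (o.selected i j, n))).toReal := by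
  rw [net.toReal_tsum_measure_succeeds o a i j c MeasurableSet.univ, setIntegral_univ, Params.fP,
    p.assocProb_mul_setIntegral (net.integrable_linkDensity o a i j c),
    setIntegral_congr_set (Ioi_ae_eq_Ici (μ := volume))]
  refine setIntegral_eq_integral_of_forall_compl_eq_zero fun y hy => ?_
  rw [p.linkDensity_of_lt o a i j c (not_le.1 hy), mul_zero]

/-- Different nodes are separated by almost sure uniqueness and, at the same node, environments
exclude each other. The free index `idx` covers both the sum over all layers and the sum within one
layer. -/
lemma measure_iUnion_mainLink_succeeds (o : Subject) (a : Criterion) (k : Fin (K + 1))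
    {ι : Type*} [Countable ι] {idx : ι → (Fin (K + 1) × Channel) × ℕ}
    (hidx : Function.Injective idx) :
    μ (⋃ i, net.mainLink o a k ((idx i).1.1, (idx i).2) (idx i).1.2 Set.univ
        ∩ net.succeeds o k ((idx i).1.1, (idx i).2))
      = ∑' i, μ (net.mainLink o a k ((idx i).1.1, (idx i).2) (idx i).1.2 Set.univ
        ∩ net.succeeds o k ((idx i).1.1, (idx i).2)) := by
  refine net.measure_iUnion_associated o a k (fun i => ((idx i).1.1, (idx i).2))
    (fun i => (net.measurableSet_mainLink o a k _ _ MeasurableSet.univ).inter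
      (net.measurableSet_succeeds o k _)) (fun i ω h => h.1.1) fun i i' hne hnode => ?_
  refine Set.disjoint_left.2 fun ω h h' => hne (hidx ?_)
  have hc := h.1.2.1.symm.trans ((congrArg (fun q => net.linkChannel k (o.txNode q) (o.rxNode q) ω)
    hnode).trans h'.1.2.1)
  simp only [Prod.mk.injEq] at hnode
  exact Prod.ext (Prod.ext hnode.1 hc) hnode.2

/-- The success probability, split according to the main link. -/
lemma stp_eq_sum (o : Subject) (a : Criterion) (k : Fin (K + 1)) :
    net.stp o a k = ∑ l, ∑ c, (∑' n, μ (net.mainLink o a k (l, n) c Set.univ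
      ∩ net.succeeds o k (l, n))).toReal := by
  have hset : {ω | ∃ q, net.Associated o a k q ω ∧ ω ∈ net.succeeds o k q}
      = ⋃ i : (Fin (K + 1) × Channel) × ℕ, net.mainLink o a k (i.1.1, i.2) i.1.2 Set.univ
        ∩ net.succeeds o k (i.1.1, i.2) := by
    ext ω
    simp only [Set.mem_ofPred_eq, Set.mem_iUnion]
    constructor
    · rintro ⟨q, h1, h2⟩
      exact ⟨((q.1, net.linkChannel k (o.txNode q) (o.rxNode q) ω), q.2), ⟨h1, rfl, trivial⟩, h2⟩
    · rintro ⟨i, h1, h2⟩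
      exact ⟨_, h1.1, h2⟩
  rw [stp, measureReal_def, hset, net.measure_iUnion_mainLink_succeeds o a k
    (idx := fun i => i) Function.injective_id, ENNReal.tsum_prod', tsum_fintype,
    ENNReal.toReal_sum fun q _ =>
      net.tsum_measure_succeeds_ne_top o a k q.1 q.2 MeasurableSet.univ, Fintype.sum_prod_type]

/-- The event that the main link with a node of layer `l` succeeds. -/
lemma measureReal_succeeds_layer (o : Subject) (a : Criterion) (k l : Fin (K + 1)) :
    μ.real {ω | ∃ n : ℕ, net.Associated o a k (l, n) ω ∧ ω ∈ net.succeeds o k (l, n)}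
      = ∑ c, (∑' n, μ (net.mainLink o a k (l, n) c Set.univ
      ∩ net.succeeds o k (l, n))).toReal := by
  have hset : {ω | ∃ n : ℕ, net.Associated o a k (l, n) ω ∧ ω ∈ net.succeeds o k (l, n)}
      = ⋃ i : Channel × ℕ, net.mainLink o a k (l, i.2) i.1 Set.univ
        ∩ net.succeeds o k (l, i.2) := by
    ext ω
    simp only [Set.mem_ofPred_eq, Set.mem_iUnion]
    constructor
    · rintro ⟨n, h1, h2⟩
      exact ⟨(net.linkChannel k (o.txNode (l, n)) (o.rxNode (l, n)) ω, n), ⟨h1, rfl, trivial⟩, h2⟩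
    · rintro ⟨i, h1, h2⟩
      exact ⟨_, h1.1, h2⟩
  rw [measureReal_def, hset, net.measure_iUnion_mainLink_succeeds o a k
    (idx := fun i : Channel × ℕ => ((l, i.1), i.2)) fun i i' h => by simp_all [Prod.ext_iff],
    ENNReal.tsum_prod', tsum_fintype, ENNReal.toReal_sum fun c _ =>
      net.tsum_measure_succeeds_ne_top o a k l c MeasurableSet.univ]

lemma integral_rate (o : Subject) (a : Criterion) (k : Fin (K + 1)) :
    ∫ ω, net.rate o a k ω ∂μ = ∑ l, (∑ c, (∑' n, μ (net.mainLink o a k (l, n) c Set.univ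
      ∩ net.succeeds o k (l, n))).toReal)
      * p.dataRate (layerOf k (o.rxNode (l, 0))) (layerOf k (o.txNode (l, 0))) := by
  simp only [rate]
  rw [integral_finsetSum _ fun l _ => (integrable_const _).indicator
    (net.measurableSet_succeeds_layer o a k l)]
  refine Finset.sum_congr rfl fun l _ => ?_
  rw [integral_indicator_const _ (net.measurableSet_succeeds_layer o a k l),
    net.measureReal_succeeds_layer, smul_eq_mul]
  rfl

end Network

end MAN

/-- The first conjunct says that `assocProb`, `mainPDF`, `lapTotal` and `condSTP` are the
association probability, the density of the main link distance, the conditional Laplace transform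
of interference plus noise, and the conditional success probability given the main link; the
second and third ones are the formulas for the STP and the ASE of layer `k`. -/
theorem lemma3 {K : ℕ} (p : MAN.Params K) {Ω : Type*} [MeasurableSpace Ω] (μ : Measure Ω)
    [IsProbabilityMeasure μ] (net : MAN.Network p μ) (o : MAN.Subject) (a : MAN.Criterion) :
    (∀ (i j : Fin (K + 1)) (c : MAN.Channel),
      -- association probability and distribution of the main link distance
      μ.real (⋃ n : ℕ, net.mainLink o a (o.selecting i j) (o.selected i j, n) c Set.univ)
          = p.assocProb o a i j c ∧
      Integrable (p.mainPDF o a i j c) ∧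
      (∀ B : Set ℝ, MeasurableSet B →
        μ.real (⋃ n : ℕ, net.mainLink o a (o.selecting i j) (o.selected i j, n) c B)
          = p.assocProb o a i j c * ∫ y in B, p.mainPDF o a i j c y) ∧
      -- Laplace transform of interference plus noise given the main link
      (∀ s : ℝ, 0 < s →
        Integrable (fun y => p.lapTotal o a i j c y s * p.mainPDF o a i j c y) ∧
        ∀ B : Set ℝ, MeasurableSet B →
          HasSum (fun n : ℕ =>
            ∫ ω in net.mainLink o a (o.selecting i j) (o.selected i j, n) c B,
              MAN.expNeg (ENNReal.ofReal s *
                net.interferencePlusNoise (o.selecting i j) (o.txNode (o.selected i j, n))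
                  (o.rxNode (o.selected i j, n)) ω) ∂μ)
            (p.assocProb o a i j c *
              ∫ y in B, p.lapTotal o a i j c y s * p.mainPDF o a i j c y)) ∧
      -- success probability given the main link
      Integrable (fun y => p.condSTP o a i j c y * p.mainPDF o a i j c y) ∧
      (∀ B : Set ℝ, MeasurableSet B →
        μ.real (⋃ n : ℕ, net.mainLink o a (o.selecting i j) (o.selected i j, n) c B ∩
            net.succeeds o (o.selecting i j) (o.selected i j, n))
          = p.assocProb o a i j c *
            ∫ y in B, p.condSTP o a i j c y * p.mainPDF o a i j c y)) ∧
    -- successful transmission probability of each layer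
    (∀ k : Fin (K + 1), net.stp o a k =
      match o with
      | .receiver => ∑ j : Fin (K + 1), ∑ c : MAN.Channel, p.fP .receiver a k j c
      | .transmitter => ∑ i : Fin (K + 1), ∑ c : MAN.Channel, p.fP .transmitter a i k c) ∧
    -- area spectral efficiency of each layer
    (∀ k : Fin (K + 1), net.ase o a k =
      match o with
      | .receiver => ∑ j : Fin (K + 1), ∑ c : MAN.Channel,
          (p.totalDens k - p.candDens .receiver k) * p.dataRate k j * p.fP .receiver a k j c
      | .transmitter => ∑ i : Fin (K + 1), ∑ c : MAN.Channel,
          (p.totalDens k - p.candDens .transmitter k) * p.dataRate i k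
            * p.fP .transmitter a i k c) := by
  refine ⟨fun i j c => ?_, fun k => ?_, fun k => ?_⟩
  · have hint := net.integrable_linkDensity o a i j c
    have hmain : ∀ B : Set ℝ, MeasurableSet B →
        μ.real (⋃ n : ℕ, net.mainLink o a (o.selecting i j) (o.selected i j, n) c B)
          = p.assocProb o a i j c * ∫ y in B, p.mainPDF o a i j c y := by
      intro B hB
      have h := p.assocProb_mul_setIntegral hint (fun _ => 1) B
      simp only [one_mul] at h
      rw [h, net.measureReal_iUnion_mainLink o a i j c hB]
    refine ⟨?_, ?_, hmain, fun s hs => ⟨?_, fun B hB => ?_⟩, ?_, fun B hB => ?_⟩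
    · rw [net.measureReal_iUnion_mainLink o a i j c MeasurableSet.univ, setIntegral_univ,
        p.assocProb_eq]
    · exact hint.div_const _
    · exact p.integrable_mul_mainPDF (net.integrable_lapTotal_mul_linkDensity o a hs.le i j c)
    · rw [p.assocProb_mul_setIntegral hint]
      exact net.hasSum_setIntegral_mainLink o a hs.le i j c hB
    · exact p.integrable_mul_mainPDF (net.integrable_condSTP_mul_linkDensity o a i j c)
    · rw [p.assocProb_mul_setIntegral hint, ← net.toReal_tsum_measure_succeeds o a i j c hB,
        measureReal_def, net.measure_iUnion_mainLink_inter o a _ _ c hB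
          fun n => net.measurableSet_succeeds o _ _]
  · rw [net.stp_eq_sum]
    cases o <;> exact Finset.sum_congr rfl fun l _ => Finset.sum_congr rfl fun c _ =>
      (net.fP_eq _ a _ _ c).symm
  · cases o
    · refine (congrArg (p.dens .rx k * ·) (net.integral_rate .receiver a k)).trans ?_
      simp only [Finset.mul_sum]
      refine Finset.sum_congr rfl fun l _ => ?_
      rw [Finset.sum_mul, Finset.mul_sum]
      refine Finset.sum_congr rfl fun c _ => ?_
      rw [net.fP_eq .receiver a k l c]
      -- `totalDens - candDens` is the density of the nodes with the selecting role.
      simp only [MAN.Params.totalDens, MAN.Params.candDens, MAN.Subject.candRole,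
        MAN.Subject.selecting, MAN.Subject.selected, MAN.Subject.rxNode, MAN.Subject.txNode,
        MAN.Network.layerOf, Option.elim]
      ring
    · refine (congrArg (p.dens .tx k * ·) (net.integral_rate .transmitter a k)).trans ?_
      simp only [Finset.mul_sum]
      refine Finset.sum_congr rfl fun l _ => ?_
      rw [Finset.sum_mul, Finset.mul_sum]
      refine Finset.sum_congr rfl fun c _ => ?_
      rw [net.fP_eq .transmitter a l k c]
      simp only [MAN.Params.totalDens, MAN.Params.candDens, MAN.Subject.candRole,
        MAN.Subject.selecting, MAN.Subject.selected, MAN.Subject.rxNode, MAN.Subject.txNode,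
        MAN.Network.layerOf, Option.elim]
      ring
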